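/- Let $k$ be a commutative ring, $\Gamma$ an abelian group with a symmetric bilinear form $\langle\ ,\ \rangle\colon\Gamma\times\Gamma\to\mathbb Z/2$, and $\iota\in\Gamma$ with $\langle\iota,\iota\rangle=1$. All dg modules over $k$ are $\Gamma$-graded with differentials of degree $\iota$, with the usual Koszul signs given by $\langle\ ,\ \rangle$. For a dg category $\mathcal C$ write $\langle X|Y\rangle=\operatorname{Hom}_{\mathcal C}(Y,X)$. The two-sided bar complex of $\mathcal C$ is the $(\mathcal C,\mathcal C)$-bimodule $$\operatorname{Bar}(\mathcal C)(Y,Y')=\bigoplus_{r\ge 0}\ \bigoplus_{X_0,\dots,X_r} q^{-r\iota}\,\langle Y|X_0\rangle\otimes\langle X_0|X_1\rangle\otimes\cdots\otimes\langle X_{r-1}|X_r\rangle\otimes\langle X_r|Y'\rangle ,$$ where $X_0,\dots,X_r$ run over all objects of $\mathcal C$ and $q^{-r\iota}$ is the shift for which $[f_0,\dots,f_{r+1}]:=f_0\otimes\cdots\otimes f_{r+1}$ has degree $\sum_i|f_i|-r\iota$. The bimodule structure is $g\cdot[f_0,\dots,f_{r+1}]\cdot g'=(-1)^{r\langle\iota,|g|\rangle}[g\circ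 f_0,f_1,\dots,f_r,f_{r+1}\circ g']$, and the differential is $$d[f_0,\dots,f_{r+1}]=\sum_{i=0}^{r+1}(-1)^{r+\langle\iota,|f_0|+\cdots+|f_{i-1}|\rangle}[f_0,\dots,d(f_i),\dots,f_{r+1}]+\sum_{i=0}^{r}(-1)^i[f_0,\dots,f_i\circ f_{i+1},\dots,f_{r+1}],$$ where the second sum is omitted for $r=0$. The additive envelope $\mathbf A(\mathcal C)$ is the dg category whose objects are formal finite direct sums $\mathbf X=\bigoplus_{a\in A}X_a$ of objects of $\mathcal C$ ($A$ a finite set), and whose morphisms $\bigoplus_{b\in B}Y_b\to\bigoplus_{a\in A}X_a$ are the matrices $(f_{a,b})$ with $f_{a,b}\in\operatorname{Hom}_{\mathcal C}(Y_b,X_a)$, with matrix multiplication as composition and degrees and differentials taken entrywise. It contains $\mathcal C$ as the full subcategory of one-term sums; let $\sigma_a\colon X_a\to\mathbf X$ and $\pi_a\colon\mathbf X\to X_a$ be the inclusions and projections of the summands. Consider composable morphisms $\mathbf X_{-1}\xleftarrow{\mathbf f_0}\mathbf X_0\leftarrow\cdots\leftarrow\mathbf X_r\xleftarrow{\mathbf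 f_{r+1}}\mathbf X_{r+1}$ in $\mathbf A(\mathcal C)$ with $\mathbf X_u=\bigoplus_{a\in A_u}X_a$, and put $f_{a,a'}=\pi_a\circ\mathbf f_u\circ\sigma_{a'}$ for $(a,a')\in A_{u-1}\times A_u$. Then the formula $$\Xi_{\mathbf A}\big([\mathbf f_0,\dots,\mathbf f_{r+1}]\big)=\sum_{(a_{-1},\dots,a_{r+1})\in A_{-1}\times\cdots\times A_{r+1}}\sigma_{a_{-1}}\cdot\big[f_{a_{-1},a_0},f_{a_0,a_1},\dots,f_{a_r,a_{r+1}}\big]\cdot\pi_{a_{r+1}}$$ determines a unique well-defined family of $k$-linear maps, and this family is a closed degree-zero map of $(\mathbf A(\mathcal C),\mathbf A(\mathcal C))$-bimodules $$\Xi_{\mathbf A}\colon \operatorname{Bar}(\mathbf A(\mathcal C))\longrightarrow \mathbf A(\mathcal C)\otimes_{\mathcal C}\operatorname{Bar}(\mathcal C)\otimes_{\mathcal C}\mathbf A(\mathcal C),$$ where $\otimes_{\mathcal C}$ is the (underived) tensor product of dg bimodules. Moreover $\Xi_{\mathbf A}$ is a homotopy equivalence of bimodules: there is a closed degree-zero bimodule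 map in the other direction such that both composites differ from the identities by differentials of bimodule maps of degree $-\iota$. -/

import Mathlib

open scoped TensorProduct DirectSum

universe uk ug u v w u' v' w' w'' t

/-! ## Gradings and signs -/

/-- The grading data: an abelian group `Γ`, a symmetric bilinear form `Γ × Γ → ℤ/2`, and an
element `ι` with `⟨ι, ι⟩ = 1`, the degree of all differentials. -/
structure SignedGrading (Γ : Type ug) [AddCommGroup Γ] where
  pairing : Γ →+ Γ →+ ZMod 2
  symm : ∀ i j, pairing i j = pairing j i
  ι : Γ
  pairing_ι : pairing ι ι = 1

namespace SignedGrading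

variable {Γ : Type ug} [AddCommGroup Γ] (k : Type uk) [CommRing k] (G : SignedGrading Γ)

/-- The sign `(-1) ^ ⟨i, j⟩`. -/
def sgn (i j : Γ) : k := (-1) ^ (G.pairing i j).val

theorem neg_one_pow_val_add (x y : ZMod 2) :
    (-1 : k) ^ (x + y).val = (-1) ^ x.val * (-1) ^ y.val := by
  have h : ∀ x y : ZMod 2, (x + y).val % 2 = (x.val + y.val) % 2 := by decide
  rw [← pow_add, neg_one_pow_eq_pow_mod_two, h, ← neg_one_pow_eq_pow_mod_two]

theorem sgn_add_right (i j l : Γ) : G.sgn k i (j + l) = G.sgn k i j * G.sgn k i l := by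
  simp only [sgn, map_add, neg_one_pow_val_add]

theorem sgn_add_left (i j l : Γ) : G.sgn k (i + j) l = G.sgn k i l * G.sgn k j l := by
  simp only [sgn, map_add, AddMonoidHom.add_apply, neg_one_pow_val_add]

theorem sgn_comm (i j : Γ) : G.sgn k i j = G.sgn k j i := by
  simp only [sgn, G.symm i j]

@[simp] theorem sgn_zero_left (i : Γ) : G.sgn k 0 i = 1 := by simp [sgn]

@[simp] theorem sgn_zero_right (i : Γ) : G.sgn k i 0 = 1 := by simp [sgn]

@[simp] theorem sgn_ι_ι : G.sgn k G.ι G.ι = -1 := by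
  simp [sgn, G.pairing_ι, ZMod.val_one]

@[simp] theorem sgn_mul_self (i j : Γ) : G.sgn k i j * G.sgn k i j = 1 := by
  simp only [sgn, ← pow_add, ← two_mul, pow_mul]
  simp

theorem sgn_neg_left (i j : Γ) : G.sgn k (-i) j = G.sgn k i j := by
  have h : ∀ x : ZMod 2, -x = x := by decide
  simp [sgn, h]

theorem sgn_neg_right (i j : Γ) : G.sgn k i (-j) = G.sgn k i j := by
  have h : ∀ x : ZMod 2, -x = x := by decide
  simp [sgn, h]

theorem sgn_nsmul_ι_ι (r : ℕ) : G.sgn k (r • G.ι) G.ι = (-1) ^ r := by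
  induction r with
  | zero => simp
  | succ r ih => rw [succ_nsmul, sgn_add_left, ih, sgn_ι_ι, pow_succ]

end SignedGrading

/-! ## Linear maps into and out of direct sums -/

section DirectSumMaps

variable {k : Type uk} [CommRing k] {κ : Type u} {V : κ → Type v}
  [∀ i, AddCommGroup (V i)] [∀ i, Module k (V i)] {W : Type w} [AddCommGroup W] [Module k W]

/-- The inclusion of a summand. -/
noncomputable def dsIn (k : Type uk) [CommRing k] {κ : Type u} (V : κ → Type v)
    [∀ i, AddCommGroup (V i)] [∀ i, Module k (V i)] (i : κ) : V i →ₗ[k] ⨁ i, V i :=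
  letI := Classical.decEq κ
  DirectSum.lof k κ V i

/-- The linear map out of a direct sum with given restrictions to the summands. -/
noncomputable def dsOut (f : ∀ i, V i →ₗ[k] W) : (⨁ i, V i) →ₗ[k] W :=
  letI := Classical.decEq κ
  DirectSum.toModule k κ W f

@[simp] theorem dsOut_dsIn (f : ∀ i, V i →ₗ[k] W) (i : κ) (x : V i) :
    dsOut f (dsIn k V i x) = f i x := by
  classical
  exact DirectSum.toModule_lof k i x

theorem ds_ext {f g : (⨁ i, V i) →ₗ[k] W} (h : ∀ i x, f (dsIn k V i x) = g (dsIn k V i x)) :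
    f = g := by
  classical
  let _ := Classical.decEq κ
  exact DirectSum.linearMap_ext k fun i => LinearMap.ext fun x => h i x

theorem ds_induction (k : Type uk) [CommRing k] {κ : Type u} {V : κ → Type v}
    [∀ i, AddCommGroup (V i)] [∀ i, Module k (V i)] {p : (⨁ i, V i) → Prop} (h0 : p 0) (hin : ∀ i x, p (dsIn k V i x))
    (hadd : ∀ x y, p x → p y → p (x + y)) (x : ⨁ i, V i) : p x := by
  let _ := Classical.decEq κ
  exact DirectSum.induction_on x h0 hin hadd

end DirectSumMaps

/-- A family of submodules is independent as soon as a linear map to finitely supported functions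
separates its members. -/
theorem iSupIndep_of_components {k : Type uk} [CommRing k] {Γ : Type ug} {V : Type v}
    [AddCommGroup V] [Module k V] (gr : Γ → Submodule k V) (P : V →ₗ[k] (Γ →₀ V))
    (h : ∀ i, ∀ x ∈ gr i, P x = Finsupp.single i x) : iSupIndep gr := by
  intro i
  rw [Submodule.disjoint_def]
  intro x hx hx'
  have h1 : (⨆ (j : Γ) (_ : j ≠ i), gr j) ≤ LinearMap.ker (Finsupp.lapply i ∘ₗ P) := by
    refine iSup₂_le fun j hj y hy => ?_
    simp [h j y hy, Finsupp.single_eq_of_ne (Ne.symm hj)]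
  have h2 := h1 hx'
  simpa [h i x hx] using h2

/-! ## Differential graded modules -/

/-- A differential `Γ`-graded `k`-module, as a module that is the direct sum of its homogeneous
components `grade i`, with a square-zero differential of degree `ι`. -/
structure DGModule (k : Type uk) [CommRing k] {Γ : Type ug} [AddCommGroup Γ]
    (G : SignedGrading Γ) where
  carrier : Type v
  [addCommGroup : AddCommGroup carrier]
  [module : Module k carrier]
  grade : Γ → Submodule k carrier
  indep : iSupIndep grade
  iSup_grade : ⨆ i, grade i = ⊤
  d : carrier →ₗ[k] carrier
  d_mem : ∀ {i : Γ} {x : carrier}, x ∈ grade i → d x ∈ grade (i + G.ι)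
  d_d : ∀ x, d (d x) = 0

namespace DGModule

variable {k : Type uk} [CommRing k] {Γ : Type ug} [AddCommGroup Γ] {G : SignedGrading Γ}

instance : CoeSort (DGModule.{uk, ug, v} k G) (Type v) := ⟨DGModule.carrier⟩

attribute [instance] DGModule.addCommGroup DGModule.module

theorem induction (M : DGModule.{uk, ug, v} k G) {p : M → Prop} (h0 : p 0)
    (hin : ∀ i, ∀ x ∈ M.grade i, p x) (hadd : ∀ x y, p x → p y → p (x + y)) (x : M) : p x := by
  have hx : x ∈ ⨆ i, M.grade i := by rw [M.iSup_grade]; trivial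
  exact Submodule.iSup_induction (motive := p) _ hx hin h0 hadd

theorem ext_homogeneous (M : DGModule.{uk, ug, v} k G) {W : Type w} [AddCommGroup W] [Module k W]
    {f g : M →ₗ[k] W} (h : ∀ i, ∀ x ∈ M.grade i, f x = g x) : f = g := by
  ext x
  induction x using M.induction with
  | h0 => simp
  | hin i x hx => exact h i x hx
  | hadd x y hx hy => simp [hx, hy]

theorem bijective_coe (M : DGModule.{uk, ug, v} k G) [DecidableEq Γ] :
    Function.Bijective (DirectSum.coeLinearMap M.grade) :=
  (DirectSum.isInternal_submodule_iff_iSupIndep_and_iSup_eq_top _).2 ⟨M.indep, M.iSup_grade⟩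

/-- The homogeneous components of an element. -/
noncomputable def components (M : DGModule.{uk, ug, v} k G) : M →ₗ[k] (Γ →₀ M) :=
  letI := Classical.decEq Γ
  DirectSum.toModule k Γ (Γ →₀ M) (fun i => Finsupp.lsingle i ∘ₗ (M.grade i).subtype) ∘ₗ
    (LinearEquiv.ofBijective (DirectSum.coeLinearMap M.grade)
      M.bijective_coe).symm.toLinearMap

theorem components_of_mem (M : DGModule.{uk, ug, v} k G) {i : Γ} {x : M} (hx : x ∈ M.grade i) :
    M.components x = Finsupp.single i x := by
  let _ := Classical.decEq Γ
  have : (LinearEquiv.ofBijective (DirectSum.coeLinearMap M.grade)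
      M.bijective_coe).symm x = DirectSum.lof k Γ (fun i => M.grade i) i ⟨x, hx⟩ := by
    rw [LinearEquiv.symm_apply_eq]
    simp
  simp only [components, LinearMap.comp_apply, LinearEquiv.coe_coe]
  rw [this, DirectSum.toModule_lof]
  simp

/-- The linear map that multiplies elements `x` of degree `|x|` by the sign `(-1) ^ ⟨j, |x|⟩`. -/
noncomputable def koszul (M : DGModule.{uk, ug, v} k G) (j : Γ) : M →ₗ[k] M :=
  (Finsupp.lsum ℕ fun i => G.sgn k j i • LinearMap.id) ∘ₗ M.components

theorem koszul_of_mem (M : DGModule.{uk, ug, v} k G) (j : Γ) {i : Γ} {x : M}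
    (hx : x ∈ M.grade i) : M.koszul j x = G.sgn k j i • x := by
  simp [koszul, M.components_of_mem hx]

theorem koszul_mem (M : DGModule.{uk, ug, v} k G) (j : Γ) {i : Γ} {x : M}
    (hx : x ∈ M.grade i) : M.koszul j x ∈ M.grade i := by
  rw [M.koszul_of_mem j hx]
  exact Submodule.smul_mem _ _ hx

@[simp] theorem koszul_koszul (M : DGModule.{uk, ug, v} k G) (j : Γ) (x : M) :
    M.koszul j (M.koszul j x) = x := by
  have : M.koszul j ∘ₗ M.koszul j = LinearMap.id := M.ext_homogeneous fun i x hx => by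
    simp [M.koszul_of_mem j hx, smul_smul]
  exact LinearMap.congr_fun this x

theorem koszul_add (M : DGModule.{uk, ug, v} k G) (i j : Γ) (x : M) :
    M.koszul (i + j) x = M.koszul i (M.koszul j x) := by
  have : M.koszul (i + j) = M.koszul i ∘ₗ M.koszul j := M.ext_homogeneous fun l x hx => by
    simp [M.koszul_of_mem _ hx, smul_smul, SignedGrading.sgn_add_left, mul_comm]
  exact LinearMap.congr_fun this x

@[simp] theorem koszul_zero (M : DGModule.{uk, ug, v} k G) (x : M) : M.koszul 0 x = x := by
  have : M.koszul 0 = LinearMap.id := M.ext_homogeneous fun l x hx => by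
    simp [M.koszul_of_mem _ hx]
  exact LinearMap.congr_fun this x

theorem koszul_d (M : DGModule.{uk, ug, v} k G) (j : Γ) (x : M) :
    M.koszul j (M.d x) = G.sgn k j G.ι • M.d (M.koszul j x) := by
  have : M.koszul j ∘ₗ M.d = G.sgn k j G.ι • (M.d ∘ₗ M.koszul j) :=
    M.ext_homogeneous fun l x hx => by
      simp [M.koszul_of_mem _ hx, M.koszul_of_mem _ (M.d_mem hx), smul_smul, SignedGrading.sgn_add_right,
        mul_comm]
  exact LinearMap.congr_fun this x

/-- The tensor product over `k`, with `d (x ⊗ y) = d x ⊗ y + (-1) ^ ⟨ι, |x|⟩ x ⊗ d y`. -/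
noncomputable def tensor (M : DGModule.{uk, ug, v} k G) (N : DGModule.{uk, ug, w} k G) :
    DGModule.{uk, ug, max v w} k G where
  carrier := M ⊗[k] N
  grade n := Submodule.span k
    {z | ∃ i j, i + j = n ∧ ∃ x ∈ M.grade i, ∃ y ∈ N.grade j, z = x ⊗ₜ[k] y}
  indep := by
    classical
    refine iSupIndep_of_components _
      (Finsupp.lmapDomain (M ⊗[k] N) k (fun p : Γ × Γ => p.1 + p.2) ∘ₗ
        (finsuppTensorFinsupp k k M N Γ Γ).toLinearMap ∘ₗ
        TensorProduct.map M.components N.components) ?_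
    intro n z hz
    induction hz using Submodule.span_induction with
    | mem z hz =>
      obtain ⟨i, j, rfl, x, hx, y, hy, rfl⟩ := hz
      simp [M.components_of_mem hx, N.components_of_mem hy, Finsupp.mapDomain_single]
    | zero => simp
    | add x y _ _ hx hy => rw [map_add, hx, hy, Finsupp.single_add]
    | smul a x _ hx => rw [map_smul, hx, Finsupp.smul_single]
  iSup_grade := by
    rw [eq_top_iff, ← TensorProduct.span_tmul_eq_top, Submodule.span_le]
    rintro z ⟨x, y, rfl⟩
    change x ⊗ₜ[k] y ∈ _
    induction x using M.induction with
    | h0 => rw [TensorProduct.zero_tmul]; exact Submodule.zero_mem _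
    | hadd x x' hx hx' => rw [TensorProduct.add_tmul]; exact Submodule.add_mem _ hx hx'
    | hin i x hx =>
      induction y using N.induction with
      | h0 => rw [TensorProduct.tmul_zero]; exact Submodule.zero_mem _
      | hadd y y' hy hy' => rw [TensorProduct.tmul_add]; exact Submodule.add_mem _ hy hy'
      | hin j y hy =>
        exact Submodule.mem_iSup_of_mem (i + j)
          (Submodule.subset_span ⟨i, j, rfl, x, hx, y, hy, rfl⟩)
  d := TensorProduct.map M.d LinearMap.id + TensorProduct.map (M.koszul G.ι) N.d
  d_mem := by
    intro n z hz
    induction hz using Submodule.span_induction with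
    | mem z hz =>
      obtain ⟨i, j, rfl, x, hx, y, hy, rfl⟩ := hz
      simp only [LinearMap.add_apply, TensorProduct.map_tmul, LinearMap.id_apply]
      refine Submodule.add_mem _ (Submodule.subset_span ?_) (Submodule.subset_span ?_)
      · exact ⟨i + G.ι, j, by abel, _, M.d_mem hx, y, hy, rfl⟩
      · exact ⟨i, j + G.ι, by abel, _, M.koszul_mem _ hx, _, N.d_mem hy, rfl⟩
    | zero => simp
    | add x y _ _ hx hy => rw [map_add]; exact Submodule.add_mem _ hx hy
    | smul a x _ hx => rw [map_smul]; exact Submodule.smul_mem _ _ hx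
  d_d := by
    intro z
    induction z using TensorProduct.induction_on with
    | zero => simp
    | add x y hx hy => rw [map_add, map_add, hx, hy, add_zero]
    | tmul x y =>
      simp [M.d_d, N.d_d, M.koszul_d, TensorProduct.neg_tmul]

/-- The simple tensor `x ⊗ y`. -/
noncomputable def tmul {M : DGModule.{uk, ug, v} k G} {N : DGModule.{uk, ug, w} k G} :
    M →ₗ[k] N →ₗ[k] M.tensor N :=
  (TensorProduct.mk k M N : M.carrier →ₗ[k] N.carrier →ₗ[k] (M.carrier ⊗[k] N.carrier))

theorem tmul_mem {M : DGModule.{uk, ug, v} k G} {N : DGModule.{uk, ug, w} k G} {i j : Γ}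
    {x : M} {y : N} (hx : x ∈ M.grade i) (hy : y ∈ N.grade j) :
    tmul x y ∈ (M.tensor N).grade (i + j) :=
  Submodule.subset_span (R := k) (M := M.carrier ⊗[k] N.carrier)
    ⟨i, j, rfl, x, hx, y, hy, rfl⟩

theorem tensor_grade_le {M : DGModule.{uk, ug, v} k G} {N : DGModule.{uk, ug, w} k G} {n : Γ}
    {S : Submodule k (M.tensor N)}
    (h : ∀ i j, i + j = n → ∀ x ∈ M.grade i, ∀ y ∈ N.grade j, tmul x y ∈ S) :
    (M.tensor N).grade n ≤ S := by
  refine Submodule.span_le.2 ?_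
  rintro z ⟨i, j, hij, x, hx, y, hy, rfl⟩
  exact h i j hij x hx y hy

/-- The linear map out of a tensor product given by a bilinear map. -/
noncomputable def tlift {M : DGModule.{uk, ug, v} k G} {N : DGModule.{uk, ug, w} k G}
    {W : Type w'} [AddCommGroup W] [Module k W] (f : M →ₗ[k] N →ₗ[k] W) : M.tensor N →ₗ[k] W :=
  TensorProduct.lift f

@[simp] theorem tlift_tmul {M : DGModule.{uk, ug, v} k G} {N : DGModule.{uk, ug, w} k G}
    {W : Type w'} [AddCommGroup W] [Module k W] (f : M →ₗ[k] N →ₗ[k] W) (x : M) (y : N) :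
    tlift f (tmul x y) = f x y :=
  TensorProduct.lift.tmul x y

theorem tensor_ext {M : DGModule.{uk, ug, v} k G} {N : DGModule.{uk, ug, w} k G}
    {W : Type w'} [AddCommGroup W] [Module k W] {f g : M.tensor N →ₗ[k] W}
    (h : ∀ x y, f (tmul x y) = g (tmul x y)) : f = g :=
  TensorProduct.ext' h

/-- A linear map applied to the first factor of a tensor product, linearly in the map. -/
noncomputable def tmapLeft {M : DGModule.{uk, ug, v} k G} {M' : DGModule.{uk, ug, v'} k G}
    {N : DGModule.{uk, ug, w} k G} : (M →ₗ[k] M') →ₗ[k] M.tensor N →ₗ[k] M'.tensor N :=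
  (LinearMap.rTensorHom N.carrier : (M.carrier →ₗ[k] M'.carrier) →ₗ[k]
    (M.carrier ⊗[k] N.carrier) →ₗ[k] (M'.carrier ⊗[k] N.carrier))

@[simp] theorem tmapLeft_tmul {M : DGModule.{uk, ug, v} k G} {M' : DGModule.{uk, ug, v'} k G}
    {N : DGModule.{uk, ug, w} k G} (a : M →ₗ[k] M') (x : M) (y : N) :
    tmapLeft a (tmul x y) = tmul (a x) y :=
  rfl

/-- A linear map applied to the second factor of a tensor product, linearly in the map. -/
noncomputable def tmapRight {M : DGModule.{uk, ug, v} k G} {N : DGModule.{uk, ug, w} k G}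
    {N' : DGModule.{uk, ug, w'} k G} : (N →ₗ[k] N') →ₗ[k] M.tensor N →ₗ[k] M.tensor N' :=
  (LinearMap.lTensorHom M.carrier : (N.carrier →ₗ[k] N'.carrier) →ₗ[k]
    (M.carrier ⊗[k] N.carrier) →ₗ[k] (M.carrier ⊗[k] N'.carrier))

@[simp] theorem tmapRight_tmul {M : DGModule.{uk, ug, v} k G} {N : DGModule.{uk, ug, w} k G}
    {N' : DGModule.{uk, ug, w'} k G} (a : N →ₗ[k] N') (x : M) (y : N) :
    tmapRight a (tmul x y) = tmul x (a y) :=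
  rfl

theorem tensor_d_tmul {M : DGModule.{uk, ug, v} k G} {N : DGModule.{uk, ug, w} k G}
    (x : M) (y : N) :
    (M.tensor N).d (tmul x y) = tmul (M.d x) y + tmul (M.koszul G.ι x) (N.d y) :=
  rfl

theorem tensor_koszul_tmul {M : DGModule.{uk, ug, v} k G} {N : DGModule.{uk, ug, w} k G}
    (l : Γ) (x : M) (y : N) :
    (M.tensor N).koszul l (tmul x y) = tmul (M.koszul l x) (N.koszul l y) := by
  induction x using M.induction with
  | h0 => simp
  | hadd x x' hx hx' => simp [hx, hx']
  | hin i x hx =>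
    induction y using N.induction with
    | h0 => simp
    | hadd y y' hy hy' => simp [hy, hy']
    | hin j y hy =>
      simp [koszul_of_mem _ _ (tmul_mem hx hy), koszul_of_mem _ _ hx, koszul_of_mem _ _ hy,
        SignedGrading.sgn_add_right, smul_smul, mul_comm]

/-- The direct sum of a family. -/
noncomputable def directSum {κ : Type u} (M : κ → DGModule.{uk, ug, v} k G) :
    DGModule.{uk, ug, max u v} k G where
  carrier := ⨁ a, (M a).carrier
  grade n := Submodule.span k {z | ∃ a, ∃ x ∈ (M a).grade n, z = dsIn k (fun a => (M a).carrier) a x}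
  indep := by
    refine iSupIndep_of_components _
      (dsOut fun a => Finsupp.mapRange.linearMap (dsIn k (fun a => (M a).carrier) a) ∘ₗ
        (M a).components) ?_
    intro n z hz
    induction hz using Submodule.span_induction with
    | mem z hz =>
      obtain ⟨a, x, hx, rfl⟩ := hz
      simp [(M a).components_of_mem hx]
    | zero => simp
    | add x y _ _ hx hy => rw [map_add, hx, hy, Finsupp.single_add]
    | smul a x _ hx => rw [map_smul, hx, Finsupp.smul_single]
  iSup_grade := by
    rw [eq_top_iff]
    rintro z -
    refine ds_induction k (Submodule.zero_mem _) (fun a x => ?_)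
      (fun x y hx hy => Submodule.add_mem _ hx hy) z
    · induction x using (M a).induction with
      | h0 => rw [map_zero]; exact Submodule.zero_mem _
      | hadd x y hx hy => rw [map_add]; exact Submodule.add_mem _ hx hy
      | hin i x hx =>
        exact Submodule.mem_iSup_of_mem i (Submodule.subset_span ⟨a, x, hx, rfl⟩)
  d := dsOut fun a => dsIn k (fun a => (M a).carrier) a ∘ₗ (M a).d
  d_mem := by
    intro n z hz
    induction hz using Submodule.span_induction with
    | mem z hz =>
      obtain ⟨a, x, hx, rfl⟩ := hz
      rw [dsOut_dsIn]
      exact Submodule.subset_span ⟨a, _, (M a).d_mem hx, rfl⟩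
    | zero => simp
    | add x y _ _ hx hy => rw [map_add]; exact Submodule.add_mem _ hx hy
    | smul a x _ hx => rw [map_smul]; exact Submodule.smul_mem _ _ hx
  d_d := by
    intro z
    refine ds_induction k (p := fun z => dsOut _ (dsOut _ z) = 0) (by simp) (fun a x => ?_)
      (fun x y hx hy => by rw [map_add, map_add, hx, hy, add_zero]) z
    rw [dsOut_dsIn, LinearMap.comp_apply, dsOut_dsIn, LinearMap.comp_apply, (M a).d_d, map_zero]

/-- The grading shift `q ^ j M`, with `(q ^ j M) ^ i = M ^ (i - j)` and the differential
multiplied by `(-1) ^ ⟨j, ι⟩`. -/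
def shift (M : DGModule.{uk, ug, v} k G) (j : Γ) : DGModule.{uk, ug, v} k G where
  carrier := M
  grade i := M.grade (i - j)
  indep := M.indep.comp (sub_left_injective (b := j))
  iSup_grade := by
    rw [← M.iSup_grade]
    exact (Equiv.subRight j).iSup_congr fun _ => rfl
  d := G.sgn k j G.ι • M.d
  d_mem := by
    intro i x hx
    have h := M.d_mem hx
    rw [sub_add_eq_add_sub] at h
    exact Submodule.smul_mem _ _ h
  d_d x := by simp [M.d_d]

/-- The inclusion of a summand into a direct sum of dg modules. -/
noncomputable def inSum {κ : Type u} (M : κ → DGModule.{uk, ug, v} k G) (a : κ) :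
    M a →ₗ[k] directSum M :=
  dsIn k (fun a => (M a).carrier) a

/-- Linear maps out of a direct sum of dg modules. -/
noncomputable def outSum {κ : Type u} {M : κ → DGModule.{uk, ug, v} k G} {W : Type w}
    [AddCommGroup W] [Module k W] (f : ∀ a, M a →ₗ[k] W) : directSum M →ₗ[k] W :=
  dsOut (V := fun a => (M a).carrier) f

@[simp] theorem outSum_inSum {κ : Type u} {M : κ → DGModule.{uk, ug, v} k G} {W : Type w}
    [AddCommGroup W] [Module k W] (f : ∀ a, M a →ₗ[k] W) (a : κ) (x : M a) :
    outSum f (inSum M a x) = f a x :=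
  dsOut_dsIn (V := fun a => (M a).carrier) f a x

theorem directSum_ext {κ : Type u} {M : κ → DGModule.{uk, ug, v} k G} {W : Type w}
    [AddCommGroup W] [Module k W] {f g : directSum M →ₗ[k] W}
    (h : ∀ a x, f (inSum M a x) = g (inSum M a x)) : f = g :=
  ds_ext (V := fun a => (M a).carrier) h

theorem inSum_mem {κ : Type u} {M : κ → DGModule.{uk, ug, v} k G} {n : Γ} {a : κ} {x : M a}
    (hx : x ∈ (M a).grade n) : inSum M a x ∈ (directSum M).grade n :=
  Submodule.subset_span (R := k) (M := ⨁ a, (M a).carrier) ⟨a, x, hx, rfl⟩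

theorem directSum_grade_le {κ : Type u} {M : κ → DGModule.{uk, ug, v} k G} {n : Γ}
    {S : Submodule k (directSum M)} (h : ∀ a, ∀ x ∈ (M a).grade n, inSum M a x ∈ S) :
    (directSum M).grade n ≤ S := by
  refine Submodule.span_le.2 ?_
  rintro _ ⟨a, x, hx, rfl⟩
  exact h a x hx

theorem directSum_d_inSum {κ : Type u} {M : κ → DGModule.{uk, ug, v} k G} (a : κ) (x : M a) :
    (directSum M).d (inSum M a x) = inSum M a ((M a).d x) :=
  dsOut_dsIn (V := fun a => (M a).carrier) _ a x

/-- The identity map, from `M` to a shift of `M`. -/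
def toShift (M : DGModule.{uk, ug, v} k G) (j : Γ) : M ≃ₗ[k] M.shift j :=
  LinearEquiv.refl k M.carrier

theorem toShift_mem (M : DGModule.{uk, ug, v} k G) {i j : Γ} {x : M} :
    M.toShift j x ∈ (M.shift j).grade i ↔ x ∈ M.grade (i - j) :=
  Iff.rfl

theorem shift_d_toShift (M : DGModule.{uk, ug, v} k G) (j : Γ) (x : M) :
    (M.shift j).d (M.toShift j x) = M.toShift j (G.sgn k j G.ι • M.d x) :=
  rfl

/-- The dg module with the same graded module and the differential twisted by `a`. -/
def twist (M : DGModule.{uk, ug, v} k G) (a : M →ₗ[k] M)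
    (ha : ∀ {i : Γ} {x : M}, x ∈ M.grade i → a x ∈ M.grade (i + G.ι))
    (hda : ∀ x, M.d (a x) + a (M.d x) + a (a x) = 0) : DGModule.{uk, ug, v} k G where
  carrier := M
  grade := M.grade
  indep := M.indep
  iSup_grade := M.iSup_grade
  d := M.d + a
  d_mem hx := Submodule.add_mem _ (M.d_mem hx) (ha hx)
  d_d x := by
    have h := hda x
    simp only [LinearMap.add_apply, map_add, M.d_d, zero_add]
    rw [← h]; abel

/-- The quotient by a submodule that is stable under the differential and generated by
homogeneous elements. -/
noncomputable def quotient (M : DGModule.{uk, ug, v} k G) (S : Submodule k M)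
    (hS : S ≤ Submodule.span k {z | z ∈ S ∧ ∃ i, z ∈ M.grade i})
    (hd : S ≤ S.comap M.d) : DGModule.{uk, ug, v} k G where
  carrier := M ⧸ S
  grade n := (M.grade n).map S.mkQ
  indep := by
    refine iSupIndep_of_components _
      (S.liftQ (Finsupp.mapRange.linearMap S.mkQ ∘ₗ M.components) ?_) ?_
    · refine hS.trans (Submodule.span_le.2 ?_)
      rintro z ⟨hz, i, hi⟩
      have : S.mkQ z = 0 := by simpa using hz
      rw [SetLike.mem_coe, LinearMap.mem_ker, LinearMap.comp_apply, M.components_of_mem hi,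
        Finsupp.mapRange.linearMap_apply, Finsupp.mapRange_single, this, Finsupp.single_zero]
    · rintro n _ ⟨z, hz, rfl⟩
      rw [Submodule.mkQ_apply, Submodule.liftQ_apply, LinearMap.comp_apply,
        M.components_of_mem hz, Finsupp.mapRange.linearMap_apply, Finsupp.mapRange_single]
      rfl
  iSup_grade := by
    rw [← Submodule.map_iSup, M.iSup_grade, Submodule.map_top, Submodule.range_mkQ]
  d := S.mapQ S M.d hd
  d_mem := by
    rintro i _ ⟨z, hz, rfl⟩
    exact ⟨M.d z, M.d_mem hz, rfl⟩
  d_d := by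
    intro z
    obtain ⟨z, rfl⟩ := S.mkQ_surjective z
    simp [M.d_d]

section quotient

variable {M : DGModule.{uk, ug, v} k G} {S : Submodule k M}
  {hS : S ≤ Submodule.span k {z | z ∈ S ∧ ∃ i, z ∈ M.grade i}} {hd : S ≤ S.comap M.d}
  {W : Type w} [AddCommGroup W] [Module k W]

/-- The projection to a quotient. -/
noncomputable def qmk (hS : S ≤ Submodule.span k {z | z ∈ S ∧ ∃ i, z ∈ M.grade i})
    (hd : S ≤ S.comap M.d) : M →ₗ[k] M.quotient S hS hd :=
  S.mkQ

/-- Linear maps out of a quotient. -/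
noncomputable def qlift (f : M →ₗ[k] W) (hf : S ≤ LinearMap.ker f) :
    M.quotient S hS hd →ₗ[k] W :=
  S.liftQ f hf

theorem qlift_qmk (f : M →ₗ[k] W) (hf : S ≤ LinearMap.ker f) (x : M) :
    qlift (hS := hS) (hd := hd) f hf (qmk hS hd x) = f x :=
  rfl

theorem qmk_eq_zero {x : M} (hx : x ∈ S) : qmk hS hd x = 0 :=
  (Submodule.Quotient.mk_eq_zero S).2 hx

theorem quotient_ext {f g : M.quotient S hS hd →ₗ[k] W}
    (h : ∀ x, f (qmk hS hd x) = g (qmk hS hd x)) : f = g :=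
  Submodule.linearMap_qext S (LinearMap.ext h)

theorem quotient_d_qmk (x : M) : (M.quotient S hS hd).d (qmk hS hd x) = qmk hS hd (M.d x) :=
  rfl

theorem qmk_mem {i : Γ} {x : M} (hx : x ∈ M.grade i) :
    qmk hS hd x ∈ (M.quotient S hS hd).grade i :=
  ⟨x, hx, rfl⟩

theorem quotient_grade_le {i : Γ} {T : Submodule k (M.quotient S hS hd)}
    (h : ∀ x ∈ M.grade i, qmk hS hd x ∈ T) : (M.quotient S hS hd).grade i ≤ T := by
  rintro _ ⟨x, hx, rfl⟩
  exact h x hx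

end quotient

/-- Matrices with entries in a finite family (the direct sum of the `M a b`). -/
def matrix {A : Type u} {B : Type w} [Fintype A] [Fintype B]
    (M : A → B → DGModule.{uk, ug, v} k G) : DGModule.{uk, ug, max u v w} k G where
  carrier := ∀ a b, (M a b).carrier
  grade n :=
    { carrier := {f | ∀ a b, f a b ∈ (M a b).grade n}
      add_mem' := fun hf hg a b => Submodule.add_mem _ (hf a b) (hg a b)
      zero_mem' := fun a b => Submodule.zero_mem _
      smul_mem' := fun c f hf a b => Submodule.smul_mem _ c (hf a b) }
  indep := by
    intro n
    rw [Submodule.disjoint_def]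
    intro f hf hf'
    funext a b
    have key := Submodule.disjoint_def.1 ((M a b).indep n) (f a b) (hf a b)
    refine key ?_
    let e : (∀ a b, (M a b).carrier) →ₗ[k] (M a b).carrier :=
      LinearMap.proj (φ := fun b => (M a b).carrier) b ∘ₗ
        LinearMap.proj (φ := fun a => ∀ b, (M a b).carrier) a
    have : f ∈ (⨆ (j : Γ) (_ : j ≠ n), (M a b).grade j).comap e := by
      refine SetLike.le_def.1 (iSup₂_le fun j hj g hg => ?_) hf'
      exact Submodule.mem_iSup_of_mem j (Submodule.mem_iSup_of_mem hj (hg a b))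
    exact this
  iSup_grade := by
    classical
    rw [eq_top_iff]
    rintro f -
    have hf : f = ∑ a, ∑ b, Pi.single a (Pi.single b (f a b)) := by
      funext a b
      simp only [Finset.sum_apply]
      rw [Finset.sum_eq_single a, Finset.sum_eq_single b]
      · simp
      · intro b' _ hb'
        simp [Pi.single_eq_of_ne (Ne.symm hb')]
      · simp
      · intro a' _ ha'
        refine Finset.sum_eq_zero fun b' _ => ?_
        rw [Pi.single_eq_of_ne (Ne.symm ha')]; rfl
      · simp
    rw [hf]
    refine Submodule.sum_mem _ fun a _ => Submodule.sum_mem _ fun b _ => ?_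
    induction f a b using (M a b).induction with
    | h0 => simp
    | hadd x y hx hy => rw [Pi.single_add, Pi.single_add]; exact Submodule.add_mem _ hx hy
    | hin i x hx =>
      refine Submodule.mem_iSup_of_mem i fun a' b' => ?_
      by_cases ha : a' = a
      · subst ha
        by_cases hb : b' = b
        · subst hb; simpa using hx
        · simp [Pi.single_eq_of_ne hb]
      · rw [Pi.single_eq_of_ne ha]; exact Submodule.zero_mem _
  d :=
    { toFun := fun f a b => (M a b).d (f a b)
      map_add' := fun f g => by funext a b; simp
      map_smul' := fun c f => by funext a b; simp }
  d_mem hf a b := (M a b).d_mem (hf a b)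
  d_d f := by funext a b; exact (M a b).d_d _

/-- The entries of a matrix. -/
def entry {A : Type u} {B : Type w} [Fintype A] [Fintype B]
    {M : A → B → DGModule.{uk, ug, v} k G} (a : A) (b : B) : matrix M →ₗ[k] M a b :=
  LinearMap.proj (φ := fun b => (M a b).carrier) b ∘ₗ
    LinearMap.proj (φ := fun a => ∀ b, (M a b).carrier) a

/-- The matrix with given entries. -/
def ofEntries {A : Type u} {B : Type w} [Fintype A] [Fintype B]
    {M : A → B → DGModule.{uk, ug, v} k G} (f : ∀ a b, M a b) : matrix M :=
  f

section matrix

variable {A : Type u} {B : Type w} [Fintype A] [Fintype B] {M : A → B → DGModule.{uk, ug, v} k G}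

@[simp] theorem entry_ofEntries (f : ∀ a b, M a b) (a : A) (b : B) :
    entry a b (ofEntries f) = f a b :=
  rfl

theorem matrix_ext {f g : matrix M} (h : ∀ a b, entry a b f = entry a b g) : f = g :=
  funext fun a => funext fun b => h a b

theorem mem_matrix_grade {n : Γ} {f : matrix M} :
    f ∈ (matrix M).grade n ↔ ∀ a b, entry a b f ∈ (M a b).grade n :=
  Iff.rfl

theorem entry_d (f : matrix M) (a : A) (b : B) :
    entry a b ((matrix M).d f) = (M a b).d (entry a b f) :=
  rfl

end matrix

end DGModule

/-! ## Differential graded categories and bimodules -/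

/-- A differential `Γ`-graded category. The complex `hom X Y` is `⟨X|C|Y⟩`, that is, the complex of
morphisms from `Y` to `X`; composition is a chain map `⟨X|C|Y⟩ ⊗ ⟨Y|C|Z⟩ → ⟨X|C|Z⟩`. -/
structure DGCategory (k : Type uk) [CommRing k] {Γ : Type ug} [AddCommGroup Γ]
    (G : SignedGrading Γ) where
  Obj : Type u
  hom : Obj → Obj → DGModule.{uk, ug, v} k G
  comp : ∀ {X Y Z : Obj}, hom X Y →ₗ[k] hom Y Z →ₗ[k] hom X Z
  one : ∀ X : Obj, hom X X
  comp_mem : ∀ {X Y Z : Obj} {i j : Γ} {f : hom X Y} {g : hom Y Z},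
    f ∈ (hom X Y).grade i → g ∈ (hom Y Z).grade j → comp f g ∈ (hom X Z).grade (i + j)
  one_mem : ∀ X : Obj, one X ∈ (hom X X).grade 0
  d_comp : ∀ {X Y Z : Obj} {i : Γ} {f : hom X Y} (g : hom Y Z), f ∈ (hom X Y).grade i →
    (hom X Z).d (comp f g) = comp ((hom X Y).d f) g + G.sgn k G.ι i • comp f ((hom Y Z).d g)
  assoc : ∀ {X Y Z W : Obj} (f : hom X Y) (g : hom Y Z) (h : hom Z W),
    comp (comp f g) h = comp f (comp g h)
  one_comp : ∀ {X Y : Obj} (f : hom X Y), comp (one X) f = f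
  comp_one : ∀ {X Y : Obj} (f : hom X Y), comp f (one Y) = f

/-- A `(C, D)`-bimodule `M`, given by dg modules `obj X Y = ⟨X|M|Y⟩` and commuting unital and
associative actions `⟨X'|C|X⟩ ⊗ ⟨X|M|Y⟩ → ⟨X'|M|Y⟩` and `⟨X|M|Y⟩ ⊗ ⟨Y|D|Y'⟩ → ⟨X|M|Y'⟩`
by chain maps. -/
structure DGBimodule {k : Type uk} [CommRing k] {Γ : Type ug} [AddCommGroup Γ]
    {G : SignedGrading Γ} (C : DGCategory.{uk, ug, u, v} k G)
    (D : DGCategory.{uk, ug, u', v'} k G) where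
  obj : C.Obj → D.Obj → DGModule.{uk, ug, w} k G
  lact : ∀ {X X' : C.Obj} {Y : D.Obj}, C.hom X' X →ₗ[k] obj X Y →ₗ[k] obj X' Y
  ract : ∀ {X : C.Obj} {Y Y' : D.Obj}, obj X Y →ₗ[k] D.hom Y Y' →ₗ[k] obj X Y'
  lact_mem : ∀ {X X' : C.Obj} {Y : D.Obj} {i j : Γ} {f : C.hom X' X} {m : obj X Y},
    f ∈ (C.hom X' X).grade i → m ∈ (obj X Y).grade j → lact f m ∈ (obj X' Y).grade (i + j)
  ract_mem : ∀ {X : C.Obj} {Y Y' : D.Obj} {i j : Γ} {m : obj X Y} {g : D.hom Y Y'},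
    m ∈ (obj X Y).grade i → g ∈ (D.hom Y Y').grade j → ract m g ∈ (obj X Y').grade (i + j)
  d_lact : ∀ {X X' : C.Obj} {Y : D.Obj} {i : Γ} {f : C.hom X' X} (m : obj X Y),
    f ∈ (C.hom X' X).grade i → (obj X' Y).d (lact f m) =
      lact ((C.hom X' X).d f) m + G.sgn k G.ι i • lact f ((obj X Y).d m)
  d_ract : ∀ {X : C.Obj} {Y Y' : D.Obj} {i : Γ} {m : obj X Y} (g : D.hom Y Y'),
    m ∈ (obj X Y).grade i → (obj X Y').d (ract m g) =
      ract ((obj X Y).d m) g + G.sgn k G.ι i • ract m ((D.hom Y Y').d g)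
  comp_lact : ∀ {X X' X'' : C.Obj} {Y : D.Obj} (f : C.hom X'' X') (f' : C.hom X' X) (m : obj X Y),
    lact (C.comp f f') m = lact f (lact f' m)
  ract_comp : ∀ {X : C.Obj} {Y Y' Y'' : D.Obj} (m : obj X Y) (g : D.hom Y Y') (g' : D.hom Y' Y''),
    ract m (D.comp g g') = ract (ract m g) g'
  lact_ract : ∀ {X X' : C.Obj} {Y Y' : D.Obj} (f : C.hom X' X) (m : obj X Y) (g : D.hom Y Y'),
    lact f (ract m g) = ract (lact f m) g
  one_lact : ∀ {X : C.Obj} {Y : D.Obj} (m : obj X Y), lact (C.one X) m = m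
  ract_one : ∀ {X : C.Obj} {Y : D.Obj} (m : obj X Y), ract m (D.one Y) = m

namespace DGCategory

variable {k : Type uk} [CommRing k] {Γ : Type ug} [AddCommGroup Γ] {G : SignedGrading Γ}
  (C : DGCategory.{uk, ug, u, v} k G)

theorem d_comp_koszul {X Y Z : C.Obj} (f : C.hom X Y) (g : C.hom Y Z) :
    (C.hom X Z).d (C.comp f g) =
      C.comp ((C.hom X Y).d f) g + C.comp ((C.hom X Y).koszul G.ι f) ((C.hom Y Z).d g) := by
  induction f using (C.hom X Y).induction with
  | h0 => simp
  | hadd f f' hf hf' => simp only [map_add, LinearMap.add_apply, hf, hf']; abel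
  | hin i f hf => rw [C.d_comp g hf, DGModule.koszul_of_mem _ _ hf]; simp

theorem koszul_comp (l : Γ) {X Y Z : C.Obj} (f : C.hom X Y) (g : C.hom Y Z) :
    (C.hom X Z).koszul l (C.comp f g) =
      C.comp ((C.hom X Y).koszul l f) ((C.hom Y Z).koszul l g) := by
  induction f using (C.hom X Y).induction with
  | h0 => simp
  | hadd f f' hf hf' => simp only [map_add, LinearMap.add_apply, hf, hf']
  | hin i f hf =>
    induction g using (C.hom Y Z).induction with
    | h0 => simp
    | hadd g g' hg hg' => simp only [map_add, hg, hg']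
    | hin j g hg =>
      simp [DGModule.koszul_of_mem _ _ hf, DGModule.koszul_of_mem _ _ hg,
        DGModule.koszul_of_mem _ _ (C.comp_mem hf hg), SignedGrading.sgn_add_right, smul_smul,
        mul_comm]

/-- The identity bimodule. -/
def idBimodule : DGBimodule.{uk, ug, u, v, v, u, v} C C where
  obj := C.hom
  lact := C.comp
  ract := C.comp
  lact_mem := C.comp_mem
  ract_mem := C.comp_mem
  d_lact := C.d_comp
  d_ract := C.d_comp
  comp_lact := C.assoc
  ract_comp m g g' := (C.assoc m g g').symm
  lact_ract f m g := (C.assoc f m g).symm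
  one_lact := C.one_comp
  ract_one := C.comp_one

/-! ### The bar complex -/

/-- For a list `X₀, …, Xᵣ` of objects, the tensor product
`⟨Y|X₀⟩ ⊗ ⟨X₀|X₁⟩ ⊗ ⋯ ⊗ ⟨Xᵣ₋₁|Xᵣ⟩ ⊗ ⟨Xᵣ|Y'⟩`; for the empty list, `⟨Y|Y'⟩`. -/
noncomputable def barTensor : C.Obj → List C.Obj → C.Obj → DGModule.{uk, ug, v} k G
  | Y, [], Y' => C.hom Y Y'
  | Y, X :: L, Y' => (C.hom Y X).tensor (barTensor X L Y')

/-- Composable sequences `Y ← X₀ ← ⋯ ← Xᵣ ← Y'` of morphisms through a given list of objects. -/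
def Sequence : C.Obj → List C.Obj → C.Obj → Type v
  | Y, [], Y' => C.hom Y Y'
  | Y, X :: L, Y' => C.hom Y X × Sequence X L Y'

/-- The map `f, t ↦ f ⊗ t`. -/
noncomputable def tcons {Y X Y' : C.Obj} (L : List C.Obj) :
    C.hom Y X →ₗ[k] C.barTensor X L Y' →ₗ[k] C.barTensor Y (X :: L) Y' :=
  DGModule.tmul (M := C.hom Y X) (N := C.barTensor X L Y')

/-- The simple tensor `f₀ ⊗ f₁ ⊗ ⋯` of a composable sequence. -/
noncomputable def simpleTensor : (Y : C.Obj) → (L : List C.Obj) → (Y' : C.Obj) →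
    C.Sequence Y L Y' → C.barTensor Y L Y'
  | _, [], _, f => f
  | _, X :: L, Y', f => C.tcons L f.1 (simpleTensor X L Y' f.2)

/-- Composition into the first tensor factor, `g, f₀ ⊗ f₁ ⊗ ⋯ ↦ (g ∘ f₀) ⊗ f₁ ⊗ ⋯`. -/
noncomputable def barLeft : {Y X : C.Obj} → (L : List C.Obj) → {Y' : C.Obj} →
    C.hom Y X →ₗ[k] C.barTensor X L Y' →ₗ[k] C.barTensor Y L Y'
  | _, _, [], _ => C.comp
  | _, _, _ :: _, _ => DGModule.tmapLeft ∘ₗ C.comp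

/-- Composition into the last tensor factor, `g, ⋯ ⊗ fᵣ ⊗ fᵣ₊₁ ↦ ⋯ ⊗ fᵣ ⊗ (fᵣ₊₁ ∘ g)`. -/
noncomputable def barRight : {Y : C.Obj} → (L : List C.Obj) → {Y' Y'' : C.Obj} →
    C.hom Y' Y'' →ₗ[k] C.barTensor Y L Y' →ₗ[k] C.barTensor Y L Y''
  | _, [], _, _ => C.comp.flip
  | _, _ :: L, _, _ => DGModule.tmapRight ∘ₗ barRight L

/-- The direct sum of the tensor products `barTensor Y L Y'` over all lists `L`. -/
abbrev BarSum (Y Y' : C.Obj) : Type (max u v) := ⨁ L : List C.Obj, (C.barTensor Y L Y').carrier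

/-- The inclusion of the summand of a list. -/
noncomputable def sumIn {Y Y' : C.Obj} (L : List C.Obj) : C.barTensor Y L Y' →ₗ[k] C.BarSum Y Y' :=
  dsIn k (fun L => (C.barTensor Y L Y').carrier) L

/-- The map `f, f₀ ⊗ f₁ ⊗ ⋯ ↦ f ⊗ f₀ ⊗ f₁ ⊗ ⋯`. -/
noncomputable def barCons {Y X Y' : C.Obj} : C.hom Y X →ₗ[k] C.BarSum X Y' →ₗ[k] C.BarSum Y Y' :=
  LinearMap.flip (dsOut fun L =>
    ((C.tcons L).compr₂ (C.sumIn (Y := Y) (Y' := Y') (X :: L))).flip)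

/-- The alternating sum of the contractions of adjacent factors,
`f₀ ⊗ ⋯ ⊗ fᵣ₊₁ ↦ ∑ (-1) ^ i f₀ ⊗ ⋯ ⊗ (fᵢ ∘ fᵢ₊₁) ⊗ ⋯ ⊗ fᵣ₊₁` over `0 ≤ i ≤ r`. -/
noncomputable def contract : {Y : C.Obj} → (L : List C.Obj) → {Y' : C.Obj} →
    C.barTensor Y L Y' →ₗ[k] C.BarSum Y Y'
  | _, [], _ => 0
  | _, _ :: L, _ =>
    DGModule.tlift ((C.barLeft L).compr₂ (C.sumIn L) - (C.barCons.flip ∘ₗ contract L).flip)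

section

variable {Y X X' Y' Y'' Z : C.Obj} {L : List C.Obj}

theorem tcons_mem {i j : Γ} {f : C.hom X Z} {t : C.barTensor Z L Y'}
    (hf : f ∈ (C.hom X Z).grade i) (ht : t ∈ (C.barTensor Z L Y').grade j) :
    C.tcons L f t ∈ (C.barTensor X (Z :: L) Y').grade (i + j) :=
  DGModule.tmul_mem hf ht

theorem barTensor_grade_le {n : Γ} {S : Submodule k (C.barTensor X (Z :: L) Y')}
    (h : ∀ i j, i + j = n → ∀ f ∈ (C.hom X Z).grade i, ∀ t ∈ (C.barTensor Z L Y').grade j,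
      C.tcons L f t ∈ S) :
    (C.barTensor X (Z :: L) Y').grade n ≤ S :=
  DGModule.tensor_grade_le h

theorem barLeft_tmul (g : C.hom Y X) (f : C.hom X Z) (t : C.barTensor Z L Y') :
    C.barLeft (Z :: L) g (C.tcons L f t) = C.tcons L (C.comp g f) t :=
  rfl

theorem barRight_tmul (g : C.hom Y' Y'') (f : C.hom X Z) (t : C.barTensor Z L Y') :
    C.barRight (Z :: L) g (C.tcons L f t) = C.tcons L f (C.barRight L g t) :=
  rfl

theorem barCons_sumIn (f : C.hom Y X) (t : C.barTensor X L Y') :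
    C.barCons f (C.sumIn L t) = C.sumIn (X :: L) (C.tcons L f t) := by
  simp [barCons, sumIn, LinearMap.compr₂_apply]

theorem contract_tmul (f : C.hom X Z) (t : C.barTensor Z L Y') :
    C.contract (Z :: L) (C.tcons L f t) =
      C.sumIn L (C.barLeft L f t) - C.barCons f (C.contract L t) := by
  rw [contract]
  exact DGModule.tlift_tmul (M := C.hom X Z) (N := C.barTensor Z L Y') _ _ _

/-- To prove a linear statement about tensor products over a nonempty list. -/
theorem barTensor_ext {W : Type w} [AddCommGroup W] [Module k W]
    {a b : C.barTensor X (Z :: L) Y' →ₗ[k] W}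
    (h : ∀ (f : C.hom X Z) (t : C.barTensor Z L Y'), a (C.tcons L f t) = b (C.tcons L f t)) :
    a = b :=
  DGModule.tensor_ext h

theorem barTensor_d_tmul (f : C.hom X Z) (t : C.barTensor Z L Y') :
    (C.barTensor X (Z :: L) Y').d (C.tcons L f t) =
      C.tcons L ((C.hom X Z).d f) t +
        C.tcons L ((C.hom X Z).koszul G.ι f) ((C.barTensor Z L Y').d t) :=
  rfl

theorem barTensor_koszul_tmul (l : Γ) (f : C.hom X Z) (t : C.barTensor Z L Y') :
    (C.barTensor X (Z :: L) Y').koszul l (C.tcons L f t) =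
      C.tcons L ((C.hom X Z).koszul l f) ((C.barTensor Z L Y').koszul l t) :=
  DGModule.tensor_koszul_tmul l f t

theorem barLeft_comp (g : C.hom Y X) (g' : C.hom X X') (t : C.barTensor X' L Y') :
    C.barLeft L (C.comp g g') t = C.barLeft L g (C.barLeft L g' t) := by
  cases L with
  | nil => exact C.assoc g g' t
  | cons Z L =>
    refine LinearMap.congr_fun (f := C.barLeft (Z :: L) (C.comp g g'))
      (g := C.barLeft (Z :: L) g ∘ₗ C.barLeft (Z :: L) g') (C.barTensor_ext fun f t => ?_) t
    simp only [LinearMap.comp_apply, barLeft_tmul, C.assoc]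

theorem barLeft_one (t : C.barTensor X L Y') : C.barLeft L (C.one X) t = t := by
  cases L with
  | nil => exact C.one_comp t
  | cons Z L =>
    refine LinearMap.congr_fun (f := C.barLeft (Z :: L) (C.one X))
      (g := LinearMap.id) (C.barTensor_ext fun f t => ?_) t
    simp only [LinearMap.id_apply, barLeft_tmul, C.one_comp]

theorem barRight_comp {Y''' : C.Obj} (g : C.hom Y' Y'') (g' : C.hom Y'' Y''')
    (t : C.barTensor X L Y') :
    C.barRight L (C.comp g g') t = C.barRight L g' (C.barRight L g t) := by
  induction L generalizing X with
  | nil => exact (C.assoc t g g').symm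
  | cons Z L ih =>
    refine LinearMap.congr_fun (f := C.barRight (Z :: L) (C.comp g g'))
      (g := C.barRight (Z :: L) g' ∘ₗ C.barRight (Z :: L) g) (C.barTensor_ext fun f t => ?_) t
    simp only [LinearMap.comp_apply, barRight_tmul, ih]

theorem barRight_one (t : C.barTensor X L Y') : C.barRight L (C.one Y') t = t := by
  induction L generalizing X with
  | nil => exact C.comp_one t
  | cons Z L ih =>
    refine LinearMap.congr_fun (f := C.barRight (Z :: L) (C.one Y'))
      (g := LinearMap.id) (C.barTensor_ext fun f t => ?_) t
    simp only [LinearMap.id_apply, barRight_tmul, ih]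

theorem barLeft_barRight (g : C.hom Y X) (t : C.barTensor X L Y') (g' : C.hom Y' Y'') :
    C.barLeft L g (C.barRight L g' t) = C.barRight L g' (C.barLeft L g t) := by
  cases L with
  | nil => exact (C.assoc g t g').symm
  | cons Z L =>
    refine LinearMap.congr_fun (f := C.barLeft (Z :: L) g ∘ₗ C.barRight (Z :: L) g')
      (g := C.barRight (Z :: L) g' ∘ₗ C.barLeft (Z :: L) g) (C.barTensor_ext fun f t => ?_) t
    simp only [LinearMap.comp_apply, barLeft_tmul, barRight_tmul]

theorem barLeft_mem {i j : Γ} {g : C.hom Y X} {t : C.barTensor X L Y'}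
    (hg : g ∈ (C.hom Y X).grade i) (ht : t ∈ (C.barTensor X L Y').grade j) :
    C.barLeft L g t ∈ (C.barTensor Y L Y').grade (i + j) := by
  cases L with
  | nil => exact C.comp_mem hg ht
  | cons Z L =>
    refine C.barTensor_grade_le
      (S := ((C.barTensor Y (Z :: L) Y').grade (i + j)).comap (C.barLeft (Z :: L) g)) ?_ ht
    rintro a b rfl f hf t ht
    rw [Submodule.mem_comap, barLeft_tmul, ← add_assoc]
    exact C.tcons_mem (C.comp_mem hg hf) ht

theorem barRight_mem {i j : Γ} {g : C.hom Y' Y''} {t : C.barTensor X L Y'}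
    (ht : t ∈ (C.barTensor X L Y').grade i) (hg : g ∈ (C.hom Y' Y'').grade j) :
    C.barRight L g t ∈ (C.barTensor X L Y'').grade (i + j) := by
  induction L generalizing X i with
  | nil => exact C.comp_mem ht hg
  | cons Z L ih =>
    refine C.barTensor_grade_le
      (S := ((C.barTensor X (Z :: L) Y'').grade (i + j)).comap (C.barRight (Z :: L) g)) ?_ ht
    rintro a b rfl f hf t ht
    rw [Submodule.mem_comap, barRight_tmul, add_assoc]
    exact C.tcons_mem hf (ih ht)

theorem barTensor_d_left (g : C.hom Y X) (t : C.barTensor X L Y') :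
    (C.barTensor Y L Y').d (C.barLeft L g t) =
      C.barLeft L ((C.hom Y X).d g) t +
        C.barLeft L ((C.hom Y X).koszul G.ι g) ((C.barTensor X L Y').d t) := by
  cases L with
  | nil => exact C.d_comp_koszul g t
  | cons Z L =>
    refine LinearMap.congr_fun (f := (C.barTensor Y (Z :: L) Y').d ∘ₗ C.barLeft (Z :: L) g)
      (g := C.barLeft (Z :: L) ((C.hom Y X).d g) +
        C.barLeft (Z :: L) ((C.hom Y X).koszul G.ι g) ∘ₗ (C.barTensor X (Z :: L) Y').d)
      (C.barTensor_ext fun f t => ?_) t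
    simp only [LinearMap.comp_apply, LinearMap.add_apply, barLeft_tmul, barTensor_d_tmul,
      C.d_comp_koszul, C.koszul_comp, map_add]
    abel

theorem barTensor_d_right (t : C.barTensor X L Y') (g : C.hom Y' Y'') :
    (C.barTensor X L Y'').d (C.barRight L g t) =
      C.barRight L g ((C.barTensor X L Y').d t) +
        C.barRight L ((C.hom Y' Y'').d g) ((C.barTensor X L Y').koszul G.ι t) := by
  induction L generalizing X with
  | nil => exact C.d_comp_koszul t g
  | cons Z L ih =>
    refine LinearMap.congr_fun (f := (C.barTensor X (Z :: L) Y'').d ∘ₗ C.barRight (Z :: L) g)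
      (g := C.barRight (Z :: L) g ∘ₗ (C.barTensor X (Z :: L) Y').d +
        C.barRight (Z :: L) ((C.hom Y' Y'').d g) ∘ₗ (C.barTensor X (Z :: L) Y').koszul G.ι)
      (C.barTensor_ext fun f t => ?_) t
    simp only [LinearMap.comp_apply, LinearMap.add_apply, barRight_tmul, barTensor_d_tmul,
      barTensor_koszul_tmul, map_add, ih]
    abel

/-- A family of linear maps applied to all summands. -/
noncomputable def sumMap (a : ∀ L, C.barTensor X L Y' →ₗ[k] C.barTensor Y L Y'') :
    C.BarSum X Y' →ₗ[k] C.BarSum Y Y'' :=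
  dsOut fun L => C.sumIn L ∘ₗ a L

theorem sumMap_sumIn (a : ∀ L, C.barTensor X L Y' →ₗ[k] C.barTensor Y L Y'')
    (t : C.barTensor X L Y') : C.sumMap a (C.sumIn L t) = C.sumIn L (a L t) := by
  simp [sumMap, sumIn]

/-- The alternating sum of contractions on all summands. -/
noncomputable def sumContract : C.BarSum X Y' →ₗ[k] C.BarSum X Y' :=
  dsOut fun L => C.contract L

theorem sumContract_sumIn (t : C.barTensor X L Y') :
    C.sumContract (C.sumIn L t) = C.contract L t := by
  simp [sumContract, sumIn]

theorem barSum_ext {W : Type w} [AddCommGroup W] [Module k W] {a b : C.BarSum X Y' →ₗ[k] W}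
    (h : ∀ L t, a (C.sumIn L t) = b (C.sumIn L t)) : a = b :=
  ds_ext h

theorem contract_left (g : C.hom Y X) (t : C.barTensor X L Y') :
    C.contract L (C.barLeft L g t) = C.sumMap (fun L => C.barLeft L g) (C.contract L t) := by
  cases L with
  | nil => simp [contract]
  | cons Z L =>
    refine LinearMap.congr_fun (f := C.contract (Z :: L) ∘ₗ C.barLeft (Z :: L) g)
      (g := C.sumMap (fun L => C.barLeft L g) ∘ₗ C.contract (Z :: L))
      (C.barTensor_ext fun f t => ?_) t
    have h : C.barCons (C.comp g f) =
        C.sumMap (fun L => C.barLeft (Y' := Y') L g) ∘ₗ C.barCons f :=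
      C.barSum_ext fun L t => by
        simp only [LinearMap.comp_apply, barCons_sumIn, sumMap_sumIn, barLeft_tmul]
    simp only [LinearMap.comp_apply, barLeft_tmul, contract_tmul, map_sub, sumMap_sumIn,
      barLeft_comp, h]

theorem contract_right (t : C.barTensor X L Y') (g : C.hom Y' Y'') :
    C.contract L (C.barRight L g t) = C.sumMap (fun L => C.barRight L g) (C.contract L t) := by
  induction L generalizing X with
  | nil => simp [contract]
  | cons Z L ih =>
    refine LinearMap.congr_fun (f := C.contract (Z :: L) ∘ₗ C.barRight (Z :: L) g)
      (g := C.sumMap (fun L => C.barRight L g) ∘ₗ C.contract (Z :: L))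
      (C.barTensor_ext fun f t => ?_) t
    have h : C.barCons f ∘ₗ C.sumMap (fun L => C.barRight L g) =
        C.sumMap (fun L => C.barRight L g) ∘ₗ C.barCons f :=
      C.barSum_ext fun L t => by
        simp only [LinearMap.comp_apply, barCons_sumIn, sumMap_sumIn, barRight_tmul]
    have h' := LinearMap.congr_fun h (C.contract L t)
    simp only [LinearMap.comp_apply] at h'
    simp only [LinearMap.comp_apply, barRight_tmul, contract_tmul, map_sub, sumMap_sumIn,
      barLeft_barRight, ih, h']

theorem contract_d (t : C.barTensor X L Y') :
    C.contract L ((C.barTensor X L Y').d t) =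
      C.sumMap (fun L => (C.barTensor X L Y').d) (C.contract L t) := by
  induction L generalizing X with
  | nil => simp [contract]
  | cons Z L ih =>
    refine LinearMap.congr_fun (f := C.contract (Z :: L) ∘ₗ (C.barTensor X (Z :: L) Y').d)
      (g := C.sumMap (fun L => (C.barTensor X L Y').d) ∘ₗ C.contract (Z :: L))
      (C.barTensor_ext fun f t => ?_) t
    have h : C.sumMap (fun L => (C.barTensor X L Y').d) ∘ₗ C.barCons f =
        C.barCons ((C.hom X Z).d f) + C.barCons ((C.hom X Z).koszul G.ι f) ∘ₗ
          C.sumMap (fun L => (C.barTensor Z L Y').d) :=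
      C.barSum_ext fun L t => by
        simp only [LinearMap.comp_apply, LinearMap.add_apply, barCons_sumIn, sumMap_sumIn,
          barTensor_d_tmul, map_add]
    have h' := LinearMap.congr_fun h (C.contract L t)
    simp only [LinearMap.comp_apply, LinearMap.add_apply] at h'
    simp only [LinearMap.comp_apply, barTensor_d_tmul, contract_tmul, map_add, map_sub,
      sumMap_sumIn, barTensor_d_left, ih, h']
    abel

theorem contract_contract (t : C.barTensor X L Y') : C.sumContract (C.contract L t) = 0 := by
  induction L generalizing X with
  | nil => simp [contract]
  | cons Z L ih =>
    refine LinearMap.congr_fun (f := C.sumContract ∘ₗ C.contract (Z :: L))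
      (g := 0) (C.barTensor_ext fun f t => ?_) t
    have h : C.sumContract ∘ₗ C.barCons (Y' := Y') f =
        C.sumMap (fun L => C.barLeft L f) - C.barCons f ∘ₗ C.sumContract :=
      C.barSum_ext fun L t => by
        simp only [LinearMap.comp_apply, LinearMap.sub_apply, barCons_sumIn, sumMap_sumIn,
          sumContract_sumIn, contract_tmul]
    have h' := LinearMap.congr_fun h (C.contract L t)
    simp only [LinearMap.comp_apply, LinearMap.sub_apply] at h'
    simp only [LinearMap.comp_apply, contract_tmul, map_sub, sumContract_sumIn, contract_left,
      h', ih, map_zero, sub_zero, sub_self, LinearMap.zero_apply]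

theorem contract_mem {n : Γ} {t : C.barTensor X L Y'} (ht : t ∈ (C.barTensor X L Y').grade n) :
    C.contract L t ∈ Submodule.span k {z : C.BarSum X Y' | ∃ L' : List C.Obj,
      L'.length + 1 = L.length ∧ ∃ s ∈ (C.barTensor X L' Y').grade n, z = C.sumIn L' s} := by
  induction L generalizing X n with
  | nil => simp [contract]
  | cons Z L ih =>
    refine C.barTensor_grade_le
      (S := (Submodule.span k _).comap (C.contract (Z :: L))) ?_ ht
    rintro a b rfl f hf t ht
    rw [Submodule.mem_comap, contract_tmul]
    refine Submodule.sub_mem _ (Submodule.subset_span ⟨L, rfl, _, C.barLeft_mem hf ht, rfl⟩) ?_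
    have h := ih ht
    rw [← Submodule.mem_comap]
    refine SetLike.le_def.1 (Submodule.span_le.2 ?_) h
    rintro _ ⟨L', hL', s, hs, rfl⟩
    rw [SetLike.mem_coe, Submodule.mem_comap, barCons_sumIn]
    exact Submodule.subset_span ⟨Z :: L', by simp [hL'], _, C.tcons_mem hf hs, rfl⟩

theorem contract_mem_length (t : C.barTensor X L Y') :
    C.contract L t ∈ Submodule.span k {z : C.BarSum X Y' | ∃ L' : List C.Obj,
      L'.length + 1 = L.length ∧ ∃ s : C.barTensor X L' Y', z = C.sumIn L' s} := by
  induction t using DGModule.induction with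
  | h0 => simp
  | hadd x y hx hy => rw [map_add]; exact Submodule.add_mem _ hx hy
  | hin i x hx =>
    refine Submodule.span_mono ?_ (C.contract_mem hx)
    rintro _ ⟨L', hL', s, -, rfl⟩
    exact ⟨L', hL', s, rfl⟩

end

/-- The direct sum `⨁ q ^ (-r ι) ⟨Y|X₀⟩ ⊗ ⟨X₀|X₁⟩ ⊗ ⋯ ⊗ ⟨Xᵣ|Y'⟩` over `r ≥ 0` and all sequences
`X₀, …, Xᵣ` of objects; such a sequence is given by `X₀` and the list `X₁, …, Xᵣ`. -/
noncomputable def barPre (Y Y' : C.Obj) : DGModule.{uk, ug, max u v} k G :=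
  DGModule.directSum fun p : C.Obj × List C.Obj =>
    (C.barTensor Y (p.1 :: p.2) Y').shift (-(p.2.length • G.ι))

section

variable {Y Y' : C.Obj}

/-- The inclusion of the summand of `X₀, …, Xᵣ`. -/
noncomputable def preIn (X : C.Obj) (L : List C.Obj) :
    C.barTensor Y (X :: L) Y' →ₗ[k] C.barPre Y Y' :=
  DGModule.inSum (fun p : C.Obj × List C.Obj =>
      (C.barTensor Y (p.1 :: p.2) Y').shift (-(p.2.length • G.ι))) (X, L) ∘ₗ
    ((C.barTensor Y (X :: L) Y').toShift (-(L.length • G.ι))).toLinearMap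

/-- Linear maps out of the direct sum. -/
noncomputable def preOut {W : Type w} [AddCommGroup W] [Module k W]
    (a : ∀ X L, C.barTensor Y (X :: L) Y' →ₗ[k] W) : C.barPre Y Y' →ₗ[k] W :=
  DGModule.outSum fun p => a p.1 p.2 ∘ₗ
    ((C.barTensor Y (p.1 :: p.2) Y').toShift (-(p.2.length • G.ι))).symm.toLinearMap

theorem preOut_preIn {W : Type w} [AddCommGroup W] [Module k W]
    (a : ∀ X L, C.barTensor Y (X :: L) Y' →ₗ[k] W) (X : C.Obj) (L : List C.Obj)
    (t : C.barTensor Y (X :: L) Y') : C.preOut a (C.preIn X L t) = a X L t :=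
  DGModule.outSum_inSum _ (X, L) _

theorem barPre_ext {W : Type w} [AddCommGroup W] [Module k W] {a b : C.barPre Y Y' →ₗ[k] W}
    (h : ∀ X L t, a (C.preIn X L t) = b (C.preIn X L t)) : a = b := by
  refine DGModule.directSum_ext fun p x => ?_
  obtain ⟨t, rfl⟩ := ((C.barTensor Y (p.1 :: p.2) Y').toShift (-(p.2.length • G.ι))).surjective x
  exact h p.1 p.2 t

theorem preIn_mem {X : C.Obj} {L : List C.Obj} {i : Γ} {t : C.barTensor Y (X :: L) Y'}
    (ht : t ∈ (C.barTensor Y (X :: L) Y').grade (i + L.length • G.ι)) :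
    C.preIn X L t ∈ (C.barPre Y Y').grade i := by
  refine DGModule.inSum_mem (a := (X, L)) ?_
  rw [← sub_neg_eq_add] at ht
  exact (DGModule.toShift_mem _).2 ht

theorem barPre_grade_le {i : Γ} {S : Submodule k (C.barPre Y Y')}
    (h : ∀ X L, ∀ t ∈ (C.barTensor Y (X :: L) Y').grade (i + L.length • G.ι),
      C.preIn X L t ∈ S) : (C.barPre Y Y').grade i ≤ S := by
  refine DGModule.directSum_grade_le fun p x hx => ?_
  obtain ⟨t, rfl⟩ := ((C.barTensor Y (p.1 :: p.2) Y').toShift (-(p.2.length • G.ι))).surjective x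
  refine h p.1 p.2 t ?_
  rw [← sub_neg_eq_add]
  exact (DGModule.toShift_mem _).1 hx

theorem barPre_d_preIn (X : C.Obj) (L : List C.Obj) (t : C.barTensor Y (X :: L) Y') :
    (C.barPre Y Y').d (C.preIn X L t) =
      (-1 : k) ^ L.length • C.preIn X L ((C.barTensor Y (X :: L) Y').d t) := by
  have h : (C.barPre Y Y').d (C.preIn X L t) = C.preIn X L
      (G.sgn k (-(L.length • G.ι)) G.ι • (C.barTensor Y (X :: L) Y').d t) :=
    DGModule.directSum_d_inSum (X, L) _
  rw [h, map_smul, SignedGrading.sgn_neg_left, SignedGrading.sgn_nsmul_ι_ι]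

/-- The projection that forgets the summand `⟨Y|Y'⟩` of the empty list. -/
noncomputable def truncate : C.BarSum Y Y' →ₗ[k] C.barPre Y Y' :=
  dsOut fun L => match L with
    | [] => 0
    | X :: L => C.preIn X L

theorem truncate_nil (t : C.barTensor Y [] Y') : C.truncate (C.sumIn [] t) = 0 := by
  simp [truncate, sumIn]

theorem truncate_cons (X : C.Obj) (L : List C.Obj) (t : C.barTensor Y (X :: L) Y') :
    C.truncate (C.sumIn (X :: L) t) = C.preIn X L t := by
  simp [truncate, sumIn]

/-- The bar differential `[f₀, …, fᵣ₊₁] ↦ ∑ (-1) ^ i [f₀, …, fᵢ ∘ fᵢ₊₁, …, fᵣ₊₁]` over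
`0 ≤ i ≤ r` for `r ≥ 1`, and zero for `r = 0`. -/
noncomputable def barDelta : C.barPre Y Y' →ₗ[k] C.barPre Y Y' :=
  C.preOut fun X L => C.truncate ∘ₗ C.contract (X :: L)

theorem barDelta_preIn (X : C.Obj) (L : List C.Obj) (t : C.barTensor Y (X :: L) Y') :
    C.barDelta (C.preIn X L t) = C.truncate (C.contract (X :: L) t) :=
  C.preOut_preIn _ X L t

theorem barDelta_truncate (y : C.BarSum Y Y') :
    C.barDelta (C.truncate y) = C.truncate (C.sumContract y) := by
  refine LinearMap.congr_fun (f := C.barDelta ∘ₗ C.truncate) (g := C.truncate ∘ₗ C.sumContract)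
    (C.barSum_ext fun L t => ?_) y
  cases L with
  | nil =>
    simp only [LinearMap.comp_apply, truncate_nil, sumContract_sumIn, contract, map_zero,
      LinearMap.zero_apply]
  | cons X L =>
    simp only [LinearMap.comp_apply, truncate_cons, sumContract_sumIn, barDelta_preIn]

theorem barDelta_mem {i : Γ} {x : C.barPre Y Y'} (hx : x ∈ (C.barPre Y Y').grade i) :
    C.barDelta x ∈ (C.barPre Y Y').grade (i + G.ι) := by
  refine C.barPre_grade_le (S := ((C.barPre Y Y').grade (i + G.ι)).comap C.barDelta) ?_ hx
  intro X L t ht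
  rw [Submodule.mem_comap, barDelta_preIn, ← Submodule.mem_comap]
  refine SetLike.le_def.1 (Submodule.span_le.2 ?_) (C.contract_mem ht)
  rintro _ ⟨L', hL', s, hs, rfl⟩
  rw [SetLike.mem_coe, Submodule.mem_comap]
  cases L' with
  | nil => rw [truncate_nil]; exact Submodule.zero_mem _
  | cons X' L' =>
    rw [truncate_cons]
    refine C.preIn_mem ?_
    have : L.length = L'.length + 1 := by simpa using hL'.symm
    rw [this, succ_nsmul, add_comm (L'.length • G.ι), ← add_assoc] at hs
    exact hs

theorem barPre_d_truncate (X : C.Obj) (L : List C.Obj) (t : C.barTensor Y (X :: L) Y') :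
    (C.barPre Y Y').d (C.truncate (C.contract (X :: L) t)) =
      - ((-1 : k) ^ L.length • C.truncate
        (C.sumMap (fun L => (C.barTensor Y L Y').d) (C.contract (X :: L) t))) := by
  have h : Submodule.span k {z : C.BarSum Y Y' | ∃ L' : List C.Obj,
      L'.length + 1 = (X :: L).length ∧ ∃ s : C.barTensor Y L' Y', z = C.sumIn L' s} ≤
      LinearMap.ker ((C.barPre Y Y').d ∘ₗ C.truncate + (-1 : k) ^ L.length • (C.truncate ∘ₗ
        C.sumMap (fun L => (C.barTensor Y L Y').d))) := by
    refine Submodule.span_le.2 ?_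
    rintro _ ⟨L', hL', s, rfl⟩
    rw [SetLike.mem_coe, LinearMap.mem_ker]
    simp only [LinearMap.add_apply, LinearMap.smul_apply, LinearMap.comp_apply, sumMap_sumIn]
    cases L' with
    | nil => simp only [truncate_nil, map_zero, smul_zero, add_zero]
    | cons X' L' =>
      have : L.length = L'.length + 1 := by simpa using hL'.symm
      rw [truncate_cons, truncate_cons, barPre_d_preIn, this, pow_succ]
      simp
  have h' := h (C.contract_mem_length t)
  rw [LinearMap.mem_ker] at h'
  exact eq_neg_of_add_eq_zero_left h'

theorem barDelta_maurerCartan (x : C.barPre Y Y') :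
    (C.barPre Y Y').d (C.barDelta x) + C.barDelta ((C.barPre Y Y').d x) +
      C.barDelta (C.barDelta x) = 0 := by
  refine LinearMap.congr_fun (f := (C.barPre Y Y').d ∘ₗ C.barDelta +
    C.barDelta ∘ₗ (C.barPre Y Y').d + C.barDelta ∘ₗ C.barDelta) (g := 0)
    (C.barPre_ext fun X L t => ?_) x
  simp only [LinearMap.add_apply, LinearMap.comp_apply, barDelta_preIn, barPre_d_preIn, map_smul,
    barPre_d_truncate, barDelta_truncate, contract_contract, contract_d, map_zero,
    LinearMap.zero_apply]
  simp

/-- The complex `⟨Y|Bar(C)|Y'⟩`. -/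
noncomputable def barComplex (Y Y' : C.Obj) : DGModule.{uk, ug, max u v} k G :=
  (C.barPre Y Y').twist C.barDelta C.barDelta_mem C.barDelta_maurerCartan

/-- The inclusion of the tensor product `⟨Y|X₀⟩ ⊗ ⋯ ⊗ ⟨Xᵣ|Y'⟩` into the bar complex. -/
noncomputable def barIn (X : C.Obj) (L : List C.Obj) :
    C.barTensor Y (X :: L) Y' →ₗ[k] C.barComplex Y Y' :=
  C.preIn X L

/-- Linear maps out of the bar complex. -/
noncomputable def barOut {W : Type w} [AddCommGroup W] [Module k W]
    (a : ∀ X L, C.barTensor Y (X :: L) Y' →ₗ[k] W) : C.barComplex Y Y' →ₗ[k] W :=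
  C.preOut a

theorem barOut_barIn {W : Type w} [AddCommGroup W] [Module k W]
    (a : ∀ X L, C.barTensor Y (X :: L) Y' →ₗ[k] W) (X : C.Obj) (L : List C.Obj)
    (t : C.barTensor Y (X :: L) Y') : C.barOut a (C.barIn X L t) = a X L t :=
  C.preOut_preIn a X L t

theorem bar_ext {W : Type w} [AddCommGroup W] [Module k W] {a b : C.barComplex Y Y' →ₗ[k] W}
    (h : ∀ X L t, a (C.barIn X L t) = b (C.barIn X L t)) : a = b :=
  C.barPre_ext h

theorem barIn_mem {X : C.Obj} {L : List C.Obj} {i : Γ} {t : C.barTensor Y (X :: L) Y'}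
    (ht : t ∈ (C.barTensor Y (X :: L) Y').grade (i + L.length • G.ι)) :
    C.barIn X L t ∈ (C.barComplex Y Y').grade i :=
  C.preIn_mem ht

theorem bar_grade_le {i : Γ} {S : Submodule k (C.barComplex Y Y')}
    (h : ∀ X L, ∀ t ∈ (C.barTensor Y (X :: L) Y').grade (i + L.length • G.ι),
      C.barIn X L t ∈ S) : (C.barComplex Y Y').grade i ≤ S :=
  C.barPre_grade_le h

/-- The part of the bar differential that contracts adjacent factors. -/
noncomputable def barTruncate : C.BarSum Y Y' →ₗ[k] C.barComplex Y Y' :=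
  C.truncate

theorem barTruncate_nil (t : C.barTensor Y [] Y') : C.barTruncate (C.sumIn [] t) = 0 :=
  C.truncate_nil t

theorem barTruncate_cons (X : C.Obj) (L : List C.Obj) (t : C.barTensor Y (X :: L) Y') :
    C.barTruncate (C.sumIn (X :: L) t) = C.barIn X L t :=
  C.truncate_cons X L t

theorem bar_d_barIn (X : C.Obj) (L : List C.Obj) (t : C.barTensor Y (X :: L) Y') :
    (C.barComplex Y Y').d (C.barIn X L t) =
      (-1 : k) ^ L.length • C.barIn X L ((C.barTensor Y (X :: L) Y').d t) +
        C.barTruncate (C.contract (X :: L) t) := by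
  have h : (C.barComplex Y Y').d (C.barIn X L t) =
      ((C.barPre Y Y').d (C.preIn X L t) + C.barDelta (C.preIn X L t) : C.barPre Y Y') := rfl
  rw [h, barPre_d_preIn, barDelta_preIn]
  rfl

variable {X : C.Obj}

/-- The left action `g · [f₀, …, fᵣ₊₁] = (-1) ^ (r ⟨ι, |g|⟩) [g ∘ f₀, f₁, …, fᵣ₊₁]`. -/
noncomputable def barLact : C.hom X Y →ₗ[k] C.barComplex Y Y' →ₗ[k] C.barComplex X Y' :=
  LinearMap.flip (C.barOut fun Z L =>
    ((C.barLeft (Z :: L) ∘ₗ (C.hom X Y).koszul (L.length • G.ι)).compr₂ (C.barIn Z L)).flip)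

/-- The right action `[f₀, …, fᵣ₊₁] · g = [f₀, …, fᵣ, fᵣ₊₁ ∘ g]`. -/
noncomputable def barRact : C.barComplex Y Y' →ₗ[k] C.hom Y' X →ₗ[k] C.barComplex Y X :=
  C.barOut fun Z L => ((C.barRight (Z :: L)).compr₂ (C.barIn Z L)).flip

theorem barLact_barIn (g : C.hom X Y) (Z : C.Obj) (L : List C.Obj)
    (t : C.barTensor Y (Z :: L) Y') : C.barLact g (C.barIn Z L t) =
      C.barIn Z L (C.barLeft (Z :: L) ((C.hom X Y).koszul (L.length • G.ι) g) t) := by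
  rw [barLact, LinearMap.flip_apply, barOut_barIn]
  rfl

theorem barRact_barIn (g : C.hom Y' X) (Z : C.Obj) (L : List C.Obj)
    (t : C.barTensor Y (Z :: L) Y') : C.barRact (C.barIn Z L t) g =
      C.barIn Z L (C.barRight (Z :: L) g t) := by
  rw [barRact, barOut_barIn]
  rfl

theorem barLact_truncate (g : C.hom X Y) (Z : C.Obj) (L : List C.Obj)
    (t : C.barTensor Y (Z :: L) Y') :
    C.barLact ((C.hom X Y).koszul G.ι g) (C.barTruncate (C.contract (Z :: L) t)) =
      C.barTruncate (C.sumMap (fun L' => C.barLeft L' ((C.hom X Y).koszul (L.length • G.ι) g))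
        (C.contract (Z :: L) t)) := by
  have h : Submodule.span k {z : C.BarSum Y Y' | ∃ L' : List C.Obj,
      L'.length + 1 = (Z :: L).length ∧ ∃ s : C.barTensor Y L' Y', z = C.sumIn L' s} ≤
      LinearMap.ker (C.barLact ((C.hom X Y).koszul G.ι g) ∘ₗ C.barTruncate - C.barTruncate ∘ₗ
        C.sumMap (fun L' => C.barLeft L' ((C.hom X Y).koszul (L.length • G.ι) g))) := by
    refine Submodule.span_le.2 ?_
    rintro _ ⟨L', hL', s, rfl⟩
    rw [SetLike.mem_coe, LinearMap.mem_ker]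
    simp only [LinearMap.sub_apply, LinearMap.comp_apply, sumMap_sumIn]
    cases L' with
    | nil => simp only [barTruncate_nil, map_zero, sub_zero]
    | cons X' L' =>
      have : L.length = L'.length + 1 := by simpa using hL'.symm
      rw [barTruncate_cons, barTruncate_cons, barLact_barIn, this, succ_nsmul,
        DGModule.koszul_add, sub_self]
  have h' := h (C.contract_mem_length t)
  rw [LinearMap.mem_ker] at h'
  exact sub_eq_zero.1 h'

theorem barRact_truncate (g : C.hom Y' X) (y : C.BarSum Y Y') :
    C.barRact (C.barTruncate y) g = C.barTruncate (C.sumMap (fun L => C.barRight L g) y) := by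
  refine LinearMap.congr_fun (f := C.barRact.flip g ∘ₗ C.barTruncate)
    (g := C.barTruncate ∘ₗ C.sumMap (fun L => C.barRight L g)) (C.barSum_ext fun L t => ?_) y
  simp only [LinearMap.comp_apply, LinearMap.flip_apply, sumMap_sumIn]
  cases L with
  | nil => simp only [barTruncate_nil, map_zero, LinearMap.zero_apply]
  | cons Z L => rw [barTruncate_cons, barTruncate_cons, barRact_barIn]

theorem bar_d_lact (g : C.hom X Y) (x : C.barComplex Y Y') :
    (C.barComplex X Y').d (C.barLact g x) = C.barLact ((C.hom X Y).d g) x +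
      C.barLact ((C.hom X Y).koszul G.ι g) ((C.barComplex Y Y').d x) := by
  refine LinearMap.congr_fun (f := (C.barComplex X Y').d ∘ₗ C.barLact g)
    (g := C.barLact ((C.hom X Y).d g) +
      C.barLact ((C.hom X Y).koszul G.ι g) ∘ₗ (C.barComplex Y Y').d)
    (C.bar_ext fun Z L t => ?_) x
  have hk : (C.hom X Y).koszul (L.length • G.ι) ((C.hom X Y).koszul G.ι g) =
      (C.hom X Y).koszul G.ι ((C.hom X Y).koszul (L.length • G.ι) g) := by
    rw [← DGModule.koszul_add, ← DGModule.koszul_add, add_comm]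
  simp only [LinearMap.comp_apply, LinearMap.add_apply, barLact_barIn, bar_d_barIn, map_add,
    map_smul, barTensor_d_left, contract_left, barLact_truncate, DGModule.koszul_d,
    SignedGrading.sgn_nsmul_ι_ι, LinearMap.smul_apply, smul_add, hk]
  abel

theorem bar_d_ract {i : Γ} {x : C.barComplex Y Y'} (g : C.hom Y' X)
    (hx : x ∈ (C.barComplex Y Y').grade i) :
    (C.barComplex Y X).d (C.barRact x g) = C.barRact ((C.barComplex Y Y').d x) g +
      G.sgn k G.ι i • C.barRact x ((C.hom Y' X).d g) := by
  have h : (C.barComplex Y Y').grade i ≤ LinearMap.ker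
      ((C.barComplex Y X).d ∘ₗ C.barRact.flip g - (C.barRact.flip g ∘ₗ (C.barComplex Y Y').d +
        G.sgn k G.ι i • C.barRact.flip ((C.hom Y' X).d g))) := by
    refine C.bar_grade_le fun Z L t ht => ?_
    rw [LinearMap.mem_ker]
    have hs : (-1 : k) ^ L.length * G.sgn k G.ι (i + L.length • G.ι) = G.sgn k G.ι i := by
      rw [SignedGrading.sgn_add_right, G.sgn_comm k G.ι (L.length • G.ι),
        SignedGrading.sgn_nsmul_ι_ι, mul_left_comm, ← pow_add, ← two_mul, pow_mul]
      simp
    simp only [LinearMap.comp_apply, LinearMap.add_apply, LinearMap.sub_apply,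
      LinearMap.smul_apply, LinearMap.flip_apply, barRact_barIn, bar_d_barIn, map_add, map_smul,
      barTensor_d_right, contract_right, barRact_truncate, DGModule.koszul_of_mem _ _ ht,
      smul_add, smul_smul, hs]
    abel
  have h' := h hx
  rw [LinearMap.mem_ker] at h'
  exact sub_eq_zero.1 h'

end

/-- The two-sided bar complex `Bar(C)`. -/
noncomputable def bar : DGBimodule.{uk, ug, u, v, max u v, u, v} C C where
  obj := C.barComplex
  lact := C.barLact
  ract := C.barRact
  lact_mem := by
    intro X X' Y i j f m hf hm
    refine C.bar_grade_le (S := ((C.barComplex X' Y).grade (i + j)).comap (C.barLact f)) ?_ hm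
    intro Z L t ht
    rw [Submodule.mem_comap, barLact_barIn]
    refine C.barIn_mem ?_
    rw [add_assoc]
    exact C.barLeft_mem (DGModule.koszul_mem _ _ hf) ht
  ract_mem := by
    intro X Y Y' i j m g hm hg
    refine C.bar_grade_le
      (S := ((C.barComplex X Y').grade (i + j)).comap (C.barRact.flip g)) ?_ hm
    intro Z L t ht
    rw [Submodule.mem_comap, LinearMap.flip_apply, barRact_barIn]
    refine C.barIn_mem ?_
    rw [add_right_comm]
    exact C.barRight_mem ht hg
  d_lact := by
    intro X X' Y i f m hf
    rw [C.bar_d_lact, DGModule.koszul_of_mem _ _ hf, map_smul, LinearMap.smul_apply]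
  d_ract := by
    intro X Y Y' i m g hm
    exact C.bar_d_ract g hm
  comp_lact := by
    intro X X' X'' Y f f' m
    refine LinearMap.congr_fun (f := C.barLact (C.comp f f')) (g := C.barLact f ∘ₗ C.barLact f')
      (C.bar_ext fun Z L t => ?_) m
    simp only [LinearMap.comp_apply, barLact_barIn, C.koszul_comp, barLeft_comp]
  ract_comp := by
    intro X Y Y' Y'' m g g'
    refine LinearMap.congr_fun (f := C.barRact.flip (C.comp g g'))
      (g := C.barRact.flip g' ∘ₗ C.barRact.flip g) (C.bar_ext fun Z L t => ?_) m
    simp only [LinearMap.comp_apply, LinearMap.flip_apply, barRact_barIn, barRight_comp]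
  lact_ract := by
    intro X X' Y Y' f m g
    refine LinearMap.congr_fun (f := C.barLact f ∘ₗ C.barRact.flip g)
      (g := C.barRact.flip g ∘ₗ C.barLact f) (C.bar_ext fun Z L t => ?_) m
    simp only [LinearMap.comp_apply, LinearMap.flip_apply, barRact_barIn, barLact_barIn,
      barLeft_barRight]
  one_lact := by
    intro X Y m
    refine LinearMap.congr_fun (f := C.barLact (C.one X)) (g := LinearMap.id)
      (C.bar_ext fun Z L t => ?_) m
    rw [barLact_barIn, DGModule.koszul_of_mem _ _ (C.one_mem X), SignedGrading.sgn_zero_right,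
      one_smul, barLeft_one]
    rfl
  ract_one := by
    intro X Y m
    refine LinearMap.congr_fun (f := C.barRact.flip (C.one Y)) (g := LinearMap.id)
      (C.bar_ext fun Z L t => ?_) m
    rw [LinearMap.flip_apply, barRact_barIn, barRight_one]
    rfl

/-- The element `[f₀, …, fᵣ₊₁]` of the bar complex. -/
noncomputable def bracket {Y Y' : C.Obj} (X : C.Obj) (L : List C.Obj)
    (f : C.Sequence Y (X :: L) Y') : C.bar.obj Y Y' :=
  C.barIn X L (C.simpleTensor Y (X :: L) Y' f)

end DGCategory

namespace DGBimodule

/-! ### Tensor products of bimodules -/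

section koszul

variable {k : Type uk} [CommRing k] {Γ : Type ug} [AddCommGroup Γ] {G : SignedGrading Γ}
  {C : DGCategory.{uk, ug, u, v} k G} {D : DGCategory.{uk, ug, u', v'} k G}
  (M : DGBimodule.{uk, ug, u, v, w, u', v'} C D)

theorem d_lact_koszul {X X' : C.Obj} {Y : D.Obj} (f : C.hom X' X) (m : M.obj X Y) :
    (M.obj X' Y).d (M.lact f m) = M.lact ((C.hom X' X).d f) m +
      M.lact ((C.hom X' X).koszul G.ι f) ((M.obj X Y).d m) := by
  induction f using DGModule.induction with
  | h0 => simp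
  | hadd f f' hf hf' => simp only [map_add, LinearMap.add_apply, hf, hf']; abel
  | hin i f hf => rw [M.d_lact m hf, DGModule.koszul_of_mem _ _ hf]; simp

theorem d_ract_koszul {X : C.Obj} {Y Y' : D.Obj} (m : M.obj X Y) (g : D.hom Y Y') :
    (M.obj X Y').d (M.ract m g) = M.ract ((M.obj X Y).d m) g +
      M.ract ((M.obj X Y).koszul G.ι m) ((D.hom Y Y').d g) := by
  induction m using DGModule.induction with
  | h0 => simp
  | hadd f f' hf hf' => simp only [map_add, LinearMap.add_apply, hf, hf']; abel
  | hin i f hf => rw [M.d_ract g hf, DGModule.koszul_of_mem _ _ hf]; simp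

theorem koszul_lact (l : Γ) {X X' : C.Obj} {Y : D.Obj} (f : C.hom X' X) (m : M.obj X Y) :
    (M.obj X' Y).koszul l (M.lact f m) =
      M.lact ((C.hom X' X).koszul l f) ((M.obj X Y).koszul l m) := by
  induction f using DGModule.induction with
  | h0 => simp
  | hadd f f' hf hf' => simp only [map_add, LinearMap.add_apply, hf, hf']
  | hin i f hf =>
    induction m using DGModule.induction with
    | h0 => simp
    | hadd m m' hm hm' => simp only [map_add, hm, hm']
    | hin j m hm =>
      simp [DGModule.koszul_of_mem _ _ hf, DGModule.koszul_of_mem _ _ hm,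
        DGModule.koszul_of_mem _ _ (M.lact_mem hf hm), SignedGrading.sgn_add_right, smul_smul,
        mul_comm]

theorem koszul_ract (l : Γ) {X : C.Obj} {Y Y' : D.Obj} (m : M.obj X Y) (g : D.hom Y Y') :
    (M.obj X Y').koszul l (M.ract m g) =
      M.ract ((M.obj X Y).koszul l m) ((D.hom Y Y').koszul l g) := by
  induction m using DGModule.induction with
  | h0 => simp
  | hadd f f' hf hf' => simp only [map_add, LinearMap.add_apply, hf, hf']
  | hin i m hm =>
    induction g using DGModule.induction with
    | h0 => simp
    | hadd g g' hg hg' => simp only [map_add, hg, hg']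
    | hin j g hg =>
      simp [DGModule.koszul_of_mem _ _ hm, DGModule.koszul_of_mem _ _ hg,
        DGModule.koszul_of_mem _ _ (M.ract_mem hm hg), SignedGrading.sgn_add_right, smul_smul,
        mul_comm]

end koszul

universe u₁ v₁ u₂ v₂ u₃ v₃

section tensor

variable {k : Type uk} [CommRing k] {Γ : Type ug} [AddCommGroup Γ] {G : SignedGrading Γ}
  {A : DGCategory.{uk, ug, u₁, v₁} k G} {B : DGCategory.{uk, ug, u₂, v₂} k G}
  {C : DGCategory.{uk, ug, u₃, v₃} k G}
  (M : DGBimodule.{uk, ug, u₁, v₁, w, u₂, v₂} A B) (N : DGBimodule.{uk, ug, u₂, v₂, w', u₃, v₃} B C)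

/-- The direct sum `⨁ ⟨X|M|Y⟩ ⊗ ⟨Y|N|Z⟩` over all objects `Y` of `B`. -/
noncomputable def tensorPre (X : A.Obj) (Z : C.Obj) : DGModule.{uk, ug, max u₂ w w'} k G :=
  DGModule.directSum fun Y : B.Obj => (M.obj X Y).tensor (N.obj Y Z)

/-- The element `m ⊗ n` of the direct sum. -/
noncomputable def tensorPreMk {X : A.Obj} {Y : B.Obj} {Z : C.Obj} :
    M.obj X Y →ₗ[k] N.obj Y Z →ₗ[k] M.tensorPre N X Z :=
  DGModule.tmul.compr₂ (DGModule.inSum (fun Y : B.Obj => (M.obj X Y).tensor (N.obj Y Z)) Y)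

theorem tensorPreMk_mem {X : A.Obj} {Y : B.Obj} {Z : C.Obj} {i j : Γ} {m : M.obj X Y}
    {n : N.obj Y Z} (hm : m ∈ (M.obj X Y).grade i) (hn : n ∈ (N.obj Y Z).grade j) :
    M.tensorPreMk N m n ∈ (M.tensorPre N X Z).grade (i + j) :=
  DGModule.inSum_mem (DGModule.tmul_mem hm hn)

theorem tensorPre_d_mk {X : A.Obj} {Y : B.Obj} {Z : C.Obj} (m : M.obj X Y) (n : N.obj Y Z) :
    (M.tensorPre N X Z).d (M.tensorPreMk N m n) = M.tensorPreMk N ((M.obj X Y).d m) n +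
      M.tensorPreMk N ((M.obj X Y).koszul G.ι m) ((N.obj Y Z).d n) :=
  (DGModule.directSum_d_inSum Y _).trans (by
    rw [DGModule.tensor_d_tmul, map_add]; rfl)

/-- The relations `m f ⊗ n ∼ m ⊗ f n`. -/
noncomputable def tensorRel (X : A.Obj) (Z : C.Obj) : Submodule k (M.tensorPre N X Z) :=
  Submodule.span k {z | ∃ (Y Y' : B.Obj) (m : M.obj X Y) (f : B.hom Y Y') (n : N.obj Y' Z),
    z = M.tensorPreMk N (M.ract m f) n - M.tensorPreMk N m (N.lact f n)}

theorem tensorRel_homogeneous (X : A.Obj) (Z : C.Obj) : M.tensorRel N X Z ≤ Submodule.span k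
    {z | z ∈ M.tensorRel N X Z ∧ ∃ i, z ∈ (M.tensorPre N X Z).grade i} := by
  refine Submodule.span_le.2 ?_
  rintro _ ⟨Y, Y', m, f, n, rfl⟩
  rw [SetLike.mem_coe]
  induction m using DGModule.induction with
  | h0 => simp
  | hadd m m' h h' =>
    simp only [map_add, LinearMap.add_apply, add_sub_add_comm]
    exact Submodule.add_mem _ h h'
  | hin i m hm =>
    induction f using DGModule.induction with
    | h0 => simp
    | hadd f f' h h' =>
      simp only [map_add, LinearMap.add_apply, add_sub_add_comm]
      exact Submodule.add_mem _ h h'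
    | hin j f hf =>
      induction n using DGModule.induction with
      | h0 => simp
      | hadd n n' h h' =>
        simp only [map_add, add_sub_add_comm]
        exact Submodule.add_mem _ h h'
      | hin l n hn =>
        refine Submodule.subset_span ⟨Submodule.subset_span ⟨Y, Y', m, f, n, rfl⟩, i + j + l, ?_⟩
        refine Submodule.sub_mem _ (M.tensorPreMk_mem N (M.ract_mem hm hf) hn) ?_
        rw [add_assoc]
        exact M.tensorPreMk_mem N hm (N.lact_mem hf hn)

theorem tensorRel_le_comap_d (X : A.Obj) (Z : C.Obj) :
    M.tensorRel N X Z ≤ (M.tensorRel N X Z).comap (M.tensorPre N X Z).d := by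
  refine Submodule.span_le.2 ?_
  rintro _ ⟨Y, Y', m, f, n, rfl⟩
  rw [SetLike.mem_coe, Submodule.mem_comap]
  have h : ∀ (m : M.obj X Y) (f : B.hom Y Y') (n : N.obj Y' Z),
      M.tensorPreMk N (M.ract m f) n - M.tensorPreMk N m (N.lact f n) ∈ M.tensorRel N X Z :=
    fun m f n => Submodule.subset_span ⟨Y, Y', m, f, n, rfl⟩
  have e : (M.tensorPre N X Z).d
        (M.tensorPreMk N (M.ract m f) n - M.tensorPreMk N m (N.lact f n)) =
      (M.tensorPreMk N (M.ract ((M.obj X Y).d m) f) n -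
        M.tensorPreMk N ((M.obj X Y).d m) (N.lact f n)) +
      (M.tensorPreMk N (M.ract ((M.obj X Y).koszul G.ι m) ((B.hom Y Y').d f)) n -
        M.tensorPreMk N ((M.obj X Y).koszul G.ι m) (N.lact ((B.hom Y Y').d f) n)) +
      (M.tensorPreMk N (M.ract ((M.obj X Y).koszul G.ι m) ((B.hom Y Y').koszul G.ι f))
          ((N.obj Y' Z).d n) -
        M.tensorPreMk N ((M.obj X Y).koszul G.ι m)
          (N.lact ((B.hom Y Y').koszul G.ι f) ((N.obj Y' Z).d n))) := by
    simp only [map_sub, tensorPre_d_mk, d_ract_koszul, d_lact_koszul, koszul_ract, map_add,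
      LinearMap.add_apply]
    abel
  rw [e]
  exact Submodule.add_mem _ (Submodule.add_mem _ (h _ _ _) (h _ _ _)) (h _ _ _)

/-- The complex `⟨X|M ⊗_B N|Z⟩`. -/
noncomputable def tensorObj (X : A.Obj) (Z : C.Obj) : DGModule.{uk, ug, max u₂ w w'} k G :=
  (M.tensorPre N X Z).quotient (M.tensorRel N X Z) (M.tensorRel_homogeneous N X Z)
    (M.tensorRel_le_comap_d N X Z)

/-- The element `m ⊗ n` of `⟨X|M ⊗_B N|Z⟩`. -/
noncomputable def tmk {X : A.Obj} {Y : B.Obj} {Z : C.Obj} :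
    M.obj X Y →ₗ[k] N.obj Y Z →ₗ[k] M.tensorObj N X Z :=
  (M.tensorPreMk N).compr₂
    (DGModule.qmk (M.tensorRel_homogeneous N X Z) (M.tensorRel_le_comap_d N X Z))

variable {M N}

theorem tmk_balanced {X : A.Obj} {Y Y' : B.Obj} {Z : C.Obj} (m : M.obj X Y) (f : B.hom Y Y')
    (n : N.obj Y' Z) : M.tmk N (M.ract m f) n = M.tmk N m (N.lact f n) := by
  have h := DGModule.qmk_eq_zero (hS := M.tensorRel_homogeneous N X Z)
    (hd := M.tensorRel_le_comap_d N X Z)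
    (Submodule.subset_span ⟨Y, Y', m, f, n, rfl⟩ : M.tensorPreMk N (M.ract m f) n -
      M.tensorPreMk N m (N.lact f n) ∈ M.tensorRel N X Z)
  rw [map_sub] at h
  exact sub_eq_zero.1 h

theorem tensorObj_ext {X : A.Obj} {Z : C.Obj} {W : Type w''} [AddCommGroup W] [Module k W]
    {f g : M.tensorObj N X Z →ₗ[k] W}
    (h : ∀ (Y : B.Obj) (m : M.obj X Y) (n : N.obj Y Z), f (M.tmk N m n) = g (M.tmk N m n)) :
    f = g := by
  refine DGModule.quotient_ext fun x => ?_
  refine LinearMap.congr_fun (f := f ∘ₗ DGModule.qmk (M.tensorRel_homogeneous N X Z)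
      (M.tensorRel_le_comap_d N X Z))
    (g := g ∘ₗ DGModule.qmk (M.tensorRel_homogeneous N X Z)
      (M.tensorRel_le_comap_d N X Z)) (DGModule.directSum_ext fun Y z => ?_) x
  exact LinearMap.congr_fun (f := (f ∘ₗ DGModule.qmk (M.tensorRel_homogeneous N X Z)
      (M.tensorRel_le_comap_d N X Z)) ∘ₗ
        DGModule.inSum (fun Y : B.Obj => (M.obj X Y).tensor (N.obj Y Z)) Y)
    (g := (g ∘ₗ DGModule.qmk (M.tensorRel_homogeneous N X Z)
      (M.tensorRel_le_comap_d N X Z)) ∘ₗ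
        DGModule.inSum (fun Y : B.Obj => (M.obj X Y).tensor (N.obj Y Z)) Y)
    (DGModule.tensor_ext fun m n => h Y m n) z

/-- The linear map out of the direct sum given by a family of bilinear maps. -/
noncomputable def tensorPreLift {X : A.Obj} {Z : C.Obj} {W : Type w''} [AddCommGroup W]
    [Module k W] (a : ∀ Y : B.Obj, M.obj X Y →ₗ[k] N.obj Y Z →ₗ[k] W) :
    M.tensorPre N X Z →ₗ[k] W :=
  DGModule.outSum fun Y => DGModule.tlift (a Y)

theorem tensorPreLift_mk {X : A.Obj} {Y : B.Obj} {Z : C.Obj} {W : Type w''} [AddCommGroup W]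
    [Module k W] (a : ∀ Y : B.Obj, M.obj X Y →ₗ[k] N.obj Y Z →ₗ[k] W) (m : M.obj X Y)
    (n : N.obj Y Z) : tensorPreLift a (M.tensorPreMk N m n) = a Y m n :=
  (DGModule.outSum_inSum (fun Y => DGModule.tlift (a Y)) Y _).trans (DGModule.tlift_tmul _ _ _)

/-- The linear map out of `⟨X|M ⊗_B N|Z⟩` given by a family of balanced bilinear maps. -/
noncomputable def tensorLift {X : A.Obj} {Z : C.Obj} {W : Type w''} [AddCommGroup W] [Module k W]
    (a : ∀ Y : B.Obj, M.obj X Y →ₗ[k] N.obj Y Z →ₗ[k] W)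
    (ha : ∀ (Y Y' : B.Obj) (m : M.obj X Y) (f : B.hom Y Y') (n : N.obj Y' Z),
      a Y' (M.ract m f) n = a Y m (N.lact f n)) : M.tensorObj N X Z →ₗ[k] W :=
  DGModule.qlift (tensorPreLift a) (by
    refine Submodule.span_le.2 ?_
    rintro _ ⟨Y, Y', m, f, n, rfl⟩
    rw [SetLike.mem_coe, LinearMap.mem_ker, map_sub, sub_eq_zero, tensorPreLift_mk,
      tensorPreLift_mk, ha])

theorem tensorLift_tmk {X : A.Obj} {Y : B.Obj} {Z : C.Obj} {W : Type w''} [AddCommGroup W]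
    [Module k W] (a : ∀ Y : B.Obj, M.obj X Y →ₗ[k] N.obj Y Z →ₗ[k] W)
    (ha : ∀ (Y Y' : B.Obj) (m : M.obj X Y) (f : B.hom Y Y') (n : N.obj Y' Z),
      a Y' (M.ract m f) n = a Y m (N.lact f n)) (m : M.obj X Y) (n : N.obj Y Z) :
    tensorLift a ha (M.tmk N m n) = a Y m n :=
  tensorPreLift_mk a m n

theorem tmk_mem {X : A.Obj} {Y : B.Obj} {Z : C.Obj} {i j : Γ} {m : M.obj X Y}
    {n : N.obj Y Z} (hm : m ∈ (M.obj X Y).grade i) (hn : n ∈ (N.obj Y Z).grade j) :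
    M.tmk N m n ∈ (M.tensorObj N X Z).grade (i + j) :=
  DGModule.qmk_mem (M.tensorPreMk_mem N hm hn)

theorem tensorObj_grade_le {X : A.Obj} {Z : C.Obj} {l : Γ} {S : Submodule k (M.tensorObj N X Z)}
    (h : ∀ (Y : B.Obj) (i j : Γ), i + j = l → ∀ m ∈ (M.obj X Y).grade i,
      ∀ n ∈ (N.obj Y Z).grade j, M.tmk N m n ∈ S) : (M.tensorObj N X Z).grade l ≤ S := by
  refine DGModule.quotient_grade_le fun x hx => ?_
  refine DGModule.directSum_grade_le (S := S.comap (DGModule.qmk (M.tensorRel_homogeneous N X Z)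
    (M.tensorRel_le_comap_d N X Z))) (fun Y z hz => ?_) hx
  refine DGModule.tensor_grade_le (S := (S.comap (DGModule.qmk (M.tensorRel_homogeneous N X Z)
    (M.tensorRel_le_comap_d N X Z))).comap
      (DGModule.inSum (fun Y : B.Obj => (M.obj X Y).tensor (N.obj Y Z)) Y)) ?_ hz
  exact fun i j hij m hm n hn => h Y i j hij m hm n hn

theorem tensorObj_d_tmk {X : A.Obj} {Y : B.Obj} {Z : C.Obj} (m : M.obj X Y) (n : N.obj Y Z) :
    (M.tensorObj N X Z).d (M.tmk N m n) = M.tmk N ((M.obj X Y).d m) n +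
      M.tmk N ((M.obj X Y).koszul G.ι m) ((N.obj Y Z).d n) :=
  (DGModule.quotient_d_qmk _).trans (by rw [tensorPre_d_mk, map_add]; rfl)

variable (M N)

/-- The left action on the tensor product, `f · (m ⊗ n) = (f · m) ⊗ n`. -/
noncomputable def tensorLact {X X' : A.Obj} {Z : C.Obj} :
    A.hom X' X →ₗ[k] M.tensorObj N X Z →ₗ[k] M.tensorObj N X' Z :=
  LinearMap.flip (tensorLift
    (fun Y => LinearMap.mk₂ k (fun (m : M.obj X Y) (n : N.obj Y Z) =>
        (M.tmk N).flip n ∘ₗ M.lact.flip m)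
      (fun m m' n => by ext f; simp) (fun c m n => by ext f; simp)
      (fun m n n' => by ext f; simp) (fun c m n => by ext f; simp))
    (fun Y Y' m f n => by
      ext g
      simp only [LinearMap.mk₂_apply, LinearMap.comp_apply, LinearMap.flip_apply, M.lact_ract,
        tmk_balanced]))

/-- The right action on the tensor product, `(m ⊗ n) · g = m ⊗ (n · g)`. -/
noncomputable def tensorRact {X : A.Obj} {Z Z' : C.Obj} :
    M.tensorObj N X Z →ₗ[k] C.hom Z Z' →ₗ[k] M.tensorObj N X Z' :=
  tensorLift
    (fun Y => LinearMap.mk₂ k (fun (m : M.obj X Y) (n : N.obj Y Z) => M.tmk N m ∘ₗ N.ract n)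
      (fun m m' n => by ext f; simp) (fun c m n => by ext f; simp)
      (fun m n n' => by ext f; simp) (fun c m n => by ext f; simp))
    (fun Y Y' m f n => by
      ext g
      simp only [LinearMap.mk₂_apply, LinearMap.comp_apply, ← N.lact_ract, tmk_balanced])

theorem tensorLact_tmk {X X' : A.Obj} {Y : B.Obj} {Z : C.Obj} (f : A.hom X' X) (m : M.obj X Y)
    (n : N.obj Y Z) : M.tensorLact N f (M.tmk N m n) = M.tmk N (M.lact f m) n := by
  rw [tensorLact, LinearMap.flip_apply, tensorLift_tmk]
  rfl

theorem tensorRact_tmk {X : A.Obj} {Y : B.Obj} {Z Z' : C.Obj} (m : M.obj X Y)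
    (n : N.obj Y Z) (g : C.hom Z Z') :
    M.tensorRact N (M.tmk N m n) g = M.tmk N m (N.ract n g) := by
  rw [tensorRact, tensorLift_tmk]
  rfl

/-- The tensor product `M ⊗_B N`. -/
noncomputable def tensor : DGBimodule.{uk, ug, u₁, v₁, max u₂ w w', u₃, v₃} A C where
  obj := M.tensorObj N
  lact := M.tensorLact N
  ract := M.tensorRact N
  lact_mem := by
    intro X X' Z i j f x hf hx
    refine tensorObj_grade_le
      (S := ((M.tensorObj N X' Z).grade (i + j)).comap (M.tensorLact N f)) ?_ hx
    rintro Y a b rfl m hm n hn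
    rw [Submodule.mem_comap, tensorLact_tmk, ← add_assoc]
    exact tmk_mem (M.lact_mem hf hm) hn
  ract_mem := by
    intro X Z Z' i j x g hx hg
    refine tensorObj_grade_le
      (S := ((M.tensorObj N X Z').grade (i + j)).comap ((M.tensorRact N).flip g)) ?_ hx
    rintro Y a b rfl m hm n hn
    rw [Submodule.mem_comap, LinearMap.flip_apply, tensorRact_tmk, add_assoc]
    exact tmk_mem hm (N.ract_mem hn hg)
  d_lact := by
    intro X X' Z i f x hf
    refine LinearMap.congr_fun (f := (M.tensorObj N X' Z).d ∘ₗ M.tensorLact N f)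
      (g := M.tensorLact N ((A.hom X' X).d f) +
        G.sgn k G.ι i • (M.tensorLact N f ∘ₗ (M.tensorObj N X Z).d))
      (tensorObj_ext fun Y m n => ?_) x
    simp only [LinearMap.comp_apply, LinearMap.add_apply, LinearMap.smul_apply, tensorLact_tmk,
      tensorObj_d_tmk, M.d_lact m hf, koszul_lact, DGModule.koszul_of_mem _ _ hf, map_add,
      map_smul, smul_add]
    abel
  d_ract := by
    intro X Z Z' i x g hx
    have h : (M.tensorObj N X Z).grade i ≤ LinearMap.ker
        ((M.tensorObj N X Z').d ∘ₗ (M.tensorRact N).flip g -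
          ((M.tensorRact N).flip g ∘ₗ (M.tensorObj N X Z).d +
            G.sgn k G.ι i • (M.tensorRact N).flip ((C.hom Z Z').d g))) := by
      refine tensorObj_grade_le ?_
      rintro Y a b rfl m hm n hn
      rw [LinearMap.mem_ker]
      simp only [LinearMap.comp_apply, LinearMap.add_apply, LinearMap.sub_apply,
        LinearMap.smul_apply, LinearMap.flip_apply, tensorRact_tmk, tensorObj_d_tmk,
        N.d_ract g hn, DGModule.koszul_of_mem _ _ hm, map_add, map_smul, smul_smul,
        SignedGrading.sgn_add_right, mul_comm (G.sgn k G.ι b) (G.sgn k G.ι a)]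
      abel
    have h' := h hx
    rw [LinearMap.mem_ker] at h'
    exact sub_eq_zero.1 h'
  comp_lact := by
    intro X X' X'' Z f f' x
    refine LinearMap.congr_fun (f := M.tensorLact N (A.comp f f'))
      (g := M.tensorLact N f ∘ₗ M.tensorLact N f') (tensorObj_ext fun Y m n => ?_) x
    simp only [LinearMap.comp_apply, tensorLact_tmk, M.comp_lact]
  ract_comp := by
    intro X Z Z' Z'' x g g'
    refine LinearMap.congr_fun (f := (M.tensorRact N).flip (C.comp g g'))
      (g := (M.tensorRact N).flip g' ∘ₗ (M.tensorRact N).flip g)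
      (tensorObj_ext fun Y m n => ?_) x
    simp only [LinearMap.comp_apply, LinearMap.flip_apply, tensorRact_tmk, N.ract_comp]
  lact_ract := by
    intro X X' Z Z' f x g
    refine LinearMap.congr_fun (f := M.tensorLact N f ∘ₗ (M.tensorRact N).flip g)
      (g := (M.tensorRact N).flip g ∘ₗ M.tensorLact N f) (tensorObj_ext fun Y m n => ?_) x
    simp only [LinearMap.comp_apply, LinearMap.flip_apply, tensorRact_tmk, tensorLact_tmk]
  one_lact := by
    intro X Z x
    refine LinearMap.congr_fun (f := M.tensorLact N (A.one X)) (g := LinearMap.id)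
      (tensorObj_ext fun Y m n => ?_) x
    simp only [tensorLact_tmk, M.one_lact, LinearMap.id_apply]
  ract_one := by
    intro X Z x
    refine LinearMap.congr_fun (f := (M.tensorRact N).flip (C.one Z)) (g := LinearMap.id)
      (tensorObj_ext fun Y m n => ?_) x
    simp only [LinearMap.flip_apply, tensorRact_tmk, N.ract_one, LinearMap.id_apply]

end tensor

end DGBimodule

/-! ### Functors and restriction -/

universe u₁ v₁ u₂ v₂ u₃ v₃

/-- A dg functor: it preserves degrees, differentials, compositions and identities. -/
structure DGFunctor {k : Type uk} [CommRing k] {Γ : Type ug} [AddCommGroup Γ]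
    {G : SignedGrading Γ} (C : DGCategory.{uk, ug, u, v} k G)
    (D : DGCategory.{uk, ug, u', v'} k G) where
  obj : C.Obj → D.Obj
  map : ∀ {X Y : C.Obj}, C.hom X Y →ₗ[k] D.hom (obj X) (obj Y)
  map_mem : ∀ {X Y : C.Obj} {i : Γ} {f : C.hom X Y}, f ∈ (C.hom X Y).grade i →
    map f ∈ (D.hom (obj X) (obj Y)).grade i
  map_d : ∀ {X Y : C.Obj} (f : C.hom X Y),
    map ((C.hom X Y).d f) = (D.hom (obj X) (obj Y)).d (map f)
  map_comp : ∀ {X Y Z : C.Obj} (f : C.hom X Y) (g : C.hom Y Z),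
    map (C.comp f g) = D.comp (map f) (map g)
  map_one : ∀ X : C.Obj, map (C.one X) = D.one (obj X)

namespace DGBimodule

section restrict

variable {k : Type uk} [CommRing k] {Γ : Type ug} [AddCommGroup Γ] {G : SignedGrading Γ}
  {A : DGCategory.{uk, ug, u₁, v₁} k G} {B : DGCategory.{uk, ug, u₂, v₂} k G}
  {C : DGCategory.{uk, ug, u₃, v₃} k G}

/-- Restriction of the left action along a dg functor. -/
def restrictLeft (M : DGBimodule.{uk, ug, u₂, v₂, w, u₃, v₃} B C) (F : DGFunctor A B) :
    DGBimodule.{uk, ug, u₁, v₁, w, u₃, v₃} A C where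
  obj X Y := M.obj (F.obj X) Y
  lact := M.lact ∘ₗ F.map
  ract := M.ract
  lact_mem hf hm := M.lact_mem (F.map_mem hf) hm
  ract_mem := M.ract_mem
  d_lact m hf := by
    simp only [LinearMap.comp_apply, M.d_lact m (F.map_mem hf), F.map_d]
  d_ract := M.d_ract
  comp_lact f f' m := by simp only [LinearMap.comp_apply, F.map_comp, M.comp_lact]
  ract_comp := M.ract_comp
  lact_ract f m g := M.lact_ract (F.map f) m g
  one_lact m := by simp only [LinearMap.comp_apply, F.map_one, M.one_lact]
  ract_one := M.ract_one

/-- Restriction of the right action along a dg functor. -/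
def restrictRight (M : DGBimodule.{uk, ug, u₁, v₁, w, u₃, v₃} A C) (F : DGFunctor B C) :
    DGBimodule.{uk, ug, u₁, v₁, w, u₂, v₂} A B where
  obj X Y := M.obj X (F.obj Y)
  lact := M.lact
  ract := M.ract.compl₂ F.map
  lact_mem := M.lact_mem
  ract_mem hm hg := M.ract_mem hm (F.map_mem hg)
  d_lact := M.d_lact
  d_ract g hm := by
    simp only [LinearMap.compl₂_apply, M.d_ract (F.map g) hm, F.map_d]
  comp_lact := M.comp_lact
  ract_comp m g g' := by simp only [LinearMap.compl₂_apply, F.map_comp, M.ract_comp]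
  lact_ract f m g := M.lact_ract f m (F.map g)
  one_lact := M.one_lact
  ract_one m := by simp only [LinearMap.compl₂_apply, F.map_one, M.ract_one]

end restrict

/-! ### Morphisms of bimodules -/

section Hom

variable {k : Type uk} [CommRing k] {Γ : Type ug} [AddCommGroup Γ] {G : SignedGrading Γ}
  {C : DGCategory.{uk, ug, u, v} k G} {D : DGCategory.{uk, ug, u', v'} k G}

/-- The bimodule maps `M → N` of degree `l`. -/
@[ext]
structure Hom (M : DGBimodule.{uk, ug, u, v, w, u', v'} C D)
    (N : DGBimodule.{uk, ug, u, v, w', u', v'} C D) (l : Γ) where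
  map : ∀ (X : C.Obj) (Y : D.Obj), M.obj X Y →ₗ[k] N.obj X Y
  map_mem : ∀ {X : C.Obj} {Y : D.Obj} {i : Γ} {m : M.obj X Y}, m ∈ (M.obj X Y).grade i →
    map X Y m ∈ (N.obj X Y).grade (i + l)
  map_lact : ∀ {X X' : C.Obj} {Y : D.Obj} {i : Γ} {f : C.hom X' X} (m : M.obj X Y),
    f ∈ (C.hom X' X).grade i → map X' Y (M.lact f m) = G.sgn k l i • N.lact f (map X Y m)
  map_ract : ∀ {X : C.Obj} {Y Y' : D.Obj} (m : M.obj X Y) (g : D.hom Y Y'),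
    map X Y' (M.ract m g) = N.ract (map X Y m) g

namespace Hom

variable {M : DGBimodule.{uk, ug, u, v, w, u', v'} C D}
  {N : DGBimodule.{uk, ug, u, v, w', u', v'} C D}
  {P : DGBimodule.{uk, ug, u, v, w'', u', v'} C D}

/-- The identity map. -/
def id (M : DGBimodule.{uk, ug, u, v, w, u', v'} C D) : Hom M M 0 where
  map X Y := LinearMap.id
  map_mem hm := by simpa using hm
  map_lact m hf := by simp
  map_ract m g := rfl

/-- The composite `φ ∘ ψ` of bimodule maps of degree zero. -/
def comp (φ : Hom N P 0) (ψ : Hom M N 0) : Hom M P 0 where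
  map X Y := φ.map X Y ∘ₗ ψ.map X Y
  map_mem hm := by simpa using φ.map_mem (ψ.map_mem hm)
  map_lact m hf := by simp [ψ.map_lact m hf, φ.map_lact _ hf]
  map_ract m g := by simp [ψ.map_ract, φ.map_ract]

/-- The differential of a bimodule map of degree `l`,
`d φ = d ∘ φ - (-1) ^ ⟨ι, l⟩ φ ∘ d`, on the complexes `⟨X|M|Y⟩`. -/
def dmap {l : Γ} (φ : Hom M N l) (X : C.Obj) (Y : D.Obj) : M.obj X Y →ₗ[k] N.obj X Y :=
  (N.obj X Y).d ∘ₗ φ.map X Y - G.sgn k G.ι l • (φ.map X Y ∘ₗ (M.obj X Y).d)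

/-- Closed bimodule maps; in degree zero, these are the bimodule chain maps. -/
def IsClosed {l : Γ} (φ : Hom M N l) : Prop := ∀ X Y, φ.dmap X Y = 0

/-- Two bimodule maps of degree zero are homotopic if their difference is the differential of
a bimodule map of degree `-ι`. -/
def Homotopic (φ ψ : Hom M N 0) : Prop :=
  ∃ h : Hom M N (-G.ι), ∀ X Y, h.dmap X Y = φ.map X Y - ψ.map X Y

/-- Homotopy equivalences of bimodules: closed maps of degree zero with an inverse up to
homotopy that is also closed of degree zero. -/
def IsHomotopyEquiv (φ : Hom M N 0) : Prop :=
  φ.IsClosed ∧ ∃ ψ : Hom N M 0, ψ.IsClosed ∧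
    Homotopic (ψ.comp φ) (Hom.id M) ∧ Homotopic (φ.comp ψ) (Hom.id N)

end Hom

end Hom

end DGBimodule

/-! ### The additive envelope -/

namespace DGCategory

/-- A formal direct sum `⨁ X_a` over a finite set of indices. -/
structure FormalSum {k : Type uk} [CommRing k] {Γ : Type ug} [AddCommGroup Γ]
    {G : SignedGrading Γ} (C : DGCategory.{uk, ug, u, v} k G) where
  Idx : Type t
  [fintype : Fintype Idx]
  obj : Idx → C.Obj

attribute [instance] FormalSum.fintype

variable {k : Type uk} [CommRing k] {Γ : Type ug} [AddCommGroup Γ] {G : SignedGrading Γ}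
  (C : DGCategory.{uk, ug, u, v} k G)

/-- The entries of the identity matrix of a formal direct sum. -/
noncomputable def delta (X : FormalSum.{uk, ug, u, v, t} C) (a b : X.Idx) :
    C.hom (X.obj a) (X.obj b) :=
  letI := Classical.decEq X.Idx
  Pi.single (M := fun b => (C.hom (X.obj a) (X.obj b)).carrier) a (C.one (X.obj a)) b

variable {C}

theorem delta_self (X : FormalSum.{uk, ug, u, v, t} C) (a : X.Idx) :
    C.delta X a a = C.one (X.obj a) := by
  simp [delta]

theorem delta_of_ne (X : FormalSum.{uk, ug, u, v, t} C) {a b : X.Idx} (h : a ≠ b) :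
    C.delta X a b = 0 := by
  let _ := Classical.decEq X.Idx
  exact Pi.single_eq_of_ne (M := fun b => (C.hom (X.obj a) (X.obj b)).carrier) (Ne.symm h) _

variable (C)

/-- The additive envelope `A(C)`: objects are finite formal direct sums, morphisms are matrices,
composition is matrix multiplication. -/
noncomputable def additiveEnvelope :
    DGCategory.{uk, ug, max u (t + 1), max v t} k G where
  Obj := FormalSum.{uk, ug, u, v, t} C
  hom X Y := DGModule.matrix fun a b => C.hom (X.obj a) (Y.obj b)
  comp := LinearMap.mk₂ k
    (fun f g => DGModule.ofEntries fun a c =>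
      ∑ b, C.comp (DGModule.entry a b f) (DGModule.entry b c g))
    (fun f f' g => DGModule.matrix_ext fun a c => by simp [Finset.sum_add_distrib])
    (fun r f g => DGModule.matrix_ext fun a c => by simp [Finset.smul_sum])
    (fun f g g' => DGModule.matrix_ext fun a c => by simp [Finset.sum_add_distrib])
    (fun r f g => DGModule.matrix_ext fun a c => by simp [Finset.smul_sum])
  one X := DGModule.ofEntries (C.delta X)
  comp_mem hf hg := DGModule.mem_matrix_grade.2 fun a c => Submodule.sum_mem _ fun b _ =>
    C.comp_mem (DGModule.mem_matrix_grade.1 hf a b) (DGModule.mem_matrix_grade.1 hg b c)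
  one_mem X := DGModule.mem_matrix_grade.2 fun a b => by
    rw [DGModule.entry_ofEntries]
    by_cases h : a = b
    · subst h
      rw [delta_self]
      exact C.one_mem _
    · rw [delta_of_ne X h]
      exact Submodule.zero_mem _
  d_comp g hf := DGModule.matrix_ext fun a c => by
    simp only [LinearMap.mk₂_apply, map_add, map_smul, DGModule.entry_d,
      DGModule.entry_ofEntries, map_sum, C.d_comp _ (DGModule.mem_matrix_grade.1 hf a _),
      Finset.sum_add_distrib, Finset.smul_sum]
  assoc f g h := DGModule.matrix_ext fun a d => by
    simp only [LinearMap.mk₂_apply, DGModule.entry_ofEntries, map_sum, LinearMap.sum_apply,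
      C.assoc]
    exact Finset.sum_comm
  one_comp f := DGModule.matrix_ext fun a b => by
    simp only [LinearMap.mk₂_apply, DGModule.entry_ofEntries]
    rw [Finset.sum_eq_single a, delta_self, C.one_comp]
    · intro a' _ h
      rw [delta_of_ne _ (Ne.symm h), map_zero, LinearMap.zero_apply]
    · simp
  comp_one f := DGModule.matrix_ext fun a b => by
    simp only [LinearMap.mk₂_apply, DGModule.entry_ofEntries]
    rw [Finset.sum_eq_single b, delta_self, C.comp_one]
    · intro b' _ h
      rw [delta_of_ne _ h, map_zero]
    · simp

/-- The formal direct sum of one object. -/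
def singleSum (X : C.Obj) : FormalSum.{uk, ug, u, v, t} C := ⟨PUnit.{t + 1}, fun _ => X⟩

/-- The morphism of the additive envelope with given matrix entries. -/
noncomputable def ofMatrix {X Y : FormalSum.{uk, ug, u, v, t} C}
    (f : ∀ a b, C.hom (X.obj a) (Y.obj b)) : (additiveEnvelope.{uk, ug, u, v, t} C).hom X Y :=
  DGModule.ofEntries f

/-- The embedding `C → A(C)` that regards objects as formal sums over a one-element set. -/
noncomputable def toEnvelope : DGFunctor C (additiveEnvelope.{uk, ug, u, v, t} C) where
  obj X := C.singleSum X
  map :=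
    { toFun := fun f => C.ofMatrix (X := C.singleSum _) (Y := C.singleSum _) fun _ _ => f
      map_add' := fun f g => rfl
      map_smul' := fun c f => rfl }
  map_mem hf := DGModule.mem_matrix_grade.2 fun _ _ => hf
  map_d f := rfl
  map_comp f g := DGModule.matrix_ext fun a b => by
    exact (Fintype.sum_unique (ι := PUnit.{t + 1}) (fun _ => C.comp f g)).symm
  map_one X := DGModule.matrix_ext fun a b => by
    exact (delta_self (C.singleSum X) a).symm

section

variable {C}

/-- The inclusion `σ_a : X_a → X` of a direct summand. -/
noncomputable def inclusion (X : FormalSum.{uk, ug, u, v, t} C) (a : X.Idx) :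
    (additiveEnvelope.{uk, ug, u, v, t} C).hom X (C.toEnvelope.obj (X.obj a)) :=
  C.ofMatrix (X := X) (Y := C.singleSum (X.obj a)) fun b _ => C.delta X b a

/-- The projection `π_a : X → X_a` to a direct summand. -/
noncomputable def projection (X : FormalSum.{uk, ug, u, v, t} C) (a : X.Idx) :
    (additiveEnvelope.{uk, ug, u, v, t} C).hom (C.toEnvelope.obj (X.obj a)) X :=
  C.ofMatrix (X := C.singleSum (X.obj a)) (Y := X) fun _ b => C.delta X a b

/-- The choices of one index for each formal sum in a list. -/
def Choice : List (FormalSum.{uk, ug, u, v, t} C) → Type t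
  | [] => PUnit
  | X :: L => X.Idx × Choice L

/-- There are finitely many choices of indices. -/
@[reducible] def choiceFintype : (L : List (FormalSum.{uk, ug, u, v, t} C)) → Fintype (Choice L)
  | [] => inferInstanceAs (Fintype PUnit)
  | X :: L =>
    letI := choiceFintype L
    inferInstanceAs (Fintype (X.Idx × Choice L))

instance (L : List (FormalSum.{uk, ug, u, v, t} C)) : Fintype (Choice L) := choiceFintype L

/-- The chosen summands. -/
def pick : (L : List (FormalSum.{uk, ug, u, v, t} C)) → Choice L → List C.Obj
  | [], _ => []
  | X :: L, c => X.obj c.1 :: pick L c.2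

/-- The sequence of matrix entries `f_{a,a₀}, f_{a₀,a₁}, …` of a composable sequence of morphisms in
the additive envelope, for a choice of indices. -/
def entries : {Y : FormalSum.{uk, ug, u, v, t} C} → (L : List (FormalSum.{uk, ug, u, v, t} C)) →
    {Y' : FormalSum.{uk, ug, u, v, t} C} →
    (additiveEnvelope.{uk, ug, u, v, t} C).Sequence Y L Y' →
    (a : Y.Idx) → (c : Choice L) → (b : Y'.Idx) →
    C.Sequence (Y.obj a) (pick L c) (Y'.obj b)
  | _, [], _, f, a, _, b => DGModule.entry a b f
  | _, _ :: L, _, f, a, c, b => (DGModule.entry a c.1 f.1, entries L f.2 c.1 c.2 b)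

end

/-- The bimodule `A(C) ⊗_C Bar(C) ⊗_C A(C)`. -/
noncomputable def inducedBar :
    DGBimodule.{uk, ug, max u (t + 1), max v t, max u v t, max u (t + 1), max v t}
      (additiveEnvelope.{uk, ug, u, v, t} C) (additiveEnvelope.{uk, ug, u, v, t} C) :=
  (((additiveEnvelope.{uk, ug, u, v, t} C).idBimodule.restrictRight C.toEnvelope).tensor
    C.bar).tensor ((additiveEnvelope.{uk, ug, u, v, t} C).idBimodule.restrictLeft C.toEnvelope)

/-- The element `g · x · g'` of `A(C) ⊗_C Bar(C) ⊗_C A(C)`. -/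
noncomputable def inducedMk {Y Y' : FormalSum.{uk, ug, u, v, t} C} {X X' : C.Obj}
    (g : (additiveEnvelope.{uk, ug, u, v, t} C).hom Y (C.toEnvelope.obj X))
    (x : C.bar.obj X X')
    (g' : (additiveEnvelope.{uk, ug, u, v, t} C).hom (C.toEnvelope.obj X') Y') :
    (inducedBar.{uk, ug, u, v, t} C).obj Y Y' :=
  DGBimodule.tmk _ _ (DGBimodule.tmk _ _ g x) g'

/-- The maps given by the formula
`[f₀, …, fᵣ₊₁] ↦ ∑ σ_a · [f_{a,a₀}, f_{a₀,a₁}, …, f_{aᵣ,b}] · π_b`,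
where the sum is over all choices of indices `a, a₀, …, aᵣ, b`. -/
def SumsOverIndices (φ : ∀ Y Y' : FormalSum.{uk, ug, u, v, t} C,
    (additiveEnvelope.{uk, ug, u, v, t} C).bar.obj Y Y' →ₗ[k]
      (inducedBar.{uk, ug, u, v, t} C).obj Y Y') : Prop :=
  ∀ (Y Y' X : FormalSum.{uk, ug, u, v, t} C) (L : List (FormalSum.{uk, ug, u, v, t} C))
    (f : (additiveEnvelope.{uk, ug, u, v, t} C).Sequence Y (X :: L) Y'),
    φ Y Y' ((additiveEnvelope.{uk, ug, u, v, t} C).bracket X L f) =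
      ∑ a : Y.Idx, ∑ c : Choice (X :: L), ∑ b : Y'.Idx,
        C.inducedMk (inclusion Y a)
          (C.bracket (X.obj c.1) (pick L c.2) (entries (X :: L) f a c b)) (projection Y' b)

end DGCategory

/-! ## Linear maps on the augmented bar complex -/

namespace DGCategory

variable {k : Type uk} [CommRing k] {Γ : Type ug} [AddCommGroup Γ] {G : SignedGrading Γ}
  (C : DGCategory.{uk, ug, u, v} k G)

/-! The computation takes place in the augmented bar complex `BarSum`, which also has the summand
⟨Y|Y'⟩ with no intermediate object. There every tensor is built from a morphism by steps y ↦ f ⊗ y,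
and the alternating sum δ of contractions obeys δ(f ⊗ y) = f·y − f ⊗ δy without an exception for
short tensors. Operators are therefore defined by recursion on the number of factors (`barFold`),
and identities between them are checked on the two kinds of generators (`barSum_induction`).
Truncation passes back to the bar complex.

Of the additive envelope only one feature matters: 1 = ∑ σ_a π_a on every object, where the entries
f_{ab} = π_a f σ_b come from C and multiply as matrices. This is abstracted as a `Splitting` of a dg
functor F : C → D. Let E(y)_{ab} be the sum over all intermediate indices of the tensors of matrix
entries of y. Since composition is matrix multiplication, E commutes with δ, and Ξ(y) = ∑ σ_a ·
E(y)_{ab} · π_b is a chain map. It is linear over D because g σ_c = ∑ σ_a g_{ac} and entries may be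
moved across ⊗_C.

The homotopy inverse is Ψ : g·x·g' ↦ g·F(x)·g'. The composite ΞΨ is the identity on the nose: both
maps respect the D-actions, so only the elements 1·x·1 have to be considered, and a one-term sum has
a single index with σ = π = 1 (`splitMap_barMap`).

The composite ΨΞ is the expansion ε, which sends [f₀, …, fᵣ₊₁] to ∑ [f₀σ, πf₁σ, …, πfᵣ₊₁]
(`extendedBarMap_splitMap`). The map s(y) = ∑ σ_a ⊗ π_a y satisfies δs + sδ = 1
(`sumContract_insert`), but it is not left linear. The prism operator P(f ⊗ y) = f ⊗ (s(εy) − Py),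
with P = 0 on single morphisms, is left linear because composition from the left only meets the
factor f, and it satisfies δP + Pδ = ε − 1 (`sumContract_prism`). It commutes with the internal
differential and raises r by one, so the sign (-1)^r in the bar differential makes the internal
terms of dP + Pd cancel. Hence P is a homotopy of degree −ι from ΨΞ to the identity. -/

theorem d_one (X : C.Obj) : (C.hom X X).d (C.one X) = 0 := by
  have h := C.d_comp (C.one X) (C.one_mem X)
  -- The Leibniz rule for 1 ∘ 1 = 1 becomes d1 = d1 + d1.
  rw [C.one_comp, C.comp_one, C.one_comp, SignedGrading.sgn_zero_right, one_smul] at h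
  exact left_eq_add.1 h

/-! ### Induction and recursion on the number of tensor factors -/

section

variable {Y' Y'' : C.Obj}

/-- The inclusion of the summand of the empty list. -/
noncomputable def sumNil {Y Y' : C.Obj} : C.hom Y Y' →ₗ[k] C.BarSum Y Y' :=
  C.sumIn []

/-- Prepending a morphism moves the left end of a tensor, so the predicate ranges over all left ends
while the right end stays fixed. -/
theorem barSum_induction {p : ∀ Y, C.BarSum Y Y' → Prop} (h0 : ∀ Y, p Y 0)
    (hadd : ∀ Y x y, p Y x → p Y y → p Y (x + y))
    (hnil : ∀ Y (f : C.hom Y Y'), p Y (C.sumNil f))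
    (hcons : ∀ Y X (f : C.hom Y X) (y : C.BarSum X Y'), p X y → p Y (C.barCons f y))
    {Y : C.Obj} (y : C.BarSum Y Y') : p Y y := by
  have hin : ∀ (L : List C.Obj) (Y : C.Obj) (t : C.barTensor Y L Y'), p Y (C.sumIn L t) := by
    intro L
    induction L with
    | nil => exact hnil
    | cons X L ih =>
      intro Y t
      -- Here 0 and + are those of the underlying tensor product; the equations `this` restate
      -- linearity of the inclusion for them.
      induction t using TensorProduct.induction_on with
      | zero =>
        have : C.sumIn (X :: L) (0 : C.barTensor Y (X :: L) Y') = 0 := map_zero _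
        exact this ▸ h0 Y
      | tmul f s =>
        have h := hcons Y X f _ (ih X s)
        rw [barCons_sumIn] at h
        exact h
      | add x y hx hy =>
        have : C.sumIn (X :: L) ((x + y : C.barTensor Y (X :: L) Y')) =
          C.sumIn (X :: L) x + C.sumIn (X :: L) y := map_add _ _ _
        exact this ▸ hadd Y _ _ hx hy
  exact ds_induction k (h0 Y) (fun L t => hin L Y t) (hadd Y) y

variable {W : C.Obj → Type w} [∀ Y, AddCommGroup (W Y)] [∀ Y, Module k (W Y)]

/-- The linear maps defined on tensor products by recursion on the number of factors. -/
noncomputable def barFoldTensor (base : ∀ Y, C.hom Y Y' →ₗ[k] W Y)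
    (step : ∀ Y X, C.hom Y X →ₗ[k] W X →ₗ[k] W Y) :
    (L : List C.Obj) → (Y : C.Obj) → C.barTensor Y L Y' →ₗ[k] W Y
  | [], Y => base Y
  | X :: L, Y => DGModule.tlift ((step Y X).compl₂ (barFoldTensor base step L X))

/-- The linear maps on the augmented bar complex given by recursion on the number of factors. -/
noncomputable def barFold (base : ∀ Y, C.hom Y Y' →ₗ[k] W Y)
    (step : ∀ Y X, C.hom Y X →ₗ[k] W X →ₗ[k] W Y) (Y : C.Obj) : C.BarSum Y Y' →ₗ[k] W Y :=
  dsOut fun L => C.barFoldTensor base step L Y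

variable (base : ∀ Y, C.hom Y Y' →ₗ[k] W Y) (step : ∀ Y X, C.hom Y X →ₗ[k] W X →ₗ[k] W Y)

/-- Together with `barFold_cons`, this is the only description of a fold that is used: its recursion
equations on the two kinds of generators. -/
theorem barFold_nil {Y : C.Obj} (f : C.hom Y Y') :
    C.barFold base step Y (C.sumNil f) = base Y f := by
  exact dsOut_dsIn (V := fun L => (C.barTensor Y L Y').carrier)
    (fun L => C.barFoldTensor base step L Y) [] f

theorem barFold_cons {Y X : C.Obj} (f : C.hom Y X) (y : C.BarSum X Y') :
    C.barFold base step Y (C.barCons f y) = step Y X f (C.barFold base step X y) := by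
  refine LinearMap.congr_fun (f := C.barFold base step Y ∘ₗ C.barCons f)
    (g := step Y X f ∘ₗ C.barFold base step X) (C.barSum_ext fun L t => ?_) y
  simp only [LinearMap.comp_apply, barCons_sumIn]
  simp only [barFold, sumIn, dsOut_dsIn]
  rw [barFoldTensor]
  exact DGModule.tlift_tmul (M := C.hom Y X) (N := C.barTensor X L Y') _ _ _

end

/-! ### Actions, contraction and internal differential on the augmented bar complex -/

section

variable {Y X Z Y' Y'' : C.Obj}

/-- Composition into the first factor on the augmented bar complex. -/
noncomputable def sumLeft : C.hom Y X →ₗ[k] C.BarSum X Y' →ₗ[k] C.BarSum Y Y' :=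
  LinearMap.flip (dsOut fun L => ((C.barLeft L).compr₂ (C.sumIn (Y := Y) (Y' := Y') L)).flip)

/-- Composition into the last factor on the augmented bar complex. -/
noncomputable def sumRight : C.hom Y' Y'' →ₗ[k] C.BarSum X Y' →ₗ[k] C.BarSum X Y'' :=
  LinearMap.flip (dsOut fun L => ((C.barRight L).compr₂ (C.sumIn (Y := X) (Y' := Y'') L)).flip)

/-- The internal differential of the augmented bar complex, without signs. -/
noncomputable def sumD : C.BarSum X Y' →ₗ[k] C.BarSum X Y' :=
  C.sumMap fun L => (C.barTensor X L Y').d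

theorem sumLeft_sumIn (g : C.hom Y X) (L : List C.Obj) (t : C.barTensor X L Y') :
    C.sumLeft g (C.sumIn L t) = C.sumIn L (C.barLeft L g t) := by
  simp [sumLeft, sumIn, LinearMap.compr₂_apply]

theorem sumRight_sumIn (g : C.hom Y' Y'') (L : List C.Obj) (t : C.barTensor X L Y') :
    C.sumRight g (C.sumIn L t) = C.sumIn L (C.barRight L g t) := by
  simp [sumRight, sumIn, LinearMap.compr₂_apply]

theorem sumMap_barLeft (g : C.hom Y X) (y : C.BarSum X Y') :
    C.sumMap (fun L => C.barLeft L g) y = C.sumLeft g y :=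
  LinearMap.congr_fun (C.barSum_ext fun L t => by rw [sumMap_sumIn, sumLeft_sumIn]) y

theorem sumMap_barRight (g : C.hom Y' Y'') (y : C.BarSum X Y') :
    C.sumMap (fun L => C.barRight L g) y = C.sumRight g y :=
  LinearMap.congr_fun (C.barSum_ext fun L t => by rw [sumMap_sumIn, sumRight_sumIn]) y

theorem sumLeft_nil (g : C.hom Y X) (f : C.hom X Y') :
    C.sumLeft g (C.sumNil f) = C.sumNil (C.comp g f) :=
  C.sumLeft_sumIn g [] f

theorem sumLeft_barCons (g : C.hom Y X) (f : C.hom X Z) (y : C.BarSum Z Y') :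
    C.sumLeft g (C.barCons f y) = C.barCons (C.comp g f) y := by
  refine LinearMap.congr_fun (f := C.sumLeft g ∘ₗ C.barCons f)
    (g := C.barCons (C.comp g f)) (C.barSum_ext fun L t => ?_) y
  simp only [LinearMap.comp_apply, barCons_sumIn, sumLeft_sumIn, barLeft_tmul]

theorem sumLeft_comp (g : C.hom Y X) (f : C.hom X Z) (y : C.BarSum Z Y') :
    C.sumLeft (C.comp g f) y = C.sumLeft g (C.sumLeft f y) := by
  refine LinearMap.congr_fun (f := C.sumLeft (C.comp g f))
    (g := C.sumLeft g ∘ₗ C.sumLeft f) (C.barSum_ext fun L t => ?_) y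
  simp only [LinearMap.comp_apply, sumLeft_sumIn, barLeft_comp]

theorem sumLeft_one (y : C.BarSum X Y') : C.sumLeft (C.one X) y = y := by
  refine LinearMap.congr_fun (f := C.sumLeft (C.one X)) (g := LinearMap.id)
    (C.barSum_ext fun L t => ?_) y
  simp only [LinearMap.id_apply, sumLeft_sumIn, barLeft_one]

theorem sumRight_nil (g : C.hom Y' Y'') (f : C.hom X Y') :
    C.sumRight g (C.sumNil f) = C.sumNil (C.comp f g) :=
  C.sumRight_sumIn g [] f

theorem sumRight_barCons (g : C.hom Y' Y'') (f : C.hom X Z) (y : C.BarSum Z Y') :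
    C.sumRight g (C.barCons f y) = C.barCons f (C.sumRight g y) := by
  refine LinearMap.congr_fun (f := C.sumRight g ∘ₗ C.barCons f)
    (g := C.barCons f ∘ₗ C.sumRight g) (C.barSum_ext fun L t => ?_) y
  simp only [LinearMap.comp_apply, barCons_sumIn, sumRight_sumIn, barRight_tmul]

theorem sumLeft_sumRight (f : C.hom Y X) (g : C.hom Y' Y'') (y : C.BarSum X Y') :
    C.sumLeft f (C.sumRight g y) = C.sumRight g (C.sumLeft f y) := by
  refine LinearMap.congr_fun (f := C.sumLeft f ∘ₗ C.sumRight g)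
    (g := C.sumRight g ∘ₗ C.sumLeft f) (C.barSum_ext fun L t => ?_) y
  simp only [LinearMap.comp_apply, sumLeft_sumIn, sumRight_sumIn, barLeft_barRight]

theorem sumContract_nil (f : C.hom X Y') : C.sumContract (C.sumNil f) = 0 := by
  exact C.sumContract_sumIn (L := []) f

/-- The contraction of the first two factors has sign +1, and all others move one place to the right
and change sign. For a single morphism y the term f·y lies in the summand of the empty list, so no
case distinction is needed. The prism identities rest on this recursion. -/
theorem sumContract_barCons (f : C.hom X Z) (y : C.BarSum Z Y') :
    C.sumContract (C.barCons f y) = C.sumLeft f y - C.barCons f (C.sumContract y) := by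
  refine LinearMap.congr_fun (f := C.sumContract ∘ₗ C.barCons f)
    (g := C.sumLeft f - C.barCons f ∘ₗ C.sumContract) (C.barSum_ext fun L t => ?_) y
  simp only [LinearMap.comp_apply, LinearMap.sub_apply, barCons_sumIn, sumLeft_sumIn,
    sumContract_sumIn, contract_tmul]

theorem sumContract_sumLeft (g : C.hom X Z) (y : C.BarSum Z Y') :
    C.sumContract (C.sumLeft g y) = C.sumLeft g (C.sumContract y) := by
  refine LinearMap.congr_fun (f := C.sumContract ∘ₗ C.sumLeft g)
    (g := C.sumLeft g ∘ₗ C.sumContract) (C.barSum_ext fun L t => ?_) y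
  simp only [LinearMap.comp_apply, sumLeft_sumIn, sumContract_sumIn, contract_left,
    sumMap_barLeft]

theorem sumD_nil (f : C.hom X Y') :
    C.sumD (C.sumNil f) = C.sumNil ((C.hom X Y').d f) :=
  C.sumMap_sumIn (L := []) _ f

theorem sumD_barCons (f : C.hom X Z) (y : C.BarSum Z Y') :
    C.sumD (C.barCons f y) = C.barCons ((C.hom X Z).d f) y +
      C.barCons ((C.hom X Z).koszul G.ι f) (C.sumD y) := by
  refine LinearMap.congr_fun (f := C.sumD ∘ₗ C.barCons f)
    (g := C.barCons ((C.hom X Z).d f) + C.barCons ((C.hom X Z).koszul G.ι f) ∘ₗ C.sumD)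
    (C.barSum_ext fun L t => ?_) y
  simp only [sumD, LinearMap.comp_apply, LinearMap.add_apply, barCons_sumIn, sumMap_sumIn,
    barTensor_d_tmul, map_add]

theorem sumD_sumLeft (f : C.hom X Z) (y : C.BarSum Z Y') :
    C.sumD (C.sumLeft f y) = C.sumLeft ((C.hom X Z).d f) y +
      C.sumLeft ((C.hom X Z).koszul G.ι f) (C.sumD y) := by
  refine LinearMap.congr_fun (f := C.sumD ∘ₗ C.sumLeft f)
    (g := C.sumLeft ((C.hom X Z).d f) + C.sumLeft ((C.hom X Z).koszul G.ι f) ∘ₗ C.sumD)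
    (C.barSum_ext fun L t => ?_) y
  simp only [sumD, LinearMap.comp_apply, LinearMap.add_apply, sumLeft_sumIn, sumMap_sumIn,
    barTensor_d_left, map_add]

end

/-! ### Length and degree -/

section

variable {Y X Y' : C.Obj}

/-- The elements of the augmented bar complex of a given length and degree. -/
noncomputable def lenGrade (n : ℕ) (i : Γ) (Y Y' : C.Obj) : Submodule k (C.BarSum Y Y') :=
  Submodule.span k {z | ∃ L : List C.Obj, L.length = n ∧
    ∃ s ∈ (C.barTensor Y L Y').grade i, z = C.sumIn L s}

theorem sumIn_mem {L : List C.Obj} {i : Γ} {s : C.barTensor Y L Y'}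
    (hs : s ∈ (C.barTensor Y L Y').grade i) : C.sumIn L s ∈ C.lenGrade L.length i Y Y' :=
  Submodule.subset_span ⟨L, rfl, s, hs, rfl⟩

theorem barCons_mem {n : ℕ} {i j : Γ} {f : C.hom Y X} {y : C.BarSum X Y'}
    (hf : f ∈ (C.hom Y X).grade i) (hy : y ∈ C.lenGrade n j X Y') :
    C.barCons f y ∈ C.lenGrade (n + 1) (i + j) Y Y' := by
  refine SetLike.le_def.1 (Submodule.span_le.2 ?_ :
    _ ≤ (C.lenGrade (n + 1) (i + j) Y Y').comap (C.barCons f)) hy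
  rintro _ ⟨L, rfl, s, hs, rfl⟩
  rw [SetLike.mem_coe, Submodule.mem_comap, barCons_sumIn]
  exact C.sumIn_mem (L := X :: L) (C.tcons_mem hf hs)

theorem sumLeft_mem {n : ℕ} {i j : Γ} {f : C.hom Y X} {y : C.BarSum X Y'}
    (hf : f ∈ (C.hom Y X).grade i) (hy : y ∈ C.lenGrade n j X Y') :
    C.sumLeft f y ∈ C.lenGrade n (i + j) Y Y' := by
  refine SetLike.le_def.1 (Submodule.span_le.2 ?_ :
    _ ≤ (C.lenGrade n (i + j) Y Y').comap (C.sumLeft f)) hy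
  rintro _ ⟨L, rfl, s, hs, rfl⟩
  rw [SetLike.mem_coe, Submodule.mem_comap, sumLeft_sumIn]
  exact C.sumIn_mem (C.barLeft_mem hf hs)

/-- Because p takes values in submodules, it suffices to treat homogeneous simple tensors, one
factor at a time. -/
theorem lenGrade_induction {p : ∀ (_ : ℕ) (_ : Γ) (Y : C.Obj), Submodule k (C.BarSum Y Y')}
    (hnil : ∀ i Y, ∀ f ∈ (C.hom Y Y').grade i, C.sumNil f ∈ p 0 i Y)
    (hcons : ∀ n i j Y X, ∀ f ∈ (C.hom Y X).grade i, ∀ y ∈ p n j X,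
      C.barCons f y ∈ p (n + 1) (i + j) Y) {n : ℕ} {i : Γ} :
    C.lenGrade n i Y Y' ≤ p n i Y := by
  refine Submodule.span_le.2 ?_
  rintro _ ⟨L, rfl, s, hs, rfl⟩
  induction L generalizing Y i with
  | nil => exact hnil i Y s hs
  | cons X L ih =>
    refine C.barTensor_grade_le (S := (p (X :: L).length i Y).comap (C.sumIn (X :: L))) ?_ hs
    rintro a b rfl f hf t ht
    rw [Submodule.mem_comap, ← barCons_sumIn]
    exact hcons _ _ _ _ _ f hf _ (ih t ht)

/-- The signs in the differential and in the left action depend on r, so identities on the bar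
complex are tested on elements of one length. A list of n + 1 objects X₀, …, Xₙ is the case r = n.
-/
theorem bar_ext_lenGrade {W : Type w} [AddCommGroup W] [Module k W]
    {a b : C.barComplex Y Y' →ₗ[k] W}
    (h : ∀ n i, ∀ y ∈ C.lenGrade (n + 1) i Y Y', a (C.barTruncate y) = b (C.barTruncate y)) :
    a = b := by
  refine C.bar_ext fun X L t => ?_
  induction t using DGModule.induction with
  | h0 => simp
  | hadd x y hx hy => simp only [map_add, hx, hy]
  | hin i t ht =>
    rw [← barTruncate_cons]
    exact h L.length i _ (C.sumIn_mem (L := X :: L) ht)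

/-- The shift by −nι for r = n makes degree i of the bar complex correspond to degree i + nι of the
unshifted tensor product. -/
theorem barTruncate_mem {n : ℕ} {i : Γ} {y : C.BarSum Y Y'}
    (hy : y ∈ C.lenGrade (n + 1) (i + n • G.ι) Y Y') :
    C.barTruncate y ∈ (C.barComplex Y Y').grade i := by
  refine SetLike.le_def.1 (Submodule.span_le.2 ?_ :
    _ ≤ ((C.barComplex Y Y').grade i).comap C.barTruncate) hy
  rintro _ ⟨L, hL, s, hs, rfl⟩
  rw [SetLike.mem_coe, Submodule.mem_comap]
  cases L with
  | nil => simp at hL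
  | cons X L =>
    obtain rfl : L.length = n := by simpa using hL
    rw [barTruncate_cons]
    exact C.barIn_mem hs

theorem bar_grade_le_lenGrade {i : Γ} {S : Submodule k (C.barComplex Y Y')}
    (h : ∀ n, ∀ y ∈ C.lenGrade (n + 1) (i + n • G.ι) Y Y', C.barTruncate y ∈ S) :
    (C.barComplex Y Y').grade i ≤ S := by
  refine C.bar_grade_le fun X L t ht => ?_
  rw [← barTruncate_cons]
  exact h L.length _ (C.sumIn_mem (L := X :: L) ht)

/-- The Koszul operator is linear in g and encodes the sign (-1)^(r⟨ι,|g|⟩), so g need not be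
homogeneous. -/
theorem barLact_barTruncate {n : ℕ} {i : Γ} (g : C.hom X Y) {y : C.BarSum Y Y'}
    (hy : y ∈ C.lenGrade (n + 1) i Y Y') :
    C.barLact g (C.barTruncate y) =
      C.barTruncate (C.sumLeft ((C.hom X Y).koszul (n • G.ι) g) y) := by
  refine SetLike.le_def.1 (Submodule.span_le.2 ?_ : _ ≤ LinearMap.eqLocus
    (C.barLact g ∘ₗ C.barTruncate)
    (C.barTruncate ∘ₗ C.sumLeft ((C.hom X Y).koszul (n • G.ι) g))) hy
  rintro _ ⟨L, hL, s, -, rfl⟩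
  cases L with
  | nil => simp at hL
  | cons Z L =>
    obtain rfl : L.length = n := by simpa using hL
    simp only [SetLike.mem_coe, LinearMap.mem_eqLocus, LinearMap.comp_apply, barTruncate_cons,
      sumLeft_sumIn, barLact_barIn]

theorem barRact_barTruncate (g : C.hom Y' X) (y : C.BarSum Y Y') :
    C.barRact (C.barTruncate y) g = C.barTruncate (C.sumRight g y) := by
  rw [barRact_truncate, sumMap_barRight]

/-- For n = 0 the contraction lands in the summand of the empty list, which truncation kills. This
is the convention that the second sum is omitted for r = 0. -/
theorem bar_d_barTruncate {n : ℕ} {i : Γ} {y : C.BarSum Y Y'}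
    (hy : y ∈ C.lenGrade (n + 1) i Y Y') :
    (C.barComplex Y Y').d (C.barTruncate y) =
      (-1 : k) ^ n • C.barTruncate (C.sumD y) + C.barTruncate (C.sumContract y) := by
  refine SetLike.le_def.1 (Submodule.span_le.2 ?_ : _ ≤ LinearMap.eqLocus
    ((C.barComplex Y Y').d ∘ₗ C.barTruncate)
    ((-1 : k) ^ n • C.barTruncate ∘ₗ C.sumD + C.barTruncate ∘ₗ C.sumContract)) hy
  rintro _ ⟨L, hL, s, -, rfl⟩
  cases L with
  | nil => simp at hL
  | cons Z L =>
    obtain rfl : L.length = n := by simpa using hL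
    simp only [SetLike.mem_coe, LinearMap.mem_eqLocus, LinearMap.comp_apply,
      LinearMap.add_apply, LinearMap.smul_apply, barTruncate_cons, sumD, sumMap_sumIn,
      bar_d_barIn, sumContract_sumIn]

/-- The linear map on the bar complex induced by a linear map on the augmented bar complex. -/
noncomputable def barDesc {W : Type w} [AddCommGroup W] [Module k W]
    (a : C.BarSum Y Y' →ₗ[k] W) : C.barComplex Y Y' →ₗ[k] W :=
  C.barOut fun X L => a ∘ₗ C.sumIn (X :: L)

/-- Truncation forgets exactly the summand of the empty list, so a linear map descends along it as
soon as it vanishes on single morphisms. -/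
theorem barDesc_barTruncate {W : Type w} [AddCommGroup W] [Module k W]
    {a : C.BarSum Y Y' →ₗ[k] W} (ha : ∀ f : C.hom Y Y', a (C.sumNil f) = 0)
    (y : C.BarSum Y Y') : C.barDesc a (C.barTruncate y) = a y := by
  refine LinearMap.congr_fun (f := C.barDesc a ∘ₗ C.barTruncate) (g := a)
    (C.barSum_ext fun L t => ?_) y
  cases L with
  | nil => rw [LinearMap.comp_apply, barTruncate_nil, map_zero]; exact (ha t).symm
  | cons X L => rw [LinearMap.comp_apply, barTruncate_cons, barDesc, barOut_barIn]; rfl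

theorem barTruncate_sumNil (f : C.hom Y Y') : C.barTruncate (C.sumNil f) = 0 :=
  C.barTruncate_nil f

end

/-- Linear maps that agree on simple tensors are equal. -/
theorem simpleTensor_ext {W : Type w} [AddCommGroup W] [Module k W] {Y' : C.Obj}
    (L : List C.Obj) {Y : C.Obj} {a b : C.barTensor Y L Y' →ₗ[k] W}
    (h : ∀ f, a (C.simpleTensor Y L Y' f) = b (C.simpleTensor Y L Y' f)) : a = b := by
  induction L generalizing Y with
  | nil => exact LinearMap.ext h
  | cons X L ih =>
    refine C.barTensor_ext fun f t => ?_
    exact LinearMap.congr_fun (ih (a := a ∘ₗ C.tcons L f) (b := b ∘ₗ C.tcons L f)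
      fun s => h (f, s)) t

end DGCategory

/-! ## The augmented bar complex and dg functors -/

namespace DGFunctor

variable {k : Type uk} [CommRing k] {Γ : Type ug} [AddCommGroup Γ] {G : SignedGrading Γ}
  {C : DGCategory.{uk, ug, u, v} k G} {D : DGCategory.{uk, ug, u', v'} k G}
  (F : DGFunctor C D)

theorem map_koszul (l : Γ) {X Y : C.Obj} (f : C.hom X Y) :
    F.map ((C.hom X Y).koszul l f) = (D.hom (F.obj X) (F.obj Y)).koszul l (F.map f) := by
  refine LinearMap.congr_fun (f := F.map ∘ₗ (C.hom X Y).koszul l)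
    (g := (D.hom (F.obj X) (F.obj Y)).koszul l ∘ₗ F.map)
    ((C.hom X Y).ext_homogeneous fun i x hx => ?_) f
  simp only [LinearMap.comp_apply, DGModule.koszul_of_mem _ _ hx,
    DGModule.koszul_of_mem _ _ (F.map_mem hx), map_smul]

section

variable {X Y Y' Y'' : C.Obj}

/-- The map of augmented bar complexes induced by a dg functor. -/
noncomputable def barSumMap {Y' : C.Obj} (Y : C.Obj) :
    C.BarSum Y Y' →ₗ[k] D.BarSum (F.obj Y) (F.obj Y') :=
  C.barFold (W := fun Y => D.BarSum (F.obj Y) (F.obj Y')) (fun _ => D.sumNil ∘ₗ F.map)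
    (fun _ _ => D.barCons ∘ₗ F.map) Y

theorem barSumMap_nil (f : C.hom Y Y') :
    F.barSumMap Y (C.sumNil f) = D.sumNil (F.map f) :=
  C.barFold_nil _ _ f

theorem barSumMap_cons (f : C.hom Y X) (y : C.BarSum X Y') :
    F.barSumMap Y (C.barCons f y) = D.barCons (F.map f) (F.barSumMap X y) :=
  C.barFold_cons _ _ f y

theorem barSumMap_sumLeft (f : C.hom Y X) (y : C.BarSum X Y') :
    F.barSumMap Y (C.sumLeft f y) = D.sumLeft (F.map f) (F.barSumMap X y) := by
  induction y using C.barSum_induction with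
  | h0 X => simp only [map_zero]
  | hadd X x y hx hy => simp only [map_add, hx, hy]
  | hnil X g =>
    simp only [DGCategory.sumLeft_nil, barSumMap_nil, F.map_comp]
  | hcons X Z g y _ =>
    simp only [DGCategory.sumLeft_barCons, barSumMap_cons, F.map_comp]

theorem barSumMap_sumRight (g : C.hom Y' Y'') (y : C.BarSum Y Y') :
    F.barSumMap Y (C.sumRight g y) = D.sumRight (F.map g) (F.barSumMap Y y) := by
  induction y using C.barSum_induction with
  | h0 X => simp only [map_zero]
  | hadd X x y hx hy => simp only [map_add, hx, hy]
  | hnil X f =>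
    simp only [DGCategory.sumRight_nil, barSumMap_nil, F.map_comp]
  | hcons X Z f y ih =>
    simp only [DGCategory.sumRight_barCons, barSumMap_cons, ih]

theorem barSumMap_sumContract (y : C.BarSum Y Y') :
    F.barSumMap Y (C.sumContract y) = D.sumContract (F.barSumMap Y y) := by
  induction y using C.barSum_induction with
  | h0 X => simp only [map_zero]
  | hadd X x y hx hy => simp only [map_add, hx, hy]
  | hnil X f => simp only [DGCategory.sumContract_nil, barSumMap_nil, map_zero]
  | hcons X Z f y ih =>
    simp only [DGCategory.sumContract_barCons, barSumMap_cons, barSumMap_sumLeft, map_sub, ih]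

theorem barSumMap_sumD (y : C.BarSum Y Y') :
    F.barSumMap Y (C.sumD y) = D.sumD (F.barSumMap Y y) := by
  induction y using C.barSum_induction with
  | h0 X => simp only [map_zero]
  | hadd X x y hx hy => simp only [map_add, hx, hy]
  | hnil X f => simp only [DGCategory.sumD_nil, barSumMap_nil, F.map_d]
  | hcons X Z f y ih =>
    simp only [DGCategory.sumD_barCons, barSumMap_cons, map_add, ih, F.map_d, F.map_koszul]

theorem barSumMap_mem {n : ℕ} {i : Γ} {y : C.BarSum Y Y'} (hy : y ∈ C.lenGrade n i Y Y') :
    F.barSumMap Y y ∈ D.lenGrade n i (F.obj Y) (F.obj Y') := by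
  refine C.lenGrade_induction
    (p := fun n i Y => (D.lenGrade n i (F.obj Y) (F.obj Y')).comap (F.barSumMap Y)) ?_ ?_ hy
  · intro i Y f hf
    rw [Submodule.mem_comap, barSumMap_nil]
    exact D.sumIn_mem (L := []) (F.map_mem hf)
  · intro n i j Y X f hf y hy
    rw [Submodule.mem_comap, barSumMap_cons]
    exact D.barCons_mem (F.map_mem hf) hy

end

/-! ### Splittings -/

/-- A decomposition of all objects of `D` into finite direct sums of objects in the image of a
dg functor `F : C → D`, together with the matrix entries of morphisms. -/
structure Splitting where
  Idx : D.Obj → Type t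
  [fintype : ∀ Y, Fintype (Idx Y)]
  obj : ∀ {Y : D.Obj}, Idx Y → C.Obj
  incl : ∀ {Y : D.Obj} (a : Idx Y), D.hom Y (F.obj (obj a))
  proj : ∀ {Y : D.Obj} (a : Idx Y), D.hom (F.obj (obj a)) Y
  incl_mem : ∀ {Y : D.Obj} (a : Idx Y), incl a ∈ (D.hom Y (F.obj (obj a))).grade 0
  proj_mem : ∀ {Y : D.Obj} (a : Idx Y), proj a ∈ (D.hom (F.obj (obj a)) Y).grade 0
  d_incl : ∀ {Y : D.Obj} (a : Idx Y), (D.hom Y (F.obj (obj a))).d (incl a) = 0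
  d_proj : ∀ {Y : D.Obj} (a : Idx Y), (D.hom (F.obj (obj a)) Y).d (proj a) = 0
  -- Completeness is the only relation imposed between inclusions and projections; orthogonality π_b
  -- σ_a = 0 for a ≠ b is not part of the data.
  sum_incl_proj : ∀ Y : D.Obj, ∑ a : Idx Y, D.comp (incl a) (proj a) = D.one Y
  entry : ∀ {X Y : D.Obj} (a : Idx X) (b : Idx Y), D.hom X Y →ₗ[k] C.hom (obj a) (obj b)
  entry_mem : ∀ {X Y : D.Obj} (a : Idx X) (b : Idx Y) {i : Γ} {f : D.hom X Y},
    f ∈ (D.hom X Y).grade i → entry a b f ∈ (C.hom (obj a) (obj b)).grade i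
  entry_d : ∀ {X Y : D.Obj} (a : Idx X) (b : Idx Y) (f : D.hom X Y),
    entry a b ((D.hom X Y).d f) = (C.hom (obj a) (obj b)).d (entry a b f)
  -- F is not assumed faithful, so `map_entry` would give this rule only after applying F; it is
  -- imposed in C itself.
  entry_comp : ∀ {X Y Z : D.Obj} (a : Idx X) (c : Idx Z) (f : D.hom X Y) (g : D.hom Y Z),
    entry a c (D.comp f g) = ∑ b, C.comp (entry a b f) (entry b c g)
  map_entry : ∀ {X Y : D.Obj} (a : Idx X) (b : Idx Y) (f : D.hom X Y),
    F.map (entry a b f) = D.comp (proj a) (D.comp f (incl b))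

namespace Splitting

attribute [instance] Splitting.fintype

variable {F} (S : F.Splitting)

/-! ### Completeness relations for matrix entries -/

section

variable {X Y Z : D.Obj}

theorem entry_koszul (l : Γ) (a : S.Idx X) (b : S.Idx Y) (f : D.hom X Y) :
    S.entry a b ((D.hom X Y).koszul l f) =
      (C.hom (S.obj a) (S.obj b)).koszul l (S.entry a b f) := by
  refine LinearMap.congr_fun (f := S.entry a b ∘ₗ (D.hom X Y).koszul l)
    (g := (C.hom (S.obj a) (S.obj b)).koszul l ∘ₗ S.entry a b)
    ((D.hom X Y).ext_homogeneous fun i x hx => ?_) f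
  simp only [LinearMap.comp_apply, DGModule.koszul_of_mem _ _ hx,
    DGModule.koszul_of_mem _ _ (S.entry_mem a b hx), map_smul]

theorem koszul_incl (l : Γ) (a : S.Idx Y) :
    (D.hom Y (F.obj (S.obj a))).koszul l (S.incl a) = S.incl a := by
  rw [DGModule.koszul_of_mem _ _ (S.incl_mem a), SignedGrading.sgn_zero_right, one_smul]

theorem koszul_proj (l : Γ) (a : S.Idx Y) :
    (D.hom (F.obj (S.obj a)) Y).koszul l (S.proj a) = S.proj a := by
  rw [DGModule.koszul_of_mem _ _ (S.proj_mem a), SignedGrading.sgn_zero_right, one_smul]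

/-- Inserting 1 = ∑ σ_a π_a in front of f σ_b produces the entries. In this form they can be moved
across ⊗_C, which makes Ξ left linear; `sum_entry_proj` does the same on the right. -/
theorem sum_incl_entry (f : D.hom X Y) (b : S.Idx Y) :
    ∑ a, D.comp (S.incl a) (F.map (S.entry a b f)) = D.comp f (S.incl b) := by
  simp only [S.map_entry, ← D.assoc (S.incl _)]
  rw [← LinearMap.sum_apply, ← map_sum, S.sum_incl_proj, D.one_comp]

theorem sum_entry_proj (f : D.hom X Y) (a : S.Idx X) :
    ∑ b, D.comp (F.map (S.entry a b f)) (S.proj b) = D.comp (S.proj a) f := by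
  simp only [S.map_entry, D.assoc]
  rw [← map_sum, ← map_sum, S.sum_incl_proj, D.comp_one]

end

/-! ### Tensors of matrix entries, summed over the intermediate indices -/

section

variable {X Y Z Y' Y'' : D.Obj}

/-- The sums over all choices of indices of the matrix entries of the factors. -/
noncomputable def entries {Y' : D.Obj} (b : S.Idx Y') (Y : D.Obj) :
    D.BarSum Y Y' →ₗ[k] ∀ a : S.Idx Y, C.BarSum (S.obj a) (S.obj b) :=
  D.barFold (W := fun Y => ∀ a : S.Idx Y, C.BarSum (S.obj a) (S.obj b))
    (fun _ => LinearMap.pi fun a => C.sumNil ∘ₗ S.entry a b)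
    (fun Y X => LinearMap.mk₂ k
      (fun f w a => ∑ c : S.Idx X, C.barCons (S.entry (X := Y) a c f) (w c))
      (fun f f' w => by
        funext a; simp only [map_add, LinearMap.add_apply, Finset.sum_add_distrib, Pi.add_apply])
      (fun r f w => by
        funext a; simp only [map_smul, LinearMap.smul_apply, Finset.smul_sum, Pi.smul_apply])
      (fun f w w' => by
        funext a; simp only [map_add, Finset.sum_add_distrib, Pi.add_apply])
      (fun r f w => by
        funext a; simp only [map_smul, Finset.smul_sum, Pi.smul_apply])) Y

variable (b : S.Idx Y') (a : S.Idx Y)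

theorem entries_nil (f : D.hom Y Y') :
    S.entries b Y (D.sumNil f) a = C.sumNil (S.entry a b f) :=
  congrFun (D.barFold_nil
    (W := fun Y => ∀ a : S.Idx Y, C.BarSum (S.obj a) (S.obj b)) _ _ f) a

theorem entries_cons (f : D.hom Y X) (y : D.BarSum X Y') :
    S.entries b Y (D.barCons f y) a =
      ∑ c, C.barCons (S.entry a c f) (S.entries b X y c) :=
  congrFun (D.barFold_cons
    (W := fun Y => ∀ a : S.Idx Y, C.BarSum (S.obj a) (S.obj b)) _ _ f y) a

theorem entries_sumIn_cons {L : List D.Obj} (f : D.hom Y X) (s : D.barTensor X L Y') :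
    S.entries b Y (D.sumIn (X :: L) (D.tcons L f s)) a =
      ∑ c, C.barCons (S.entry a c f) (S.entries b X (D.sumIn L s) c) := by
  rw [← D.barCons_sumIn, entries_cons]

/-- Composition into the first factor multiplies its matrix from the left, by `entry_comp`; the
remaining factors are untouched. -/
theorem entries_sumLeft (f : D.hom Y X) (y : D.BarSum X Y') :
    S.entries b Y (D.sumLeft f y) a =
      ∑ c, C.sumLeft (S.entry a c f) (S.entries b X y c) := by
  induction y using D.barSum_induction with
  | h0 X => simp only [map_zero, Pi.zero_apply, Finset.sum_const_zero]
  | hadd X x y hx hy =>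
    simp only [map_add, Pi.add_apply, hx, hy, Finset.sum_add_distrib]
  | hnil X g =>
    simp only [DGCategory.sumLeft_nil, entries_nil, S.entry_comp, map_sum]
  | hcons X Z g y _ =>
    simp only [DGCategory.sumLeft_barCons, entries_cons, S.entry_comp, map_sum,
      LinearMap.sum_apply]
    -- The index of the object where f meets g and the index of the next object are summed in
    -- opposite orders.
    exact Finset.sum_comm

theorem entries_sumRight (b : S.Idx Y'') (g : D.hom Y' Y'') (y : D.BarSum Y Y') :
    S.entries b Y (D.sumRight g y) a =
      ∑ b', C.sumRight (S.entry b' b g) (S.entries b' Y y a) := by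
  induction y using D.barSum_induction with
  | h0 X => simp only [map_zero, Pi.zero_apply, Finset.sum_const_zero]
  | hadd X x y hx hy =>
    simp only [map_add, Pi.add_apply, hx, hy, Finset.sum_add_distrib]
  | hnil X f =>
    simp only [DGCategory.sumRight_nil, entries_nil, S.entry_comp, map_sum]
  | hcons X Z f y ih =>
    simp only [DGCategory.sumRight_barCons, entries_cons, map_sum, ih]
    exact Finset.sum_comm

/-- Contracting at an object, after summing over its index, is matrix multiplication. Hence the
entries of a composite appear on both sides, and sums over indices are compatible with the bar
differential. -/
theorem entries_sumContract (y : D.BarSum Y Y') :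
    S.entries b Y (D.sumContract y) a = C.sumContract (S.entries b Y y a) := by
  induction y using D.barSum_induction with
  | h0 X => simp only [map_zero, Pi.zero_apply]
  | hadd X x y hx hy => simp only [map_add, Pi.add_apply, hx, hy]
  | hnil X f =>
    simp only [DGCategory.sumContract_nil, entries_nil, map_zero, Pi.zero_apply]
  | hcons X Z f y ih =>
    simp only [DGCategory.sumContract_barCons, entries_cons, entries_sumLeft, map_sub,
      Pi.sub_apply, map_sum, ih, Finset.sum_sub_distrib]

theorem entries_sumD (y : D.BarSum Y Y') :
    S.entries b Y (D.sumD y) a = C.sumD (S.entries b Y y a) := by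
  induction y using D.barSum_induction with
  | h0 X => simp only [map_zero, Pi.zero_apply]
  | hadd X x y hx hy => simp only [map_add, Pi.add_apply, hx, hy]
  | hnil X f => simp only [DGCategory.sumD_nil, entries_nil, S.entry_d]
  | hcons X Z f y ih =>
    simp only [DGCategory.sumD_barCons, entries_cons, map_add, Pi.add_apply, map_sum, ih,
      S.entry_d, S.entry_koszul, Finset.sum_add_distrib]

theorem entries_mem {n : ℕ} {i : Γ} {y : D.BarSum Y Y'} (hy : y ∈ D.lenGrade n i Y Y') :
    S.entries b Y y a ∈ C.lenGrade n i (S.obj a) (S.obj b) := by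
  -- The infimum puts the claims for all left indices into one submodule, because the induction step
  -- needs the claim at every index c of the next object. The given index a is read off at the end.
  refine D.lenGrade_induction (p := fun n i Y => ⨅ a : S.Idx Y,
    (C.lenGrade n i (S.obj a) (S.obj b)).comap (LinearMap.proj a ∘ₗ S.entries b Y)) ?_ ?_ hy
    |> (Submodule.mem_iInf _).1 <| a
  · intro i Y f hf
    refine (Submodule.mem_iInf _).2 fun a => ?_
    rw [Submodule.mem_comap, LinearMap.comp_apply, LinearMap.proj_apply, entries_nil]
    exact C.sumIn_mem (L := []) (S.entry_mem a b hf)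
  · intro n i j Y X f hf y hy
    refine (Submodule.mem_iInf _).2 fun a => ?_
    rw [Submodule.mem_comap, LinearMap.comp_apply, LinearMap.proj_apply, entries_cons]
    exact Submodule.sum_mem _ fun c _ =>
      C.barCons_mem (S.entry_mem a c hf) ((Submodule.mem_iInf _).1 hy c)

end

/-! ### The prism operator -/

section

variable {X Y Z Y' Y'' : D.Obj}

/-- The map `y ↦ ∑ σ_a ⊗ π_a y`. -/
noncomputable def insert : D.BarSum Y Y' →ₗ[k] D.BarSum Y Y' :=
  ∑ a : S.Idx Y, D.barCons (S.incl a) ∘ₗ D.sumLeft (S.proj a)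

theorem insert_apply (y : D.BarSum Y Y') :
    S.insert y = ∑ a : S.Idx Y, D.barCons (S.incl a) (D.sumLeft (S.proj a) y) := by
  simp only [insert, LinearMap.sum_apply, LinearMap.comp_apply]

/-- This is the extra degeneracy: δ(σ_a ⊗ π_a y) = σ_a π_a y − σ_a ⊗ π_a δy, and ∑ σ_a π_a = 1. -/
theorem sumContract_insert (y : D.BarSum Y Y') :
    D.sumContract (S.insert y) = y - S.insert (D.sumContract y) := by
  simp only [insert_apply, map_sum, DGCategory.sumContract_barCons, DGCategory.sumContract_sumLeft,
    Finset.sum_sub_distrib, ← DGCategory.sumLeft_comp]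
  rw [← LinearMap.sum_apply, ← map_sum, S.sum_incl_proj, DGCategory.sumLeft_one]

/-- No sign appears, since σ_a and π_a are closed of degree zero. -/
theorem sumD_insert (y : D.BarSum Y Y') : D.sumD (S.insert y) = S.insert (D.sumD y) := by
  simp only [insert_apply, map_sum, DGCategory.sumD_barCons, DGCategory.sumD_sumLeft, S.d_incl,
    S.d_proj, S.koszul_incl, S.koszul_proj, map_zero, LinearMap.zero_apply, zero_add]

theorem sumRight_insert (g : D.hom Y' Y'') (y : D.BarSum Y Y') :
    D.sumRight g (S.insert y) = S.insert (D.sumRight g y) := by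
  simp only [insert_apply, map_sum, DGCategory.sumRight_barCons, DGCategory.sumLeft_sumRight]

theorem insert_mem {n : ℕ} {i : Γ} {y : D.BarSum Y Y'} (hy : y ∈ D.lenGrade n i Y Y') :
    S.insert y ∈ D.lenGrade (n + 1) i Y Y' := by
  rw [insert_apply]
  refine Submodule.sum_mem _ fun a _ => ?_
  have h := D.barCons_mem (S.incl_mem a) (D.sumLeft_mem (S.proj_mem a) hy)
  rwa [zero_add, zero_add] at h

/-- The map that replaces all objects strictly between the ends by their summands. -/
noncomputable def expand {Y' : D.Obj} (Y : D.Obj) : D.BarSum Y Y' →ₗ[k] D.BarSum Y Y' :=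
  D.barFold (W := fun Y => D.BarSum Y Y') (fun _ => D.sumNil)
    (fun _ _ => D.sumLeft.compl₂ S.insert) Y

theorem expand_nil (f : D.hom Y Y') : S.expand Y (D.sumNil f) = D.sumNil f :=
  D.barFold_nil _ _ f

/-- Unwinding gives f₀ ⊗ ⋯ ⊗ fᵣ₊₁ ↦ ∑ f₀σ ⊗ πf₁σ ⊗ ⋯ ⊗ πfᵣ₊₁, with one index for each object between
the ends. -/
theorem expand_cons (f : D.hom Y X) (y : D.BarSum X Y') :
    S.expand Y (D.barCons f y) = D.sumLeft f (S.insert (S.expand X y)) :=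
  D.barFold_cons _ _ f y

theorem expand_sumLeft (f : D.hom Y X) (y : D.BarSum X Y') :
    S.expand Y (D.sumLeft f y) = D.sumLeft f (S.expand X y) := by
  induction y using D.barSum_induction with
  | h0 X => simp only [map_zero]
  | hadd X x y hx hy => simp only [map_add, hx, hy]
  | hnil X g => simp only [DGCategory.sumLeft_nil, expand_nil]
  | hcons X Z g y _ =>
    simp only [DGCategory.sumLeft_barCons, expand_cons, DGCategory.sumLeft_comp]

theorem expand_sumRight (g : D.hom Y' Y'') (y : D.BarSum Y Y') :
    S.expand Y (D.sumRight g y) = D.sumRight g (S.expand Y y) := by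
  induction y using D.barSum_induction with
  | h0 X => simp only [map_zero]
  | hadd X x y hx hy => simp only [map_add, hx, hy]
  | hnil X f => simp only [DGCategory.sumRight_nil, expand_nil]
  | hcons X Z f y ih =>
    simp only [DGCategory.sumRight_barCons, expand_cons, ih, ← sumRight_insert,
      DGCategory.sumLeft_sumRight]

/-- Writing ε for the expansion and s for the insertion, δs = 1 − sδ gives δ(f·s(εy)) = f·εy −
f·s(δεy), and by induction this is ε(f·y − f ⊗ δy). -/
theorem expand_sumContract (y : D.BarSum Y Y') :
    S.expand Y (D.sumContract y) = D.sumContract (S.expand Y y) := by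
  induction y using D.barSum_induction with
  | h0 X => simp only [map_zero]
  | hadd X x y hx hy => simp only [map_add, hx, hy]
  | hnil X f => simp only [DGCategory.sumContract_nil, expand_nil, map_zero]
  | hcons X Z f y ih =>
    simp only [DGCategory.sumContract_barCons, expand_cons, map_sub, expand_sumLeft, ih,
      DGCategory.sumContract_sumLeft, sumContract_insert]

theorem expand_sumD (y : D.BarSum Y Y') :
    S.expand Y (D.sumD y) = D.sumD (S.expand Y y) := by
  induction y using D.barSum_induction with
  | h0 X => simp only [map_zero]
  | hadd X x y hx hy => simp only [map_add, hx, hy]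
  | hnil X f => simp only [DGCategory.sumD_nil, expand_nil]
  | hcons X Z f y ih =>
    simp only [DGCategory.sumD_barCons, expand_cons, map_add, ih,
      DGCategory.sumD_sumLeft, sumD_insert]

theorem expand_mem {n : ℕ} {i : Γ} {y : D.BarSum Y Y'} (hy : y ∈ D.lenGrade n i Y Y') :
    S.expand Y y ∈ D.lenGrade n i Y Y' := by
  refine D.lenGrade_induction (p := fun n i Y => (D.lenGrade n i Y Y').comap (S.expand Y))
    ?_ ?_ hy
  · intro i Y f hf
    rw [Submodule.mem_comap, expand_nil]
    exact D.sumIn_mem (L := []) hf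
  · intro n i j Y X f hf y hy
    rw [Submodule.mem_comap, expand_cons]
    exact D.sumLeft_mem hf (S.insert_mem hy)

/-- Since F(f_{ac}) = π_a f σ_c, every intermediate index contributes a σ to one factor and a π to
the next, exactly as in the expansion. Only the outer π_a and π_b remain: the former appears on the
right side, the latter is absorbed by completeness. -/
theorem sum_barSumMap_entries (y : D.BarSum Y Y') (a : S.Idx Y) :
    ∑ b, D.sumRight (S.proj b) (F.barSumMap _ (S.entries b Y y a)) =
      D.sumLeft (S.proj a) (S.expand Y y) := by
  induction y using D.barSum_induction with
  | h0 X => simp only [map_zero, Pi.zero_apply, Finset.sum_const_zero]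
  | hadd X x y hx hy => simp only [map_add, Pi.add_apply, Finset.sum_add_distrib, hx, hy]
  | hnil X f =>
    simp only [entries_nil, barSumMap_nil, DGCategory.sumRight_nil, expand_nil,
      DGCategory.sumLeft_nil, ← map_sum, S.sum_entry_proj]
  | hcons X Z f y ih =>
    simp only [entries_cons, map_sum, barSumMap_cons, DGCategory.sumRight_barCons, expand_cons]
    -- The sum over b is moved inside the sum over the index c of the next object, where the
    -- induction hypothesis applies for each c.
    rw [Finset.sum_comm]
    simp only [← map_sum, ih, insert_apply]
    simp only [map_sum, DGCategory.sumLeft_barCons, S.map_entry]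

/-- The pair of the map `expand` and the prism operator between it and the identity. -/
noncomputable def expandPrism {Y' : D.Obj} (Y : D.Obj) :
    D.BarSum Y Y' →ₗ[k] D.BarSum Y Y' × D.BarSum Y Y' :=
  D.barFold (W := fun Y => D.BarSum Y Y' × D.BarSum Y Y') (fun _ => D.sumNil.prod 0)
    (fun _ _ => LinearMap.mk₂ k
      -- The recursion for the prism operator P involves the expansion of the tail besides P of the
      -- tail, so P is not a fold by itself. The pair (εy, Py) is one: ε(f ⊗ y) = f·s(εy) and P(f ⊗
      -- y) = f ⊗ (s(εy) − Py).
      (fun f w => (D.sumLeft f (S.insert w.1), D.barCons f (S.insert w.1 - w.2)))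
      (fun f f' w => by simp only [map_add, LinearMap.add_apply, Prod.mk_add_mk])
      (fun r f w => by simp only [map_smul, LinearMap.smul_apply, Prod.smul_mk])
      (fun f w w' => by
        simp only [Prod.fst_add, Prod.snd_add, Prod.mk_add_mk, ← map_add]
        simp only [map_add, add_sub_add_comm])
      (fun r f w => by
        simp only [map_smul, Prod.smul_fst, Prod.smul_snd, Prod.smul_mk, ← smul_sub])) Y

/-- The prism operator between the identity and `expand`. -/
noncomputable def prism {Y' : D.Obj} (Y : D.Obj) : D.BarSum Y Y' →ₗ[k] D.BarSum Y Y' :=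
  LinearMap.snd k _ _ ∘ₗ S.expandPrism Y

theorem expandPrism_cons (f : D.hom Y X) (y : D.BarSum X Y') :
    S.expandPrism Y (D.barCons f y) = (D.sumLeft f (S.insert (S.expandPrism X y).1),
      D.barCons f (S.insert (S.expandPrism X y).1 - (S.expandPrism X y).2)) :=
  D.barFold_cons (W := fun Y => D.BarSum Y Y' × D.BarSum Y Y') _ _ f y

theorem expandPrism_nil (f : D.hom Y Y') : S.expandPrism Y (D.sumNil f) = (D.sumNil f, 0) :=
  D.barFold_nil (W := fun Y => D.BarSum Y Y' × D.BarSum Y Y') _ _ f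

theorem expandPrism_fst (y : D.BarSum Y Y') : (S.expandPrism Y y).1 = S.expand Y y := by
  induction y using D.barSum_induction with
  | h0 X => simp only [map_zero, Prod.fst_zero]
  | hadd X x y hx hy => simp only [map_add, Prod.fst_add, hx, hy]
  | hnil X f => rw [expandPrism_nil, expand_nil]
  | hcons X Z f y ih => rw [expandPrism_cons, ih, expand_cons]

theorem prism_nil (f : D.hom Y Y') : S.prism Y (D.sumNil f) = 0 := by
  rw [prism, LinearMap.comp_apply, expandPrism_nil, LinearMap.snd_apply]

/-- Unwinding gives the usual prism, the sum over 0 ≤ i ≤ r of (-1)^i f₀ ⊗ ⋯ ⊗ fᵢ ⊗ s(ε(fᵢ₊₁ ⊗ ⋯ ⊗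
fᵣ₊₁)): the factors up to fᵢ are kept and those after it are expanded. -/
theorem prism_cons (f : D.hom Y X) (y : D.BarSum X Y') :
    S.prism Y (D.barCons f y) = D.barCons f (S.insert (S.expand X y) - S.prism X y) := by
  rw [prism, LinearMap.comp_apply, expandPrism_cons, expandPrism_fst, LinearMap.snd_apply]
  rfl

/-- The recursion keeps the first factor in front, so composition into it passes through. The
insertion s lacks this property, which is why s itself cannot serve as a bimodule homotopy. -/
theorem prism_sumLeft (f : D.hom Y X) (y : D.BarSum X Y') :
    S.prism Y (D.sumLeft f y) = D.sumLeft f (S.prism X y) := by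
  induction y using D.barSum_induction with
  | h0 X => simp only [map_zero]
  | hadd X x y hx hy => simp only [map_add, hx, hy]
  | hnil X g => simp only [DGCategory.sumLeft_nil, prism_nil, map_zero]
  | hcons X Z g y _ => simp only [DGCategory.sumLeft_barCons, prism_cons]

theorem prism_sumRight (g : D.hom Y' Y'') (y : D.BarSum Y Y') :
    S.prism Y (D.sumRight g y) = D.sumRight g (S.prism Y y) := by
  induction y using D.barSum_induction with
  | h0 X => simp only [map_zero]
  | hadd X x y hx hy => simp only [map_add, hx, hy]
  | hnil X f => simp only [DGCategory.sumRight_nil, prism_nil, map_zero]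
  | hcons X Z f y ih =>
    simp only [DGCategory.sumRight_barCons, prism_cons, ih, expand_sumRight, ← sumRight_insert,
      map_sub]

theorem prism_sumD (y : D.BarSum Y Y') :
    S.prism Y (D.sumD y) = D.sumD (S.prism Y y) := by
  induction y using D.barSum_induction with
  | h0 X => simp only [map_zero]
  | hadd X x y hx hy => simp only [map_add, hx, hy]
  | hnil X f => simp only [DGCategory.sumD_nil, prism_nil, map_zero]
  | hcons X Z f y ih =>
    simp only [DGCategory.sumD_barCons, prism_cons, map_add, map_sub, ih, expand_sumD, sumD_insert]
    abel

/-- By δs = 1 − sδ, δP(f ⊗ y) = ε(f ⊗ y) − f·Py − f ⊗ (εy − sδεy − δPy), while left linearity gives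
Pδ(f ⊗ y) = f·Py − f ⊗ (sεδy − Pδy). In the sum the terms in s and f·Py cancel, and the identity for
y turns the rest into ε(f ⊗ y) − f ⊗ y. -/
theorem sumContract_prism (y : D.BarSum Y Y') :
    D.sumContract (S.prism Y y) + S.prism Y (D.sumContract y) = S.expand Y y - y := by
  induction y using D.barSum_induction with
  | h0 X => simp only [map_zero, add_zero, sub_zero]
  | hadd X x y hx hy =>
    simp only [map_add]
    rw [add_add_add_comm, hx, hy, add_sub_add_comm]
  | hnil X f =>
    simp only [DGCategory.sumContract_nil, prism_nil, expand_nil, map_zero, add_zero, sub_self]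
  | hcons X Z f y ih =>
    have h := congrArg (D.barCons f) ih
    simp only [map_add, map_sub] at h
    simp only [prism_cons, DGCategory.sumContract_barCons, map_sub, prism_sumLeft,
      expand_sumContract, sumContract_insert, expand_cons]
    -- With everything on one side, the goal and f ⊗ (the induction hypothesis) have the same terms
    -- after cancellation.
    rw [← sub_eq_zero] at h ⊢
    rw [← h]
    abel

theorem prism_mem {n : ℕ} {i : Γ} {y : D.BarSum Y Y'} (hy : y ∈ D.lenGrade n i Y Y') :
    S.prism Y y ∈ D.lenGrade (n + 1) i Y Y' := by
  -- The length and degree of the tail are carried along, since its expansion enters the recursion.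
  refine (SetLike.le_def.1 (D.lenGrade_induction (p := fun n i Y => D.lenGrade n i Y Y' ⊓
    (D.lenGrade (n + 1) i Y Y').comap (S.prism Y)) ?_ ?_) hy).2
  · intro i Y f hf
    refine ⟨D.sumIn_mem (L := []) hf, ?_⟩
    rw [SetLike.mem_coe, Submodule.mem_comap, prism_nil]
    exact Submodule.zero_mem _
  · intro n i j Y X f hf y hy
    refine ⟨D.barCons_mem hf hy.1, ?_⟩
    rw [SetLike.mem_coe, Submodule.mem_comap, prism_cons]
    exact D.barCons_mem hf (Submodule.sub_mem _ (S.insert_mem (S.expand_mem hy.1)) hy.2)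

end

end Splitting

end DGFunctor

/-! ## Extension of bimodule maps along dg functors -/

namespace DGBimodule

variable {k : Type uk} [CommRing k] {Γ : Type ug} [AddCommGroup Γ] {G : SignedGrading Γ}

/-! ### Bimodule maps of degree zero -/

section

variable {C : DGCategory.{uk, ug, u, v} k G} {D : DGCategory.{uk, ug, u', v'} k G}
  {M : DGBimodule.{uk, ug, u, v, w, u', v'} C D} {N : DGBimodule.{uk, ug, u, v, w', u', v'} C D}

/-- In degree zero the sign is trivial, so linearity over homogeneous morphisms extends to all
morphisms. -/
theorem Hom.map_lact_of_degree_zero (φ : Hom M N 0) {X X' : C.Obj} {Y : D.Obj} (f : C.hom X' X)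
    (m : M.obj X Y) : φ.map X' Y (M.lact f m) = N.lact f (φ.map X Y m) := by
  refine LinearMap.congr_fun (f := φ.map X' Y ∘ₗ M.lact.flip m) (g := N.lact.flip (φ.map X Y m))
    ((C.hom X' X).ext_homogeneous fun i f hf => ?_) f
  have h := φ.map_lact m hf
  rw [SignedGrading.sgn_zero_left, one_smul] at h
  exact h

theorem Hom.map_mem_of_degree_zero (φ : Hom M N 0) {X : C.Obj} {Y : D.Obj} {i : Γ}
    {m : M.obj X Y} (hm : m ∈ (M.obj X Y).grade i) : φ.map X Y m ∈ (N.obj X Y).grade i := by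
  have h := φ.map_mem hm
  rwa [add_zero] at h

theorem Hom.map_koszul_of_degree_zero (φ : Hom M N 0) (l : Γ) {X : C.Obj} {Y : D.Obj}
    (m : M.obj X Y) : φ.map X Y ((M.obj X Y).koszul l m) = (N.obj X Y).koszul l (φ.map X Y m) := by
  refine LinearMap.congr_fun (f := φ.map X Y ∘ₗ (M.obj X Y).koszul l)
    (g := (N.obj X Y).koszul l ∘ₗ φ.map X Y) ((M.obj X Y).ext_homogeneous fun i m hm => ?_) m
  simp only [LinearMap.comp_apply, DGModule.koszul_of_mem _ _ hm,
    DGModule.koszul_of_mem _ _ (φ.map_mem_of_degree_zero hm), map_smul]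

theorem Hom.isClosed_iff (φ : Hom M N 0) :
    φ.IsClosed ↔ ∀ X Y m, (N.obj X Y).d (φ.map X Y m) = φ.map X Y ((M.obj X Y).d m) := by
  refine forall₂_congr fun X Y => ?_
  rw [Hom.dmap, SignedGrading.sgn_zero_right, one_smul, sub_eq_zero, LinearMap.ext_iff]
  rfl

end

/-! ### Bimodule maps out of a tensor product -/

variable {A : DGCategory.{uk, ug, u₁, v₁} k G} {B : DGCategory.{uk, ug, u₂, v₂} k G}
  {E : DGCategory.{uk, ug, u₃, v₃} k G} {M : DGBimodule.{uk, ug, u₁, v₁, w, u₂, v₂} A B}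
  {N : DGBimodule.{uk, ug, u₂, v₂, w', u₃, v₃} B E}
  {P : DGBimodule.{uk, ug, u₁, v₁, w'', u₃, v₃} A E}

/-- The map of bimodules out of a tensor product given by a balanced family of bilinear maps that
commute with the outer actions. -/
noncomputable def tensorHom (a : ∀ X Y Z, M.obj X Y →ₗ[k] N.obj Y Z →ₗ[k] P.obj X Z)
    (ha : ∀ X Y Y' Z (m : M.obj X Y) (f : B.hom Y Y') (n : N.obj Y' Z),
      a X Y' Z (M.ract m f) n = a X Y Z m (N.lact f n))
    (hmem : ∀ X Y Z i j, ∀ m ∈ (M.obj X Y).grade i, ∀ n ∈ (N.obj Y Z).grade j,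
      a X Y Z m n ∈ (P.obj X Z).grade (i + j))
    (hlact : ∀ X X' Y Z (f : A.hom X' X) (m : M.obj X Y) (n : N.obj Y Z),
      a X' Y Z (M.lact f m) n = P.lact f (a X Y Z m n))
    (hract : ∀ X Y Z Z' (m : M.obj X Y) (n : N.obj Y Z) (g : E.hom Z Z'),
      a X Y Z' m (N.ract n g) = P.ract (a X Y Z m n) g) :
    Hom (M.tensor N) P 0 where
  map X Z := tensorLift (fun Y => a X Y Z) (fun Y Y' => ha X Y Y' Z)
  map_mem := by
    intro X Z i x hx
    rw [add_zero]
    refine tensorObj_grade_le (S := ((P.obj X Z).grade i).comap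
      (tensorLift (fun Y => a X Y Z) (fun Y Y' => ha X Y Y' Z))) ?_ hx
    rintro Y i j rfl m hm n hn
    rw [Submodule.mem_comap, tensorLift_tmk]
    exact hmem X Y Z i j m hm n hn
  map_lact := by
    intro X X' Z i f x _
    rw [SignedGrading.sgn_zero_left, one_smul]
    refine LinearMap.congr_fun
      (f := tensorLift (fun Y => a X' Y Z) (fun Y Y' => ha X' Y Y' Z) ∘ₗ M.tensorLact N f)
      (g := P.lact f ∘ₗ tensorLift (fun Y => a X Y Z) (fun Y Y' => ha X Y Y' Z))
      (tensorObj_ext fun Y m n => ?_) x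
    simp only [LinearMap.comp_apply, tensorLact_tmk, tensorLift_tmk, hlact]
  map_ract := by
    intro X Z Z' x g
    refine LinearMap.congr_fun
      (f := tensorLift (fun Y => a X Y Z') (fun Y Y' => ha X Y Y' Z') ∘ₗ (M.tensorRact N).flip g)
      (g := P.ract.flip g ∘ₗ tensorLift (fun Y => a X Y Z) (fun Y Y' => ha X Y Y' Z))
      (tensorObj_ext fun Y m n => ?_) x
    simp only [LinearMap.comp_apply, LinearMap.flip_apply, tensorRact_tmk, tensorLift_tmk, hract]

section

variable {a : ∀ X Y Z, M.obj X Y →ₗ[k] N.obj Y Z →ₗ[k] P.obj X Z}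
  {ha : ∀ X Y Y' Z (m : M.obj X Y) (f : B.hom Y Y') (n : N.obj Y' Z),
    a X Y' Z (M.ract m f) n = a X Y Z m (N.lact f n)}
  {hmem : ∀ X Y Z i j, ∀ m ∈ (M.obj X Y).grade i, ∀ n ∈ (N.obj Y Z).grade j,
    a X Y Z m n ∈ (P.obj X Z).grade (i + j)}
  {hlact : ∀ X X' Y Z (f : A.hom X' X) (m : M.obj X Y) (n : N.obj Y Z),
    a X' Y Z (M.lact f m) n = P.lact f (a X Y Z m n)}
  {hract : ∀ X Y Z Z' (m : M.obj X Y) (n : N.obj Y Z) (g : E.hom Z Z'),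
    a X Y Z' m (N.ract n g) = P.ract (a X Y Z m n) g}

theorem tensorHom_tmk {X : A.Obj} {Y : B.Obj} {Z : E.Obj} (m : M.obj X Y) (n : N.obj Y Z) :
    (tensorHom a ha hmem hlact hract).map X Z (M.tmk N m n) = a X Y Z m n :=
  tensorLift_tmk (fun Y => a X Y Z) (fun Y Y' => ha X Y Y' Z) m n

/-- The elements m ⊗ n span the tensor product, so closedness only needs the Leibniz rule for the
bilinear maps. -/
theorem tensorHom_isClosed (hd : ∀ X Y Z (m : M.obj X Y) (n : N.obj Y Z),
    (P.obj X Z).d (a X Y Z m n) =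
      a X Y Z ((M.obj X Y).d m) n + a X Y Z ((M.obj X Y).koszul G.ι m) ((N.obj Y Z).d n)) :
    (tensorHom a ha hmem hlact hract).IsClosed := by
  rw [Hom.isClosed_iff]
  intro X Z x
  refine LinearMap.congr_fun
    (f := (P.obj X Z).d ∘ₗ tensorLift (fun Y => a X Y Z) (fun Y Y' => ha X Y Y' Z))
    (g := tensorLift (fun Y => a X Y Z) (fun Y Y' => ha X Y Y' Z) ∘ₗ (M.tensorObj N X Z).d)
    (tensorObj_ext fun Y m n => ?_) x
  simp only [LinearMap.comp_apply, tensorObj_d_tmk, map_add, tensorLift_tmk, hd]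

end

end DGBimodule

/-! ## The bar complex and its extension along a dg functor -/

namespace DGFunctor

variable {k : Type uk} [CommRing k] {Γ : Type ug} [AddCommGroup Γ] {G : SignedGrading Γ}
  {C : DGCategory.{uk, ug, u, v} k G} {D : DGCategory.{uk, ug, u', v'} k G}
  (F : DGFunctor C D)

/-! ### The chain map of bar complexes induced by a dg functor -/

section

variable {X Y X' Y' : C.Obj}

/-- The map of bar complexes induced by a dg functor. -/
noncomputable def barMap : C.barComplex X Y →ₗ[k] D.barComplex (F.obj X) (F.obj Y) :=
  C.barDesc (D.barTruncate ∘ₗ F.barSumMap X)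

theorem barMap_barTruncate (y : C.BarSum X Y) :
    F.barMap (C.barTruncate y) = D.barTruncate (F.barSumMap X y) :=
  C.barDesc_barTruncate (fun f => by
    rw [LinearMap.comp_apply, barSumMap_nil, DGCategory.barTruncate_sumNil]) y

theorem barMap_mem {i : Γ} {x : C.barComplex X Y} (hx : x ∈ (C.barComplex X Y).grade i) :
    F.barMap x ∈ (D.barComplex (F.obj X) (F.obj Y)).grade i := by
  refine C.bar_grade_le_lenGrade
    (S := ((D.barComplex (F.obj X) (F.obj Y)).grade i).comap F.barMap) (fun n y hy => ?_) hx
  rw [Submodule.mem_comap, barMap_barTruncate]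
  exact D.barTruncate_mem (F.barSumMap_mem hy)

theorem barMap_lact (f : C.hom X' X) (x : C.barComplex X Y) :
    F.barMap (C.barLact f x) = D.barLact (F.map f) (F.barMap x) := by
  refine LinearMap.congr_fun (f := F.barMap ∘ₗ C.barLact f)
    (g := D.barLact (F.map f) ∘ₗ F.barMap) (C.bar_ext_lenGrade fun n i y hy => ?_) x
  -- F preserves length and degree, so the Koszul sign of the left action is the same on both sides.
  rw [LinearMap.comp_apply, LinearMap.comp_apply, C.barLact_barTruncate f hy, barMap_barTruncate,
    barMap_barTruncate, D.barLact_barTruncate _ (F.barSumMap_mem hy), barSumMap_sumLeft,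
    map_koszul]

theorem barMap_ract (x : C.barComplex X Y) (f : C.hom Y Y') :
    F.barMap (C.barRact x f) = D.barRact (F.barMap x) (F.map f) := by
  refine LinearMap.congr_fun (f := F.barMap ∘ₗ C.barRact.flip f)
    (g := D.barRact.flip (F.map f) ∘ₗ F.barMap) (C.bar_ext_lenGrade fun n i y _ => ?_) x
  simp only [LinearMap.comp_apply, LinearMap.flip_apply, DGCategory.barRact_barTruncate,
    barMap_barTruncate, barSumMap_sumRight]

theorem barMap_d (x : C.barComplex X Y) :
    (D.barComplex (F.obj X) (F.obj Y)).d (F.barMap x) = F.barMap ((C.barComplex X Y).d x) := by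
  refine LinearMap.congr_fun (f := (D.barComplex (F.obj X) (F.obj Y)).d ∘ₗ F.barMap)
    (g := F.barMap ∘ₗ (C.barComplex X Y).d) (C.bar_ext_lenGrade fun n i y hy => ?_) x
  simp only [LinearMap.comp_apply, C.bar_d_barTruncate hy, barMap_barTruncate,
    D.bar_d_barTruncate (F.barSumMap_mem hy), map_add, map_smul, barSumMap_sumD,
    barSumMap_sumContract]

end

/-- The bimodule `D ⊗_C Bar(C) ⊗_C D`. -/
noncomputable def extendedBar : DGBimodule.{uk, ug, u', v', max u v v', u', v'} D D :=
  ((D.idBimodule.restrictRight F).tensor C.bar).tensor (D.idBimodule.restrictLeft F)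

variable {X X' Z Z' : C.Obj} {Y Y' W W' : D.Obj}

/-- The element `g · x · g'` of `D ⊗_C Bar(C) ⊗_C D`. -/
noncomputable def extendedMk : D.hom Y (F.obj X) →ₗ[k] C.barComplex X X' →ₗ[k]
    D.hom (F.obj X') Y' →ₗ[k] F.extendedBar.obj Y Y' :=
  LinearMap.compr₂ (DGBimodule.tmk (D.idBimodule.restrictRight F) C.bar)
    (DGBimodule.tmk ((D.idBimodule.restrictRight F).tensor C.bar) (D.idBimodule.restrictLeft F))

theorem extendedMk_lact (g : D.hom Y (F.obj X)) (f : C.hom X Z) (x : C.barComplex Z X')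
    (g' : D.hom (F.obj X') Y') :
    F.extendedMk g (C.barLact f x) g' = F.extendedMk (D.comp g (F.map f)) x g' :=
  congrArg (fun z => DGBimodule.tmk ((D.idBimodule.restrictRight F).tensor C.bar)
    (D.idBimodule.restrictLeft F) z g') (DGBimodule.tmk_balanced
      (M := D.idBimodule.restrictRight F) (N := C.bar) g f x).symm

/-- Two moves: f first acts on the inner tensor product from the right, then crosses the outer
tensor sign. -/
theorem extendedMk_ract (g : D.hom Y (F.obj X)) (x : C.barComplex X Z) (f : C.hom Z X')
    (g' : D.hom (F.obj X') Y') :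
    F.extendedMk g (C.barRact x f) g' = F.extendedMk g x (D.comp (F.map f) g') :=
  (congrArg (fun z => DGBimodule.tmk ((D.idBimodule.restrictRight F).tensor C.bar)
    (D.idBimodule.restrictLeft F) z g') (DGBimodule.tensorRact_tmk
      (D.idBimodule.restrictRight F) C.bar g x f).symm).trans
    (DGBimodule.tmk_balanced (M := (D.idBimodule.restrictRight F).tensor C.bar)
      (N := D.idBimodule.restrictLeft F) _ f g')

theorem lact_extendedMk (h : D.hom W Y) (g : D.hom Y (F.obj X)) (x : C.barComplex X X')
    (g' : D.hom (F.obj X') Y') :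
    F.extendedBar.lact h (F.extendedMk g x g') = F.extendedMk (D.comp h g) x g' :=
  (DGBimodule.tensorLact_tmk ((D.idBimodule.restrictRight F).tensor C.bar)
    (D.idBimodule.restrictLeft F) h _ g').trans
    (congrArg (fun z => DGBimodule.tmk ((D.idBimodule.restrictRight F).tensor C.bar)
      (D.idBimodule.restrictLeft F) z g') (DGBimodule.tensorLact_tmk
        (D.idBimodule.restrictRight F) C.bar h g x))

theorem ract_extendedMk (g : D.hom Y (F.obj X)) (x : C.barComplex X X')
    (g' : D.hom (F.obj X') Y') (h : D.hom Y' W) :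
    F.extendedBar.ract (F.extendedMk g x g') h = F.extendedMk g x (D.comp g' h) :=
  DGBimodule.tensorRact_tmk ((D.idBimodule.restrictRight F).tensor C.bar)
    (D.idBimodule.restrictLeft F) _ g' h

theorem extendedMk_mem {i j l : Γ} {g : D.hom Y (F.obj X)} {x : C.barComplex X X'}
    {g' : D.hom (F.obj X') Y'} (hg : g ∈ (D.hom Y (F.obj X)).grade i)
    (hx : x ∈ (C.barComplex X X').grade j) (hg' : g' ∈ (D.hom (F.obj X') Y').grade l) :
    F.extendedMk g x g' ∈ (F.extendedBar.obj Y Y').grade (i + j + l) :=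
  DGBimodule.tmk_mem (M := (D.idBimodule.restrictRight F).tensor C.bar)
    (N := D.idBimodule.restrictLeft F)
    (DGBimodule.tmk_mem (M := D.idBimodule.restrictRight F) (N := C.bar) hg hx) hg'

/-- Only the middle factor is differentiated: dg and dg' vanish, and g of degree zero causes no
sign. The degree of g' is irrelevant, because it stands last. -/
theorem d_extendedMk {g : D.hom Y (F.obj X)} (x : C.barComplex X X') {g' : D.hom (F.obj X') Y'}
    (hg : g ∈ (D.hom Y (F.obj X)).grade 0) (hdg : (D.hom Y (F.obj X)).d g = 0)
    (hdg' : (D.hom (F.obj X') Y').d g' = 0) :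
    (F.extendedBar.obj Y Y').d (F.extendedMk g x g') =
      F.extendedMk g ((C.barComplex X X').d x) g' := by
  have h1 : ((D.idBimodule.restrictRight F).tensorObj C.bar Y X').d
      (DGBimodule.tmk (D.idBimodule.restrictRight F) C.bar g x) =
      DGBimodule.tmk (D.idBimodule.restrictRight F) C.bar g ((C.barComplex X X').d x) := by
    have e1 : ((D.idBimodule.restrictRight F).obj Y X).d g = 0 := hdg
    have e2 : ((D.idBimodule.restrictRight F).obj Y X).koszul G.ι g = g := by
      refine (DGModule.koszul_of_mem (D.hom Y (F.obj X)) _ hg).trans ?_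
      rw [SignedGrading.sgn_zero_right, one_smul]
    refine (DGBimodule.tensorObj_d_tmk (M := D.idBimodule.restrictRight F) (N := C.bar) g
      x).trans ?_
    rw [e1, e2, map_zero]
    exact zero_add _
  have e3 : ((D.idBimodule.restrictLeft F).obj X' Y').d g' = 0 := hdg'
  refine (DGBimodule.tensorObj_d_tmk (M := (D.idBimodule.restrictRight F).tensor C.bar)
    (N := D.idBimodule.restrictLeft F) _ g').trans ?_
  rw [e3, map_zero, add_zero]
  exact congrArg (fun z => DGBimodule.tmk ((D.idBimodule.restrictRight F).tensor C.bar)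
    (D.idBimodule.restrictLeft F) z g') h1

theorem extendedBar_ext {V : Type w} [AddCommGroup V] [Module k V]
    {a b : F.extendedBar.obj Y Y' →ₗ[k] V}
    (h : ∀ (X X' : C.Obj) (g : D.hom Y (F.obj X)) (x : C.barComplex X X')
      (g' : D.hom (F.obj X') Y'), a (F.extendedMk g x g') = b (F.extendedMk g x g')) : a = b := by
  refine DGBimodule.tensorObj_ext (M := (D.idBimodule.restrictRight F).tensor C.bar)
    (N := D.idBimodule.restrictLeft F) fun X' y g' => ?_
  refine LinearMap.congr_fun (f := a ∘ₗ (DGBimodule.tmk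
      ((D.idBimodule.restrictRight F).tensor C.bar) (D.idBimodule.restrictLeft F)).flip g')
    (g := b ∘ₗ (DGBimodule.tmk ((D.idBimodule.restrictRight F).tensor C.bar)
      (D.idBimodule.restrictLeft F)).flip g')
    (DGBimodule.tensorObj_ext (M := D.idBimodule.restrictRight F) (N := C.bar)
      fun X g x => h X X' g x g') y

/-- The map `g · x ↦ g · F(x)` from `D ⊗_C Bar(C)` to `Bar(D)`. -/
noncomputable def leftExtendedBarHom :
    DGBimodule.Hom ((D.idBimodule.restrictRight F).tensor C.bar) (D.bar.restrictRight F) 0 :=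
  DGBimodule.tensorHom (M := D.idBimodule.restrictRight F) (N := C.bar)
    (P := D.bar.restrictRight F)
    (fun Y X X' => (D.barLact (X := Y) (Y := F.obj X) (Y' := F.obj X')).compl₂ F.barMap)
    -- Balancedness holds because g·F(f)·F(x) = g·F(f·x).
    (fun _ _ _ _ g f x => (D.bar.comp_lact g (F.map f) (F.barMap x)).trans
      (congrArg (D.bar.lact g) (F.barMap_lact f x).symm))
    (fun _ _ _ _ _ _ hg _ hx => D.bar.lact_mem hg (F.barMap_mem hx))
    (fun _ _ _ _ h g x => D.bar.comp_lact h g (F.barMap x))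
    (fun _ _ _ _ g x f => (congrArg (D.barLact g) (F.barMap_ract x f)).trans
      (D.bar.lact_ract g (F.barMap x) (F.map f)))

theorem leftExtendedBarHom_isClosed : F.leftExtendedBarHom.IsClosed := by
  refine DGBimodule.tensorHom_isClosed fun Y X X' g x => ?_
  exact (D.bar_d_lact g (F.barMap x)).trans (congrArg
    (fun z => D.barLact ((D.hom Y (F.obj X)).d g) (F.barMap x) +
      D.barLact ((D.hom Y (F.obj X)).koszul G.ι g) z) (F.barMap_d x))

/-- The map `g · x · g' ↦ g · F(x) · g'` from `D ⊗_C Bar(C) ⊗_C D` to `Bar(D)`. -/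
noncomputable def extendedBarHom : DGBimodule.Hom F.extendedBar D.bar 0 :=
  DGBimodule.tensorHom (M := (D.idBimodule.restrictRight F).tensor C.bar)
    (N := D.idBimodule.restrictLeft F) (P := D.bar)
    (fun Y X' Y' => (D.barRact (Y := Y) (Y' := F.obj X') (X := Y')) ∘ₗ
      F.leftExtendedBarHom.map Y X')
    (fun Y X _ _ y f g => (congrArg (fun z => D.bar.ract z g)
      (F.leftExtendedBarHom.map_ract y f)).trans
      (D.bar.ract_comp (F.leftExtendedBarHom.map Y X y) (F.map f) g).symm)
    (fun _ _ _ _ _ _ hy _ hg =>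
      D.bar.ract_mem (F.leftExtendedBarHom.map_mem_of_degree_zero hy) hg)
    (fun Y _ X _ h y g => (congrArg (fun z => D.bar.ract z g)
      (F.leftExtendedBarHom.map_lact_of_degree_zero h y)).trans
      (D.bar.lact_ract h (F.leftExtendedBarHom.map Y X y) g).symm)
    (fun Y X _ _ y g h => D.bar.ract_comp (F.leftExtendedBarHom.map Y X y) g h)

/-- The Leibniz rule for the right action on Bar(D) applies; the left factor is handled by a closed
map of degree zero, which commutes with d and with the Koszul sign. -/
theorem extendedBarHom_isClosed : F.extendedBarHom.IsClosed := by
  refine DGBimodule.tensorHom_isClosed fun Y X Y' y g => ?_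
  have h := (DGBimodule.Hom.isClosed_iff _).1 F.leftExtendedBarHom_isClosed Y X y
  refine (D.bar.d_ract_koszul (F.leftExtendedBarHom.map Y X y) g).trans ?_
  exact congrArg₂ (fun z z' => D.bar.ract z g + D.bar.ract z' ((D.hom (F.obj X) Y').d g)) h
    (F.leftExtendedBarHom.map_koszul_of_degree_zero G.ι y).symm

/-- The linear maps `g · x · g' ↦ g · F(x) · g'` from `D ⊗_C Bar(C) ⊗_C D` to `Bar(D)`. -/
noncomputable def extendedBarMap (Y Y' : D.Obj) : F.extendedBar.obj Y Y' →ₗ[k] D.barComplex Y Y' :=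
  F.extendedBarHom.map Y Y'

theorem extendedBarMap_mk (g : D.hom Y (F.obj X)) (x : C.barComplex X X')
    (g' : D.hom (F.obj X') Y') :
    F.extendedBarMap Y Y' (F.extendedMk g x g') =
      D.barRact (D.barLact g (F.barMap x)) g' := by
  refine (DGBimodule.tensorHom_tmk (M := (D.idBimodule.restrictRight F).tensor C.bar)
    (N := D.idBimodule.restrictLeft F) (P := D.bar) _ g').trans ?_
  exact congrArg (fun z => D.barRact z g') (DGBimodule.tensorHom_tmk
    (M := D.idBimodule.restrictRight F) (N := C.bar) (P := D.bar.restrictRight F) g x)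

end DGFunctor

namespace DGBimodule.Hom

variable {k : Type uk} [CommRing k] {Γ : Type ug} [AddCommGroup Γ] {G : SignedGrading Γ}
  {C : DGCategory.{uk, ug, u, v} k G} {D : DGCategory.{uk, ug, u', v'} k G}
  {M : DGBimodule.{uk, ug, u, v, w, u', v'} C D} {N : DGBimodule.{uk, ug, u, v, w', u', v'} C D}

theorem homotopic_refl (φ : Hom M N 0) : Homotopic φ φ := by
  refine ⟨⟨fun _ _ => 0, fun _ => Submodule.zero_mem _, fun _ _ => ?_, fun _ _ => ?_⟩,
    fun X Y => ?_⟩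
  · simp
  · simp
  · simp [dmap]

end DGBimodule.Hom

namespace DGFunctor.Splitting

variable {k : Type uk} [CommRing k] {Γ : Type ug} [AddCommGroup Γ] {G : SignedGrading Γ}
  {C : DGCategory.{uk, ug, u, v} k G} {D : DGCategory.{uk, ug, u', v'} k G}
  {F : DGFunctor C D} (S : F.Splitting)

/-! ### The bimodule map defined by the sums over matrix entries -/

section

variable {Y Y' W : D.Obj}

/-- The map `y ↦ ∑ σ_a · E(y)_{a,b} · π_b`, for the matrix entries `E(y)` of `y`. -/
noncomputable def sumSplit (Y Y' : D.Obj) : D.BarSum Y Y' →ₗ[k] F.extendedBar.obj Y Y' :=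
  ∑ a : S.Idx Y, ∑ b : S.Idx Y', (F.extendedMk (S.incl a)).flip (S.proj b) ∘ₗ
    C.barTruncate ∘ₗ LinearMap.proj a ∘ₗ S.entries b Y

theorem sumSplit_apply (y : D.BarSum Y Y') :
    S.sumSplit Y Y' y = ∑ a, ∑ b,
      F.extendedMk (S.incl a) (C.barTruncate (S.entries b Y y a)) (S.proj b) := by
  simp only [sumSplit, LinearMap.sum_apply, LinearMap.comp_apply, LinearMap.flip_apply,
    LinearMap.proj_apply]

/-- The map from the bar complex of `D` to the extension of the bar complex of `C` that is given
by the sums over all matrix entries. -/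
noncomputable def splitMap (Y Y' : D.Obj) : D.barComplex Y Y' →ₗ[k] F.extendedBar.obj Y Y' :=
  D.barDesc (S.sumSplit Y Y')

theorem splitMap_barTruncate (y : D.BarSum Y Y') :
    S.splitMap Y Y' (D.barTruncate y) = ∑ a, ∑ b,
      F.extendedMk (S.incl a) (C.barTruncate (S.entries b Y y a)) (S.proj b) := by
  -- The map descends to the bar complex: entries of a single morphism stay in the summand of the
  -- empty list and are truncated away.
  refine (D.barDesc_barTruncate (fun f => ?_) y).trans (S.sumSplit_apply y)
  simp only [sumSplit_apply, entries_nil, DGCategory.barTruncate_sumNil, map_zero,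
    LinearMap.zero_apply, Finset.sum_const_zero]

theorem splitMap_barIn {X : D.Obj} {L : List D.Obj} (s : D.barTensor Y (X :: L) Y') :
    S.splitMap Y Y' (D.barIn X L s) = ∑ a, ∑ b, F.extendedMk (S.incl a)
      (C.barTruncate (S.entries b Y (D.sumIn (X :: L) s) a)) (S.proj b) := by
  rw [← D.barTruncate_cons, splitMap_barTruncate]

theorem splitMap_mem {i : Γ} {x : D.barComplex Y Y'} (hx : x ∈ (D.barComplex Y Y').grade i) :
    S.splitMap Y Y' x ∈ (F.extendedBar.obj Y Y').grade i := by
  refine D.bar_grade_le_lenGrade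
    (S := ((F.extendedBar.obj Y Y').grade i).comap (S.splitMap Y Y')) (fun n y hy => ?_) hx
  rw [Submodule.mem_comap, splitMap_barTruncate]
  refine Submodule.sum_mem _ fun a _ => Submodule.sum_mem _ fun b _ => ?_
  have h := F.extendedMk_mem (S.incl_mem a) (C.barTruncate_mem (S.entries_mem b a hy))
    (S.proj_mem b)
  rwa [zero_add, add_zero] at h

/-- Acting by g multiplies the first matrix, and ∑ σ_a · g_{ac}E(y)_{cb} · π_b equals gσ_c ·
E(y)_{cb} · π_b after moving g_{ac} across ⊗_C and applying `sum_incl_entry`. -/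
theorem splitMap_lact (g : D.hom W Y) (x : D.barComplex Y Y') :
    S.splitMap W Y' (D.barLact g x) = F.extendedBar.lact g (S.splitMap Y Y' x) := by
  refine LinearMap.congr_fun (f := S.splitMap W Y' ∘ₗ D.barLact g)
    (g := F.extendedBar.lact g ∘ₗ S.splitMap Y Y') (D.bar_ext_lenGrade fun n i y hy => ?_) x
  -- Taking entries keeps the length and the degree, so the sign of the left action on Bar(D) is the
  -- sign needed in Bar(C).
  have h : ∀ a b c, C.barTruncate (C.sumLeft (S.entry a c ((D.hom W Y).koszul (n • G.ι) g))
      (S.entries b Y y c)) =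
      C.barLact (S.entry a c g) (C.barTruncate (S.entries (Y' := Y') b Y y c)) := fun a b c => by
    rw [C.barLact_barTruncate _ (S.entries_mem b c hy), entry_koszul]
  simp only [LinearMap.comp_apply, D.barLact_barTruncate g hy, splitMap_barTruncate, map_sum,
    entries_sumLeft, h, LinearMap.sum_apply, F.extendedMk_lact, F.lact_extendedMk]
  simp only [← S.sum_incl_entry g, map_sum, LinearMap.sum_apply]
  rw [Finset.sum_comm]
  conv_rhs => rw [Finset.sum_comm]
  exact Finset.sum_congr rfl fun b _ => Finset.sum_comm

theorem splitMap_ract (x : D.barComplex Y Y') (g : D.hom Y' W) :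
    S.splitMap Y W (D.barRact x g) = F.extendedBar.ract (S.splitMap Y Y' x) g := by
  refine LinearMap.congr_fun (f := S.splitMap Y W ∘ₗ D.barRact.flip g)
    (g := F.extendedBar.ract.flip g ∘ₗ S.splitMap Y Y') (D.bar_ext_lenGrade fun n i y _ => ?_) x
  simp only [LinearMap.comp_apply, LinearMap.flip_apply, D.barRact_barTruncate,
    splitMap_barTruncate, map_sum, entries_sumRight, ← C.barRact_barTruncate, LinearMap.sum_apply,
    F.extendedMk_ract, F.ract_extendedMk, ← S.sum_entry_proj g]
  exact Finset.sum_congr rfl fun a _ => Finset.sum_comm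

/-- The outer factors σ_a and π_b are closed and σ_a has degree zero, so the differential acts on
the tensors of entries only, and these are compatible with both parts of it. -/
theorem splitMap_d (x : D.barComplex Y Y') :
    (F.extendedBar.obj Y Y').d (S.splitMap Y Y' x) = S.splitMap Y Y' ((D.barComplex Y Y').d x) := by
  refine LinearMap.congr_fun (f := (F.extendedBar.obj Y Y').d ∘ₗ S.splitMap Y Y')
    (g := S.splitMap Y Y' ∘ₗ (D.barComplex Y Y').d) (D.bar_ext_lenGrade fun n i y hy => ?_) x
  simp only [LinearMap.comp_apply, D.bar_d_barTruncate hy, splitMap_barTruncate, map_sum, map_add,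
    map_smul, F.d_extendedMk _ (S.incl_mem _) (S.d_incl _) (S.d_proj _),
    C.bar_d_barTruncate (S.entries_mem _ _ hy), entries_sumD, entries_sumContract,
    LinearMap.add_apply, LinearMap.smul_apply, Finset.sum_add_distrib, Finset.smul_sum]

/-- The map of bimodules `Bar(D) → D ⊗_C Bar(C) ⊗_C D` given by a splitting. -/
noncomputable def splitHom : DGBimodule.Hom D.bar F.extendedBar 0 where
  map := S.splitMap
  map_mem hx := by
    rw [add_zero]
    exact S.splitMap_mem hx
  map_lact x _ := by
    rw [SignedGrading.sgn_zero_left, one_smul]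
    exact S.splitMap_lact _ x
  map_ract x g := S.splitMap_ract x g

theorem splitHom_isClosed : S.splitHom.IsClosed :=
  (DGBimodule.Hom.isClosed_iff _).2 fun _ _ => S.splitMap_d

/-! ### The homotopy equivalence -/

/-- Summing F(E(y)_{ab})·π_b over b gives π_a·ε(y) by `sum_barSumMap_entries`, and ∑ σ_a π_a = 1
removes the remaining index. -/
theorem extendedBarMap_splitMap (y : D.BarSum Y Y') {n : ℕ} {i : Γ}
    (hy : y ∈ D.lenGrade (n + 1) i Y Y') :
    F.extendedBarMap Y Y' (S.splitMap Y Y' (D.barTruncate y)) =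
      D.barTruncate (S.expand Y y) := by
  have h : ∀ a b, F.extendedBarMap Y Y'
      (F.extendedMk (S.incl a) (C.barTruncate (S.entries b Y y a)) (S.proj b)) =
      D.barTruncate (D.sumLeft (S.incl a) (D.sumRight (S.proj b)
        (F.barSumMap _ (S.entries (Y' := Y') b Y y a)))) := fun a b => by
    rw [F.extendedBarMap_mk, F.barMap_barTruncate,
      D.barLact_barTruncate _ (F.barSumMap_mem (S.entries_mem b a hy)), koszul_incl,
      D.barRact_barTruncate, D.sumLeft_sumRight]
  rw [splitMap_barTruncate]
  simp only [map_sum, h]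
  simp only [← map_sum, sum_barSumMap_entries]
  simp only [← D.sumLeft_comp]
  rw [← LinearMap.sum_apply, ← map_sum, S.sum_incl_proj, D.sumLeft_one]

/-- The prism operator on the bar complex. -/
noncomputable def barPrism (Y Y' : D.Obj) : D.barComplex Y Y' →ₗ[k] D.barComplex Y Y' :=
  D.barDesc (D.barTruncate ∘ₗ S.prism Y)

theorem barPrism_barTruncate (y : D.BarSum Y Y') :
    S.barPrism Y Y' (D.barTruncate y) = D.barTruncate (S.prism Y y) :=
  D.barDesc_barTruncate (fun f => by rw [LinearMap.comp_apply, prism_nil, map_zero]) y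

theorem barPrism_mem {i : Γ} {x : D.barComplex Y Y'} (hx : x ∈ (D.barComplex Y Y').grade i) :
    S.barPrism Y Y' x ∈ (D.barComplex Y Y').grade (i + -G.ι) := by
  refine D.bar_grade_le_lenGrade
    (S := ((D.barComplex Y Y').grade (i + -G.ι)).comap (S.barPrism Y Y')) (fun n y hy => ?_) hx
  rw [Submodule.mem_comap, barPrism_barTruncate]
  -- The prism has one more object and the same tensor degree: r = n + 1, so its shift contributes
  -- one further −ι.
  refine D.barTruncate_mem (n := n + 1) ?_
  have e : i + -G.ι + (n + 1) • G.ι = i + n • G.ι := by rw [succ_nsmul]; abel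
  rw [e]
  exact S.prism_mem hy

/-- The prism is left linear without sign on the augmented complex. The sign here comes from the
left action, whose exponent r⟨ι,|g|⟩ grows by ⟨ι,|g|⟩ on the longer tensor. -/
theorem barPrism_lact {i : Γ} {g : D.hom W Y} (hg : g ∈ (D.hom W Y).grade i)
    (x : D.barComplex Y Y') :
    S.barPrism W Y' (D.barLact g x) =
      G.sgn k (-G.ι) i • D.barLact g (S.barPrism Y Y' x) := by
  refine LinearMap.congr_fun (f := S.barPrism W Y' ∘ₗ D.barLact g)
    (g := G.sgn k (-G.ι) i • (D.barLact g ∘ₗ S.barPrism Y Y'))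
    (D.bar_ext_lenGrade fun n j y hy => ?_) x
  rw [LinearMap.smul_apply, LinearMap.comp_apply, LinearMap.comp_apply,
    D.barLact_barTruncate g hy, barPrism_barTruncate, barPrism_barTruncate, prism_sumLeft,
    D.barLact_barTruncate g (S.prism_mem hy), succ_nsmul, DGModule.koszul_add,
    DGModule.koszul_of_mem _ G.ι hg, SignedGrading.sgn_neg_left]
  simp only [map_smul, LinearMap.smul_apply, smul_smul, SignedGrading.sgn_mul_self, one_smul]

theorem barPrism_ract (x : D.barComplex Y Y') (g : D.hom Y' W) :
    S.barPrism Y W (D.barRact x g) = D.barRact (S.barPrism Y Y' x) g := by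
  refine LinearMap.congr_fun (f := S.barPrism Y W ∘ₗ D.barRact.flip g)
    (g := D.barRact.flip g ∘ₗ S.barPrism Y Y') (D.bar_ext_lenGrade fun n i y _ => ?_) x
  simp only [LinearMap.comp_apply, LinearMap.flip_apply, D.barRact_barTruncate,
    barPrism_barTruncate, prism_sumRight]

/-- The prism operator as a map of bimodules. -/
noncomputable def barPrismHom : DGBimodule.Hom D.bar D.bar (-G.ι) where
  map := S.barPrism
  map_mem hx := S.barPrism_mem hx
  map_lact x hg := S.barPrism_lact hg x
  map_ract x g := S.barPrism_ract x g

/-- On r = n the internal parts of dP and Pd have the signs (-1)^(n+1) and (-1)^n. They cancel,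
because P commutes with the internal differential, and `sumContract_prism` remains. -/
theorem barPrism_homotopy (x : D.barComplex Y Y') :
    (D.barComplex Y Y').d (S.barPrism Y Y' x) + S.barPrism Y Y' ((D.barComplex Y Y').d x) =
      F.extendedBarMap Y Y' (S.splitMap Y Y' x) - x := by
  refine LinearMap.congr_fun
    (f := (D.barComplex Y Y').d ∘ₗ S.barPrism Y Y' + S.barPrism Y Y' ∘ₗ (D.barComplex Y Y').d)
    (g := F.extendedBarMap Y Y' ∘ₗ S.splitMap Y Y' - LinearMap.id) (D.bar_ext_lenGrade fun n i y hy => ?_) x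
  have h := congrArg D.barTruncate (S.sumContract_prism y)
  rw [map_add, map_sub] at h
  refine Eq.trans ?_ (h.trans (congrArg (· - D.barTruncate y)
    (S.extendedBarMap_splitMap y hy).symm))
  simp only [LinearMap.add_apply, LinearMap.comp_apply, barPrism_barTruncate,
    D.bar_d_barTruncate hy, D.bar_d_barTruncate (S.prism_mem hy), map_add, map_smul, prism_sumD,
    pow_succ, mul_neg_one, neg_smul]
  abel

theorem homotopic_extendedBarHom_splitHom :
    DGBimodule.Hom.Homotopic (F.extendedBarHom.comp S.splitHom) (DGBimodule.Hom.id D.bar) := by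
  refine ⟨S.barPrismHom, fun Y Y' => LinearMap.ext fun x => ?_⟩
  refine Eq.trans ?_ (S.barPrism_homotopy x)
  -- For a map h of degree −ι the differential is dh + hd, since ⟨ι, −ι⟩ = 1.
  rw [DGBimodule.Hom.dmap, SignedGrading.sgn_neg_right, SignedGrading.sgn_ι_ι, neg_one_smul,
    sub_neg_eq_add]
  rfl

end

/-- Every g·x·g' arises from 1·x·1 by the outer actions, with which both maps commute. The
hypothesis says that the splitting is trivial on bar elements coming from C. -/
theorem splitMap_extendedBarMap
    (h : ∀ {X X' : C.Obj} (x : C.barComplex X X'),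
      S.splitMap _ _ (F.barMap x) = F.extendedMk (D.one (F.obj X)) x (D.one (F.obj X')))
    {Y Y' : D.Obj} (x : F.extendedBar.obj Y Y') :
    S.splitMap Y Y' (F.extendedBarMap Y Y' x) = x := by
  refine LinearMap.congr_fun (f := S.splitMap Y Y' ∘ₗ F.extendedBarMap Y Y')
    (g := LinearMap.id) (F.extendedBar_ext fun X X' g x g' => ?_) x
  rw [LinearMap.comp_apply, F.extendedBarMap_mk, splitMap_ract, splitMap_lact, h,
    F.lact_extendedMk, F.ract_extendedMk, D.comp_one, D.one_comp, LinearMap.id_apply]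

/-- Only the composite on Bar(D) needs a homotopy, the prism; the other composite is strictly the
identity. -/
theorem splitHom_isHomotopyEquiv
    (h : ∀ {X X' : C.Obj} (x : C.barComplex X X'),
      S.splitMap _ _ (F.barMap x) = F.extendedMk (D.one (F.obj X)) x (D.one (F.obj X'))) :
    S.splitHom.IsHomotopyEquiv := by
  refine ⟨S.splitHom_isClosed, F.extendedBarHom, F.extendedBarHom_isClosed,
    S.homotopic_extendedBarHom_splitHom, ?_⟩
  rw [show S.splitHom.comp F.extendedBarHom = DGBimodule.Hom.id F.extendedBar from
    DGBimodule.Hom.ext (funext fun Y => funext fun Y' => LinearMap.ext fun x =>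
      S.splitMap_extendedBarMap h x)]
  exact DGBimodule.Hom.homotopic_refl _

end DGFunctor.Splitting

/-! ## The additive envelope -/

namespace DGCategory

variable {k : Type uk} [CommRing k] {Γ : Type ug} [AddCommGroup Γ] {G : SignedGrading Γ}
  (C : DGCategory.{uk, ug, u, v} k G)

theorem delta_mem (X : FormalSum.{uk, ug, u, v, t} C) (a b : X.Idx) :
    C.delta X a b ∈ (C.hom (X.obj a) (X.obj b)).grade 0 := by
  by_cases h : a = b
  · subst h
    rw [delta_self]
    exact C.one_mem _
  · rw [delta_of_ne X h]
    exact Submodule.zero_mem _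

theorem d_delta (X : FormalSum.{uk, ug, u, v, t} C) (a b : X.Idx) :
    (C.hom (X.obj a) (X.obj b)).d (C.delta X a b) = 0 := by
  by_cases h : a = b
  · subst h
    rw [delta_self, d_one]
  · rw [delta_of_ne X h, map_zero]

theorem sum_comp_delta {W : C.Obj} (X : FormalSum.{uk, ug, u, v, t} C) (b : X.Idx)
    (f : ∀ a, C.hom W (X.obj a)) : ∑ a, C.comp (f a) (C.delta X a b) = f b := by
  rw [Finset.sum_eq_single b, delta_self, C.comp_one]
  · intro a _ h
    rw [delta_of_ne _ h, map_zero]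
  · simp

theorem sum_delta_comp {W : C.Obj} (X : FormalSum.{uk, ug, u, v, t} C) (b : X.Idx)
    (f : ∀ a, C.hom (X.obj a) W) : ∑ a, C.comp (C.delta X b a) (f a) = f b := by
  rw [Finset.sum_eq_single b, delta_self, C.one_comp]
  · intro a _ h
    rw [delta_of_ne _ (Ne.symm h), map_zero, LinearMap.zero_apply]
  · simp

theorem inclusion_mem (X : FormalSum.{uk, ug, u, v, t} C) (a : X.Idx) :
    inclusion X a ∈ ((additiveEnvelope.{uk, ug, u, v, t} C).hom X
      (C.toEnvelope.obj (X.obj a))).grade 0 :=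
  (DGModule.mem_matrix_grade (A := X.Idx) (B := PUnit.{t + 1})
    (M := fun b _ => C.hom (X.obj b) (X.obj a))).2 fun b _ => C.delta_mem X b a

theorem projection_mem (X : FormalSum.{uk, ug, u, v, t} C) (a : X.Idx) :
    projection X a ∈ ((additiveEnvelope.{uk, ug, u, v, t} C).hom
      (C.toEnvelope.obj (X.obj a)) X).grade 0 :=
  (DGModule.mem_matrix_grade (A := PUnit.{t + 1}) (B := X.Idx)
    (M := fun _ b => C.hom (X.obj a) (X.obj b))).2 fun _ b => C.delta_mem X a b

theorem d_inclusion (X : FormalSum.{uk, ug, u, v, t} C) (a : X.Idx) :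
    ((additiveEnvelope.{uk, ug, u, v, t} C).hom X (C.toEnvelope.obj (X.obj a))).d
      (inclusion X a) = 0 :=
  DGModule.matrix_ext (A := X.Idx) (B := PUnit.{t + 1})
    (M := fun b _ => C.hom (X.obj b) (X.obj a)) fun b _ => C.d_delta X b a

theorem d_projection (X : FormalSum.{uk, ug, u, v, t} C) (a : X.Idx) :
    ((additiveEnvelope.{uk, ug, u, v, t} C).hom (C.toEnvelope.obj (X.obj a)) X).d
      (projection X a) = 0 :=
  DGModule.matrix_ext (A := PUnit.{t + 1}) (B := X.Idx)
    (M := fun _ b => C.hom (X.obj a) (X.obj b)) fun _ b => C.d_delta X a b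

theorem sum_inclusion_projection (X : FormalSum.{uk, ug, u, v, t} C) :
    ∑ a : X.Idx, (additiveEnvelope.{uk, ug, u, v, t} C).comp (inclusion X a) (projection X a) =
      (additiveEnvelope.{uk, ug, u, v, t} C).one X := by
  refine DGModule.matrix_ext (A := X.Idx) (B := X.Idx)
    (M := fun b c => C.hom (X.obj b) (X.obj c)) fun b c => ?_
  refine (map_sum (DGModule.entry (A := X.Idx) (B := X.Idx)
    (M := fun b c => C.hom (X.obj b) (X.obj c)) b c) _ _).trans ?_
  refine Eq.trans (Finset.sum_congr rfl fun a _ => ?_) (C.sum_delta_comp X b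
    fun a => C.delta X a c)
  -- The composite σ_a π_a passes through a one-term sum, so the matrix product has a single
  -- summand.
  exact Fintype.sum_unique (ι := PUnit.{t + 1})
    (fun _ => C.comp (C.delta X b a) (C.delta X a c))

/-- The matrix entries of a morphism of the additive envelope. -/
noncomputable def matrixEntry {X Y : FormalSum.{uk, ug, u, v, t} C} (a : X.Idx) (b : Y.Idx) :
    (additiveEnvelope.{uk, ug, u, v, t} C).hom X Y →ₗ[k] C.hom (X.obj a) (Y.obj b) :=
  DGModule.entry (M := fun a b => C.hom (X.obj a) (Y.obj b)) a b

theorem map_matrixEntry {X Y : FormalSum.{uk, ug, u, v, t} C} (a : X.Idx) (b : Y.Idx)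
    (f : (additiveEnvelope.{uk, ug, u, v, t} C).hom X Y) :
    C.toEnvelope.map (C.matrixEntry a b f) = (additiveEnvelope.{uk, ug, u, v, t} C).comp
      (projection X a) ((additiveEnvelope.{uk, ug, u, v, t} C).comp f (inclusion Y b)) := by
  refine DGModule.matrix_ext (A := PUnit.{t + 1}) (B := PUnit.{t + 1})
    (M := fun _ _ => C.hom (X.obj a) (Y.obj b)) fun _ _ => ?_
  refine Eq.trans ?_ (C.sum_delta_comp X a fun a' =>
    ∑ b', C.comp (C.matrixEntry a' b' f) (C.delta Y b' b)).symm
  exact (C.sum_comp_delta Y b fun b' => C.matrixEntry a b' f).symm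

/-- The decomposition of the objects of the additive envelope into their summands. -/
noncomputable def envelopeSplitting :
    DGFunctor.Splitting.{uk, ug, u, v, max u (t + 1), max v t, t}
      (C.toEnvelope : DGFunctor C (additiveEnvelope.{uk, ug, u, v, t} C)) where
  Idx := FormalSum.Idx (C := C)
  fintype := FormalSum.fintype (C := C)
  obj {Y} := FormalSum.obj (C := C) Y
  incl {Y} := inclusion (C := C) Y
  proj {Y} := projection (C := C) Y
  incl_mem {Y} := C.inclusion_mem Y
  proj_mem {Y} := C.projection_mem Y
  d_incl {Y} := C.d_inclusion Y
  d_proj {Y} := C.d_projection Y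
  sum_incl_proj := C.sum_inclusion_projection
  entry {X Y} := C.matrixEntry (X := X) (Y := Y)
  -- In the envelope, degrees and differentials are entrywise and composition is matrix
  -- multiplication, so these axioms hold by definition.
  entry_mem a b _ _ hf := hf a b
  entry_d _ _ _ := rfl
  entry_comp _ _ _ _ := rfl
  map_entry {X Y} := C.map_matrixEntry (X := X) (Y := Y)

/-- The only index of a formal sum with one term. -/
def singleIdx (X : C.Obj) :
    (envelopeSplitting.{uk, ug, u, v, t} C).Idx (C.toEnvelope.obj X) :=
  PUnit.unit.{t + 1}

/-! ### One-term sums: the splitting is trivial on C -/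

theorem sum_singleIdx {V : Type w} [AddCommMonoid V] (X : C.Obj)
    (f : (envelopeSplitting.{uk, ug, u, v, t} C).Idx (C.toEnvelope.obj X) → V) :
    ∑ a, f a = f (C.singleIdx X) :=
  Fintype.sum_unique (ι := PUnit.{t + 1}) f

/-- All objects involved are one-term sums, so each sum over indices has one term and the only entry
of the image of f is f. -/
theorem entries_barSumMap {X X' : C.Obj} (y : C.BarSum X X') :
    (envelopeSplitting.{uk, ug, u, v, t} C).entries (C.singleIdx X')
      (C.toEnvelope.obj X) (C.toEnvelope.barSumMap X y) (C.singleIdx X) = y := by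
  induction y using C.barSum_induction with
  | h0 X =>
    simp only [map_zero, Pi.zero_apply]
    rfl
  | hadd X x y hx hy =>
    simp only [map_add, Pi.add_apply, hx, hy]
    rfl
  | hnil X f =>
    rw [DGFunctor.barSumMap_nil, DGFunctor.Splitting.entries_nil]
    rfl
  | hcons X Z f y ih =>
    rw [DGFunctor.barSumMap_cons, DGFunctor.Splitting.entries_cons]
    rw [sum_singleIdx, ih]
    rfl

theorem splitMap_barMap {X X' : C.Obj} (x : C.barComplex X X') :
    (envelopeSplitting.{uk, ug, u, v, t} C).splitMap _ _ (C.toEnvelope.barMap x) =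
      C.toEnvelope.extendedMk ((additiveEnvelope.{uk, ug, u, v, t} C).one (C.toEnvelope.obj X)) x
        ((additiveEnvelope.{uk, ug, u, v, t} C).one (C.toEnvelope.obj X')) := by
  refine LinearMap.congr_fun
    (f := (envelopeSplitting.{uk, ug, u, v, t} C).splitMap _ _ ∘ₗ C.toEnvelope.barMap)
    (g := (C.toEnvelope.extendedMk
      ((additiveEnvelope.{uk, ug, u, v, t} C).one (C.toEnvelope.obj X))).flip
        ((additiveEnvelope.{uk, ug, u, v, t} C).one (C.toEnvelope.obj X')))
    (C.bar_ext_lenGrade fun n i y _ => ?_) x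
  rw [LinearMap.comp_apply, DGFunctor.barMap_barTruncate,
    DGFunctor.Splitting.splitMap_barTruncate, sum_singleIdx, sum_singleIdx]
  -- The inclusion and the projection of a one-term sum are definitionally its identity matrix.
  exact congrArg (fun z => C.toEnvelope.extendedMk
    ((additiveEnvelope.{uk, ug, u, v, t} C).one (C.toEnvelope.obj X)) (C.barTruncate z)
      ((additiveEnvelope.{uk, ug, u, v, t} C).one (C.toEnvelope.obj X'))) (C.entries_barSumMap y)

/-- The index of a summand, regarded as an index for the splitting of the envelope. -/
def summandIdx {Y : FormalSum.{uk, ug, u, v, t} C} (a : Y.Idx) :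
    (envelopeSplitting.{uk, ug, u, v, t} C).Idx Y :=
  a

/-! ### The explicit formula on brackets, and uniqueness -/

theorem sum_choice_nil {V : Type w} [AddCommMonoid V]
    (g : Choice ([] : List (FormalSum.{uk, ug, u, v, t} C)) → V) : ∑ c, g c = g PUnit.unit :=
  Fintype.sum_unique (ι := PUnit.{t + 1}) g

theorem sum_choice_cons {V : Type w} [AddCommMonoid V] (X : FormalSum.{uk, ug, u, v, t} C)
    (L : List (FormalSum.{uk, ug, u, v, t} C)) (g : Choice (X :: L) → V) :
    ∑ c, g c = ∑ c : X.Idx, ∑ c' : Choice L, g (c, c') := by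
  let _ := choiceFintype L
  exact Fintype.sum_prod_type (α₁ := X.Idx) (α₂ := Choice L) g

/-- The recursion sums over the index of one object at a time; expanding all these sums gives a
single sum over the choices of all intermediate indices. -/
theorem entries_simpleTensor {Y' : FormalSum.{uk, ug, u, v, t} C} (b : Y'.Idx)
    (L : List (FormalSum.{uk, ug, u, v, t} C)) {Y : FormalSum.{uk, ug, u, v, t} C}
    (f : (additiveEnvelope.{uk, ug, u, v, t} C).Sequence Y L Y') (a : Y.Idx) :
    (envelopeSplitting.{uk, ug, u, v, t} C).entries (C.summandIdx b) Y
      ((additiveEnvelope.{uk, ug, u, v, t} C).sumIn L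
        ((additiveEnvelope.{uk, ug, u, v, t} C).simpleTensor Y L Y' f)) (C.summandIdx a) =
      ∑ c : Choice L, C.sumIn (pick L c) (C.simpleTensor _ _ _ (entries L f a c b)) := by
  induction L generalizing Y with
  | nil =>
    rw [sum_choice_nil]
    exact DGFunctor.Splitting.entries_nil (envelopeSplitting.{uk, ug, u, v, t} C)
      (C.summandIdx b) (C.summandIdx a) f
  | cons X L ih =>
    rw [sum_choice_cons]
    refine (DGFunctor.Splitting.entries_sumIn_cons (envelopeSplitting.{uk, ug, u, v, t} C)
      (X := X) (C.summandIdx b) (C.summandIdx a) f.1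
      ((additiveEnvelope.{uk, ug, u, v, t} C).simpleTensor X L Y' f.2)).trans ?_
    have h : ∀ c : X.Idx, C.barCons (C.matrixEntry a c f.1)
        ((envelopeSplitting.{uk, ug, u, v, t} C).entries (C.summandIdx b) X
          ((additiveEnvelope.{uk, ug, u, v, t} C).sumIn L
            ((additiveEnvelope.{uk, ug, u, v, t} C).simpleTensor X L Y' f.2)) (C.summandIdx c)) =
        ∑ c' : Choice L, C.sumIn (X.obj c :: pick L c') (C.tcons (pick L c')
          (C.matrixEntry a c f.1) (C.simpleTensor _ _ _ (entries L f.2 c c' b))) := fun c =>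
      (congrArg (C.barCons (C.matrixEntry a c f.1)) (ih f.2 c)).trans
        ((map_sum (C.barCons (C.matrixEntry a c f.1)) _ _).trans
          (Finset.sum_congr rfl fun _ _ => C.barCons_sumIn _ _))
    exact Finset.sum_congr rfl fun c _ => h c

theorem splitMap_barIn_simpleTensor {Y Y' X : FormalSum.{uk, ug, u, v, t} C}
    {L : List (FormalSum.{uk, ug, u, v, t} C)}
    (f : (additiveEnvelope.{uk, ug, u, v, t} C).Sequence Y (X :: L) Y') :
    (envelopeSplitting.{uk, ug, u, v, t} C).splitMap Y Y'
      ((additiveEnvelope.{uk, ug, u, v, t} C).barIn X L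
        ((additiveEnvelope.{uk, ug, u, v, t} C).simpleTensor Y (X :: L) Y' f)) =
      ∑ a : Y.Idx, ∑ c : Choice (X :: L), ∑ b : Y'.Idx,
        C.toEnvelope.extendedMk (inclusion Y a) (C.barIn (X.obj c.1) (pick L c.2)
          (C.simpleTensor _ _ _ (entries (X :: L) f a c b))) (projection Y' b) := by
  refine (DGFunctor.Splitting.splitMap_barIn (envelopeSplitting.{uk, ug, u, v, t} C)
    (X := X) (L := L) _).trans ?_
  have h : ∀ (a : Y.Idx) (b : Y'.Idx),
      (C.barTruncate ((envelopeSplitting.{uk, ug, u, v, t} C).entries (C.summandIdx b) Y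
        ((additiveEnvelope.{uk, ug, u, v, t} C).sumIn (X :: L)
          ((additiveEnvelope.{uk, ug, u, v, t} C).simpleTensor Y (X :: L) Y' f))
            (C.summandIdx a)) : C.barComplex (Y.obj a) (Y'.obj b)) =
      ∑ c : Choice (X :: L), C.barIn (X.obj c.1) (pick L c.2)
        (C.simpleTensor _ _ _ (entries (X :: L) f a c b)) := fun a b =>
    (congrArg C.barTruncate (C.entries_simpleTensor b (X :: L) f a)).trans
      ((map_sum C.barTruncate _ _).trans (Finset.sum_congr rfl fun _ _ =>
        C.barTruncate_cons _ _ _))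
  have h' : ∀ (a : Y.Idx) (b : Y'.Idx) (x : Choice (X :: L) → C.barComplex (Y.obj a) (Y'.obj b)),
      C.toEnvelope.extendedMk (inclusion Y a) (∑ c, x c) (projection Y' b) =
        ∑ c, C.toEnvelope.extendedMk (inclusion Y a) (x c) (projection Y' b) := fun a b x => by
    rw [map_sum, LinearMap.sum_apply]
  -- The map sums over both outer indices first; the formula has the intermediate indices between
  -- them, so the sums over b and c are exchanged.
  have h'' : ∀ a : Y.Idx, ∑ b : Y'.Idx, C.toEnvelope.extendedMk (inclusion Y a)
      (∑ c : Choice (X :: L), C.barIn (X.obj c.1) (pick L c.2)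
        (C.simpleTensor _ _ _ (entries (X :: L) f a c b))) (projection Y' b) =
      ∑ c : Choice (X :: L), ∑ b : Y'.Idx, C.toEnvelope.extendedMk (inclusion Y a)
        (C.barIn (X.obj c.1) (pick L c.2)
          (C.simpleTensor _ _ _ (entries (X :: L) f a c b))) (projection Y' b) := fun a =>
    (Finset.sum_congr rfl fun b _ => h' a b _).trans Finset.sum_comm
  refine Eq.trans ?_ (Finset.sum_congr rfl fun a _ => h'' a)
  exact Finset.sum_congr rfl fun a _ => Finset.sum_congr rfl fun b _ =>
    congrArg (fun z => C.toEnvelope.extendedMk (inclusion Y a) z (projection Y' b)) (h a b)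

/-- The target `inducedBar` and the extension of the bar complex along `toEnvelope` are
definitionally equal, as are their generators, so the formula on simple tensors is the required one.
-/
theorem sumsOverIndices_splitMap :
    C.SumsOverIndices (envelopeSplitting.{uk, ug, u, v, t} C).splitHom.map :=
  fun _ _ _ _ f => C.splitMap_barIn_simpleTensor f

/-- Brackets are the images of simple tensors and span the bar complex, so the formula leaves no
freedom. -/
theorem SumsOverIndices.ext {φ ψ : ∀ Y Y' : FormalSum.{uk, ug, u, v, t} C,
    (additiveEnvelope.{uk, ug, u, v, t} C).bar.obj Y Y' →ₗ[k]
      (inducedBar.{uk, ug, u, v, t} C).obj Y Y'} (hφ : C.SumsOverIndices φ)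
    (hψ : C.SumsOverIndices ψ) : φ = ψ := by
  funext Y Y'
  refine (additiveEnvelope.{uk, ug, u, v, t} C).bar_ext (a := φ Y Y') (b := ψ Y Y')
    fun X L t => ?_
  exact LinearMap.congr_fun ((additiveEnvelope.{uk, ug, u, v, t} C).simpleTensor_ext (X :: L)
    (a := φ Y Y' ∘ₗ (additiveEnvelope.{uk, ug, u, v, t} C).barIn X L)
    (b := ψ Y Y' ∘ₗ (additiveEnvelope.{uk, ug, u, v, t} C).barIn X L)
    fun f => (hφ Y Y' X L f).trans (hψ Y Y' X L f).symm) t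

end DGCategory

theorem mainTheorem6 {k : Type uk} [CommRing k] {Γ : Type ug} [AddCommGroup Γ]
    (G : SignedGrading Γ) (C : DGCategory.{uk, ug, u, v} k G) :
    ∃ Ξ : DGBimodule.Hom (DGCategory.additiveEnvelope.{uk, ug, u, v, t} C).bar
        (DGCategory.inducedBar.{uk, ug, u, v, t} C) 0,
      C.SumsOverIndices Ξ.map ∧
      (∀ φ, C.SumsOverIndices φ → φ = Ξ.map) ∧
      Ξ.IsClosed ∧
      Ξ.IsHomotopyEquiv :=
  -- Well-definedness needs no separate check: the map is constructed linearly on all tensors by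
  -- recursion, and the formula is derived for it afterwards.
  ⟨C.envelopeSplitting.splitHom, C.sumsOverIndices_splitMap,
    fun _ hφ => hφ.ext C C.sumsOverIndices_splitMap, C.envelopeSplitting.splitHom_isClosed,
    C.envelopeSplitting.splitHom_isHomotopyEquiv C.splitMap_barMap⟩
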